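/- Let $d\ge 1$, $k\ge 0$, and let $D\subset\mathbb R^d$ be a bounded open convex set containing the origin, with gauge function $\gamma(x)=\inf\{s\ge 0: x\in sD\}$ and support function $\zeta_D(u)=\sup_{x\in D}\langle x,u\rangle$. Let $g:[0,\infty)\to(0,\infty)$ be such that $f=g\circ\gamma$ is a probability density on $\mathbb R^d$. Let $\|\theta\|=1$, $H(\theta)=\{x:\langle\theta,x\rangle\ge \zeta_D(\theta)\}$ and $H_n(\theta)=t_nH(\theta)$, where $t_n\to\infty$ and $t_n=o(n^{1/d})$. Let $h=(h_s)_{s\ge 0}$ be nonnegative symmetric measurable functions of $(x_0,\dots,x_k)\in(\mathbb R^d)^{k+1}$ such that each $h_s$ is translation invariant; for some $\kappa$, $h_1(x_0,\dots,x_k)>0$ implies $\mathrm{diam}\{x_0,\dots,x_k\}\le\kappa$; $h_s(cx_0,\dots,cx_k)=h_{s/c}(x_0,\dots,x_k)$ for $c>0$; and $h_s\le M$ for some constant $M$ and all $s$. Let $r_n>0$ with $r_n\to r\in(0,\infty)$. Let $\mathcal P_n^\theta$ be a Poisson process with intensity $n f_n$, where $f_n=f\mathbf 1_{H_n(\theta)}/\int_{H_n(\theta)}f$,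 and let $$S^*_{k,n}(\theta)=\frac1{(k+1)!}\sum h_{r_n}(x_0,\dots,x_k),$$ the sum being over all $(k+1)$-tuples of pairwise distinct points of $\mathcal P_n^\theta$. In each of the cases below $S^*_{k,n}(\theta)$ is square integrable for every $n$. For sequences, $a_n=\Theta(b_n)$ means $a_n=O(b_n)$ and $b_n=O(a_n)$ as $n\to\infty$. **Light tails.** Suppose that $D$ is rotund: $\overline D$ is strictly convex, $\gamma$ is $C^2$ on $\mathbb R^d\setminus\{0\}$, and the Hessian of $\gamma^2$ is positive definite there. Then an initial transformation exists, that is, an invertible linear map $A$ of $\mathbb R^d=\mathbb R^{d-1}\times\mathbb R$ such that $\partial D\cap H(\theta)=\{A(0,1)\}$, $A(\{(u,v): v\ge 1\})=H(\theta)$ and $\gamma(A(u,1))-\gamma(A(0,1))\sim\|u\|^2/2$ as $u\to 0$. Put $e_d=(0,1)$ and $p=A(e_d)$. Suppose that $g=Ce^{-\psi}$ with $C>0$, where $\psi$ is continuous on $[0,\infty)$, $C^2$ on $(0,\infty)$, $\psi'>0$ on $(0,\infty)$, $\psi(t)\to\infty$ and $(1/\psi')'(t)\to0$ as $t\to\infty$.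 Let $a=1/\psi'$, $q_n=(a(t_n)t_n)^{(d-1)/2}a(t_n)$, and suppose that $a(t_n)\to\xi\in[0,\infty]$. 1. Let $\xi=0$ and $\sqrt{a(t_n)t_n}\to\beta<\infty$. Then $\mathrm{Var}(S^*_{k,n}(\theta))=O(n^{2k+1})$. If moreover, for an initial transformation $A$, $h_r$ is continuous at $(A(\beta u_0,0),\dots,A(\beta u_k,0))$ for almost every $(u_0,\dots,u_k)\in(\mathbb R^{d-1})^{k+1}$ and $$|\det A|^{2k+1}\int_{(\mathbb R^{d-1})^{2k+1}}h_r\big(A(\beta u_0,0),A(\beta u_1,0),\dots,A(\beta u_k,0)\big)\,h_r\big(A(\beta u_0,0),A(\beta u_{k+1},0),\dots,A(\beta u_{2k},0)\big)\prod_{i=0}^{2k}e^{-\|u_i\|^2/2}\,du_i>0,$$ then $\mathrm{Var}(S^*_{k,n}(\theta))=\Theta(n^{2k+1})$. 2. Let $\xi>0$ (with $\xi^{-1}=0$ if $\xi=\infty$). Then $\mathrm{Var}(S^*_{k,n}(\theta))=O(n^{2k+1}/q_n^{2k})$. If moreover, for an initial transformation $A$, $$|\det A|\int_{\mathbb R^{d-1}}\int_0^\infty\int_{(\mathbb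 R^d)^{2k}}h_1(0,y_1,\dots,y_k)\,h_1(0,y_{k+1},\dots,y_{2k})\prod_{i=1}^{2k}\mathbf 1\{v\ge -r\xi^{-1}\langle A^{-1}y_i,e_d\rangle\}\,e^{-(2k+1)(\|u\|^2/2+v)-r\xi^{-1}\sum_{i=1}^{2k}\langle\nabla\gamma(p),y_i\rangle}\,dy\,dv\,du>0,$$ then $\mathrm{Var}(S^*_{k,n}(\theta))=\Theta(n^{2k+1}/q_n^{2k})$. **Regularly varying tails.** Suppose (for $D$ not necessarily rotund) that $g$ is nonincreasing and $g(tx)/g(t)\to x^{-\alpha}$ as $t\to\infty$ for all $x>0$, where $\alpha>d$. Then $\mathrm{Var}(S^*_{k,n}(\theta))=O(n^{2k+1}/t_n^{2dk})$. If moreover $$\int_{H(\theta)}\int_{(\mathbb R^d)^{2k}}h_1(0,y_1,\dots,y_k)\,h_1(0,y_{k+1},\dots,y_{2k})\,\gamma(x)^{-\alpha(2k+1)}\,dy\,dx>0,$$ then $\mathrm{Var}(S^*_{k,n}(\theta))=\Theta(n^{2k+1}/t_n^{2dk})$. -/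

import Mathlib

open MeasureTheory ProbabilityTheory Filter Topology Asymptotics Set
open scoped ENNReal NNReal Pointwise

noncomputable section

/-- The ambient space `ℝ^d` with `d = m + 1` (so that `d` ranges over all dimensions `d ≥ 1`). -/
abbrev Space (m : ℕ) : Type := EuclideanSpace ℝ (Fin (m + 1))

/-- The horizontal space `ℝ^(d-1)`. -/
abbrev Horiz (m : ℕ) : Type := EuclideanSpace ℝ (Fin m)

/-- The point `(u, v)` of `ℝ^d` with horizontal part `u ∈ ℝ^(d-1)` and vertical coordinate `v`. -/
def joinUV {m : ℕ} (u : Horiz m) (v : ℝ) : Space m :=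
  WithLp.toLp 2 (Fin.snoc (α := fun _ : Fin (m + 1) => ℝ) (fun i => u i) v)

/-- The vertical coordinate `v = ⟨x, e_d⟩` of a point. -/
def vert {m : ℕ} (x : Space m) : ℝ := x (Fin.last m)

/-! ### Convex geometry -/

/-- The support function `ζ_D(u) = sup {⟨x, u⟩ : x ∈ D}`. -/
def supportFn {m : ℕ} (D : Set (Space m)) (u : Space m) : ℝ :=
  sSup ((fun x => inner ℝ x u) '' D)

/-- The outer support halfspace `H(θ) = {x : ⟨θ, x⟩ ≥ ζ_D(θ)}`. -/
def outerHalfspace {m : ℕ} (D : Set (Space m)) (θ : Space m) : Set (Space m) :=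
  {x | supportFn D θ ≤ inner ℝ θ x}

/-- Rotund sets: open, bounded, strictly convex sets containing the origin whose gauge function
`γ` is `C²` off the origin, with the Hessian of `γ²` positive definite off the origin.
Strict convexity (no segment in the boundary) is stated for the closure, since
`StrictConvex ℝ D` holds for every open convex set `D`. -/
structure IsRotund {m : ℕ} (D : Set (Space m)) : Prop where
  isOpen : IsOpen D
  isBounded : Bornology.IsBounded D
  convex : Convex ℝ D
  strictConvex : StrictConvex ℝ (closure D)
  zero_mem : (0 : Space m) ∈ D
  contDiffOn_gauge : ContDiffOn ℝ 2 (gauge D) {0}ᶜ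
  hessian_pos : ∀ x : Space m, x ≠ 0 → ∀ w : Space m, w ≠ 0 →
    0 < iteratedFDeriv ℝ 2 (fun y => gauge D y ^ 2) x ![w, w]

/-- `A` is an initial transformation of `D` at the angle `θ`: it maps `e_d` to the contact point
`p(θ)`, where `∂D ∩ H(θ) = {p(θ)}`, it maps `{v ≥ 1}` onto `H(θ)`, and `A⁻¹ D` is in correct initial
position. -/
structure IsInitialTransformation {m : ℕ} (D : Set (Space m)) (θ : Space m)
    (A : Space m ≃L[ℝ] Space m) : Prop where
  contact : frontier D ∩ outerHalfspace D θ = {A (joinUV 0 1)}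
  image_halfspace : A '' {x | 1 ≤ vert x} = outerHalfspace D θ
  correct_position :
    (fun u : Horiz m => gauge D (A (joinUV u 1)) - gauge D (A (joinUV 0 1)))
      ~[𝓝 0] (fun u : Horiz m => ‖u‖ ^ 2 / 2)

/-- `z_D(θ) = |det A|`. -/
def absDet {m : ℕ} (A : Space m ≃L[ℝ] Space m) : ℝ :=
  |(A : Space m →L[ℝ] Space m).det|

/-! ### Kernels and U-statistics -/

/-- The kernels `h = (h_r)_{r ≥ 0}` on `(k+1)`-tuples of points: nonnegative symmetric measurable
functions that are translation invariant, locally determined, scale with `r` and are uniformly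
bounded. -/
structure IsUKernel {m : ℕ} (k : ℕ) (h : ℝ → (Fin (k + 1) → Space m) → ℝ) : Prop where
  nonneg : ∀ r, 0 ≤ r → ∀ x, 0 ≤ h r x
  measurable : ∀ r, 0 ≤ r → Measurable (h r)
  symmetric : ∀ r, 0 ≤ r → ∀ (σ : Equiv.Perm (Fin (k + 1))) x, h r (fun i => x (σ i)) = h r x
  translation_invariant : ∀ r, 0 ≤ r → ∀ (y : Space m) x, h r (fun i => x i + y) = h r x
  locally_determined : ∃ κ : ℝ, ∀ x, 0 < h 1 x → Metric.diam (range x) ≤ κ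
  scaling : ∀ r, 0 ≤ r → ∀ s : ℝ, 0 < s → ∀ x, h r (fun i => s • x i) = h (r / s) x
  bounded : ∃ M : ℝ, ∀ r, 0 ≤ r → ∀ x, h r x ≤ M

/-- `S_k(X, r) = (1/(k+1)!) ∑ h_r(x_0, …, x_k)`, the sum over all `(k+1)`-tuples of pairwise
distinct points of the configuration `X`. -/
def uStat {m : ℕ} (k : ℕ) (h : ℝ → (Fin (k + 1) → Space m) → ℝ) (X : Set (Space m)) (r : ℝ) : ℝ :=
  (1 / ((k + 1).factorial : ℝ)) *
    ∑' x : {x : Fin (k + 1) → Space m // Function.Injective x ∧ ∀ i, x i ∈ X}, h r x.1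

/-! ### Poisson processes -/

/-- The random set of points `N` is a (simple) Poisson process with intensity measure `Λ` under
the probability measure `P`: numbers of points in measurable sets are Poisson random variables, and
they are independent for disjoint sets. -/
structure IsPoissonProcess {E Ω : Type*} [MeasurableSpace E] [MeasurableSpace Ω]
    (P : Measure Ω) (Λ : Measure E) (N : Ω → Set E) : Prop where
  measurable_count : ∀ B, MeasurableSet B → Measurable (fun ω => (N ω ∩ B).encard)
  law_count : ∀ B, MeasurableSet B → Λ B ≠ ⊤ → ∀ j : ℕ,
    P {ω | (N ω ∩ B).encard = (j : ℕ∞)} = poissonMeasure (Λ B).toNNReal {j}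
  law_count_top : ∀ B, MeasurableSet B → Λ B = ⊤ → ∀ᵐ ω ∂P, (N ω ∩ B).encard = ⊤
  indep_count : ∀ (j : ℕ) (B : Fin j → Set E), (∀ i, MeasurableSet (B i)) →
    Pairwise (fun i i' => Disjoint (B i) (B i')) →
    iIndepFun (fun i ω => (N ω ∩ B i).encard) P

/-- The density `f = g ∘ γ_D` with density generator `g`. -/
def homDensity {m : ℕ} (D : Set (Space m)) (g : ℝ → ℝ) (x : Space m) : ℝ := g (gauge D x)

/-- The density `f` conditioned on the set `H`: `f 1_H / ∫_H f`. -/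
def condDensity {m : ℕ} (f : Space m → ℝ) (H : Set (Space m)) (x : Space m) : ℝ :=
  H.indicator f x / ∫ y in H, f y

/-- The intensity measure `n f_n(x) dx`, where `f_n` is `f = g ∘ γ_D` conditioned on the halfspace
`H_n(θ) = t H(θ)`. -/
def condIntensity {m : ℕ} (D : Set (Space m)) (g : ℝ → ℝ) (θ : Space m) (t : ℝ) (n : ℕ) :
    Measure (Space m) :=
  volume.withDensity fun x =>
    ENNReal.ofReal ((n : ℝ) * condDensity (homDensity D g) (t • outerHalfspace D θ) x)

/-! ### Tails -/

/-- Von Mises functions on `[0, ∞)`. -/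
structure IsVonMises (ψ : ℝ → ℝ) : Prop where
  continuousOn : ContinuousOn ψ (Ici 0)
  contDiffOn : ContDiffOn ℝ 2 ψ (Ioi 0)
  deriv_pos : ∀ t, 0 < t → 0 < deriv ψ t
  tendsto_atTop : Tendsto ψ atTop atTop
  tendsto_deriv : Tendsto (deriv fun s => 1 / deriv ψ s) atTop (𝓝 0)

/-- `a(t) = 1 / ψ'(t)`. -/
def scaleFn (ψ : ℝ → ℝ) (t : ℝ) : ℝ := 1 / deriv ψ t

/-- `q = (a(t) t)^((d-1)/2) a(t)`, where `d = m + 1`. -/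
def qFn (m : ℕ) (ψ : ℝ → ℝ) (t : ℝ) : ℝ :=
  (scaleFn ψ t * t) ^ ((m : ℝ) / 2) * scaleFn ψ t

/-- `g` is regularly varying at infinity with tail index `α`. -/
def IsRegVarying (g : ℝ → ℝ) (α : ℝ) : Prop :=
  ∀ x : ℝ, 0 < x → Tendsto (fun t => g (t * x) / g t) atTop (𝓝 (x ^ (-α)))

/-! ### The leading limit integrals of the variance -/

/-- The integral `I_{k,1}` for light tails with `ξ = 0` and `b(t_n) → β < ∞`. The variables are
`u_0`, `(u_1, …, u_k)` and `(u_{k+1}, …, u_{2k})`. -/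
def limitIntegralLite {m : ℕ} (k : ℕ) (h : ℝ → (Fin (k + 1) → Space m) → ℝ)
    (A : Space m ≃L[ℝ] Space m) (r β : ℝ) : ℝ≥0∞ :=
  ENNReal.ofReal (absDet A ^ (2 * k + 1)) *
    ∫⁻ u₀ : Horiz m, ∫⁻ u : Fin k → Horiz m, ∫⁻ u' : Fin k → Horiz m,
      ENNReal.ofReal
        (h r (fun i => A (joinUV (β • (Fin.cons u₀ u : Fin (k + 1) → Horiz m) i) 0)) *
          h r (fun i => A (joinUV (β • (Fin.cons u₀ u' : Fin (k + 1) → Horiz m) i) 0)) *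
          (Real.exp (-‖u₀‖ ^ 2 / 2) * (∏ i, Real.exp (-‖u i‖ ^ 2 / 2)) *
            ∏ i, Real.exp (-‖u' i‖ ^ 2 / 2)))

open Classical in
/-- The integral `I_{k,1}` for light tails with `ξ > 0`, as a function of `ξinv = 1/ξ` (which is
`0` if `ξ = ∞`); the point `A e_d` is `p(θ)`. The variables are
`x = (u, v)`, `(y_1, …, y_k)` and `(y_{k+1}, …, y_{2k})`. -/
def limitIntegralExp {m : ℕ} (k : ℕ) (h : ℝ → (Fin (k + 1) → Space m) → ℝ)
    (D : Set (Space m)) (A : Space m ≃L[ℝ] Space m) (r ξinv : ℝ) : ℝ≥0∞ :=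
  ENNReal.ofReal (absDet A) *
    ∫⁻ u : Horiz m, ∫⁻ v in Ici (0 : ℝ), ∫⁻ y : Fin k → Space m, ∫⁻ y' : Fin k → Space m,
      if (∀ i, -(r * ξinv * vert (A.symm (y i))) ≤ v) ∧
          (∀ i, -(r * ξinv * vert (A.symm (y' i))) ≤ v) then
        ENNReal.ofReal
          (h 1 (Fin.cons 0 y) * h 1 (Fin.cons 0 y') *
            Real.exp (-((2 * k + 1 : ℝ) * (‖u‖ ^ 2 / 2 + v)) -
              r * ξinv * ((∑ i, inner ℝ (gradient (gauge D) (A (joinUV 0 1))) (y i)) +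
                ∑ i, inner ℝ (gradient (gauge D) (A (joinUV 0 1))) (y' i))))
      else 0

/-- The integral `H_{k,1}` for regularly varying tails with index `α`. -/
def limitIntegralHeavy {m : ℕ} (k : ℕ) (h : ℝ → (Fin (k + 1) → Space m) → ℝ)
    (D : Set (Space m)) (θ : Space m) (α : ℝ) : ℝ≥0∞ :=
  ∫⁻ x in outerHalfspace D θ, ∫⁻ y : Fin k → Space m, ∫⁻ y' : Fin k → Space m,
    ENNReal.ofReal
      (h 1 (Fin.cons 0 y) * h 1 (Fin.cons 0 y') * gauge D x ^ (-(α * (2 * k + 1))))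

end

/-! No limit of the variance is computed; the order of growth follows from a two-sided bound valid
for every Poisson process with finite diffuse intensity Λ. Let T be the sum of a kernel F ≤ M over
tuples of k+1 distinct points, I its mean, ρ a bound for the diameter of tuples with F > 0, and L a
bound for the Λ-mass of balls of radius ρ. By the Mecke formula (`lintegral_tupleSum`), pairs of
tuples without a common point contribute exactly I² to E T². Pairs with a common point number at
most a constant times the points plus the stars of 2k+1 points, so Var T ≤ C M² Λ(E)(1 + L^(2k)).
For the lower bound, T is compared with the number N of points: Cov(T, N) ≥ (k+1) I and Var N ≤
Λ(E), so Cauchy–Schwarz gives ((k+1) I)² ≤ Λ(E) Var T. Both bounds are in `variance_tupleSum`.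

It remains to understand the intensity n f 1_H / ∫_H f on H = tH(θ). Since γ ≥ t there and g
decreases, f ≤ g(t). The normalising integral is of order Q g(t), with Q = q for light tails and Q =
t^d for heavy ones. Hence balls of bounded radius have mass O(n/Q), and Var = O(n (n/Q)^(2k)) as
soon as Q ≤ n, which is what t = o(n^(1/d)) provides. Conversely, on a set of volume of order Q next
to the contact point (a box for light tails, a ball for heavy ones) f is at least a constant times
g(t). When kernels of bounded range fit inside this set, I is at least of order n^(k+1)/Q^k, which
gives the matching lower bound; the positivity of the limit integral is needed only to know that
h_1(0, ·) is not almost everywhere zero.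

If ξ = 0 and β < ∞, the box has vertical thickness a → 0 and horizontal size √(at) → β, and kernels
need not fit. Balls are then bounded by the total mass n, and the lower bound comes from small boxes
around a flat configuration at which h_r is positive and continuous.

For light tails the two analytic inputs are the growth of the gauge around the contact point
(`exists_mul_le_gauge_sub`), measured in units √(at) horizontally and a vertically, and the
estimates `sub_le` and `mul_log_le_sub` for ψ, both consequences of a' → 0. -/

/-! ### Sums over tuples of distinct points -/

section TupleSums

variable {E : Type*}

/-- The `j`-tuples of pairwise distinct points of `X`. -/
def injTuples (j : ℕ) (X : Set E) : Set (Fin j → E) :=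
  {x | Function.Injective x ∧ ∀ i, x i ∈ X}

/-- The sum of `F` over all `j`-tuples of pairwise distinct points of `X`. -/
noncomputable def tupleSum {j : ℕ} (X : Set E) (F : (Fin j → E) → ℝ≥0∞) : ℝ≥0∞ :=
  ∑' x, (injTuples j X).indicator F x

theorem injTuples_finite (j : ℕ) {X : Set E} (hX : X.Finite) : (injTuples j X).Finite :=
  (Set.Finite.pi' fun _ : Fin j => hX).subset fun _ hx => hx.2

theorem tsum_pi_prod {j : ℕ} (f : Fin j → E → ℝ≥0∞) :
    ∑' x : Fin j → E, ∏ i, f i (x i) = ∏ i, ∑' y, f i y := by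
  induction j with
  | zero => simp
  | succ j ih =>
    rw [← (Fin.consEquiv fun _ => E).tsum_eq]
    simp only [Fin.consEquiv, Equiv.coe_fn_mk, Fin.prod_univ_succ, Fin.cons_zero, Fin.cons_succ]
    rw [ENNReal.tsum_prod' (f := fun p : E × (Fin j → E) => f 0 p.1 * ∏ i, f (Fin.succ i) (p.2 i))]
    simp only [ENNReal.tsum_mul_left, ih fun i => f i.succ, ENNReal.tsum_mul_right]

theorem tsum_indicator_one (s : Set E) :
    ∑' y, s.indicator (1 : E → ℝ≥0∞) y = (s.encard : ℝ≥0∞) := by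
  rw [← tsum_subtype, ← ENNReal.tsum_set_one]; rfl

theorem prod_indicator_one {j : ℕ} (s : Fin j → Set E) (x : Fin j → E) :
    ∏ i, (s i).indicator (1 : E → ℝ≥0∞) (x i) = (univ.pi s).indicator 1 x := by
  by_cases hx : x ∈ univ.pi s
  · rw [indicator_of_mem hx]
    exact Finset.prod_eq_one fun i _ => indicator_of_mem (hx i trivial) _
  · rw [indicator_of_notMem hx]
    simp only [Set.mem_pi, mem_univ, true_implies, not_forall] at hx
    obtain ⟨i, hi⟩ := hx
    exact Finset.prod_eq_zero (Finset.mem_univ i) (indicator_of_notMem hi _)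

/-- Disjoint sides force distinct entries, so the sum factors into counts of points in disjoint
sets. This is the form in which independence of the Poisson counts can be used. -/
theorem tupleSum_box {j : ℕ} (X : Set E) {Q : Fin j → Set E}
    (hQ : Pairwise fun i i' => Disjoint (Q i) (Q i')) :
    tupleSum X ((univ.pi Q).indicator 1) = ∏ i, ((X ∩ Q i).encard : ℝ≥0∞) := by
  simp only [← tsum_indicator_one, ← tsum_pi_prod, prod_indicator_one, tupleSum]
  congr 1 with x
  rw [← indicator_indicator_eq_inter x]
  where
  indicator_indicator_eq_inter (x : Fin j → E) :
      (injTuples j X).indicator ((univ.pi Q).indicator 1) x =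
        (univ.pi fun i => X ∩ Q i).indicator (1 : (Fin j → E) → ℝ≥0∞) x := by
    rw [indicator_indicator]
    congr 1
    ext y
    constructor
    · exact fun hy i _ => ⟨hy.1.2 i, hy.2 i trivial⟩
    · intro hy
      refine ⟨⟨fun i i' h => ?_, fun i => (hy i trivial).1⟩, fun i _ => (hy i trivial).2⟩
      by_contra hne
      exact disjoint_left.1 (hQ hne) (hy i trivial).2 (h ▸ (hy i' trivial).2)

variable [MeasurableSpace E]

/-- The sum of the Dirac masses at all `j`-tuples of pairwise distinct points of `X`. -/
noncomputable def tupleMeasure (j : ℕ) (X : Set E) : Measure (Fin j → E) :=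
  Measure.sum fun x : injTuples j X => Measure.dirac x.1

theorem lintegral_tupleMeasure {j : ℕ} (X : Set E) {F : (Fin j → E) → ℝ≥0∞} (hF : Measurable F) :
    ∫⁻ x, F x ∂tupleMeasure j X = tupleSum X F := by
  rw [tupleMeasure, lintegral_sum_measure, tupleSum, ← tsum_subtype]
  exact tsum_congr fun x => lintegral_dirac' _ hF

theorem tupleMeasure_apply {j : ℕ} (X : Set E) {B : Set (Fin j → E)} (hB : MeasurableSet B) :
    tupleMeasure j X B = tupleSum X (B.indicator 1) := by
  rw [← lintegral_tupleMeasure X (measurable_one.indicator hB), lintegral_indicator_one hB]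

theorem isFiniteMeasure_tupleMeasure (j : ℕ) {X : Set E} (hX : X.Finite) :
    IsFiniteMeasure (tupleMeasure j X) := by
  have := (injTuples_finite j hX).fintype
  refine ⟨?_⟩
  rw [tupleMeasure, Measure.sum_apply _ MeasurableSet.univ]
  simp [tsum_fintype]

end TupleSums

/-! ### The factorial moment measures of a Poisson process -/

section Mecke

/-- The Poisson weights already sum to 1, which leaves probability 0 for an infinite count. The mean
comes from (j+1) P(X = j+1) = λ P(X = j), summed over j. -/
theorem lintegral_encard {E Ω : Type*} [MeasurableSpace E] [MeasurableSpace Ω]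
    {P : Measure Ω} {Λ : Measure E} {N : Ω → Set E} (hN : IsPoissonProcess P Λ N)
    [IsProbabilityMeasure P] {B : Set E} (hB : MeasurableSet B) (hΛ : Λ B ≠ ⊤) :
    ∫⁻ ω, ((N ω ∩ B).encard : ℝ≥0∞) ∂P = Λ B ∧ ∀ᵐ ω ∂P, (N ω ∩ B).Finite := by
  set X : Ω → ℕ∞ := fun ω => (N ω ∩ B).encard with hX
  have hXm : Measurable X := hN.measurable_count B hB
  set l : ℝ≥0 := (Λ B).toNNReal with hl
  have hlaw : ∀ j : ℕ, P {ω | X ω = j} =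
      ENNReal.ofReal (Real.exp (-l) * (l : ℝ) ^ j / j.factorial) := by
    intro j
    rw [hN.law_count B hB hΛ j, poissonMeasure_singleton]
  have hmeas : ∀ j : ℕ, MeasurableSet {ω | X ω = j} := fun j =>
    hXm (measurableSet_singleton (j : ℕ∞))
  have hsum : ∑' j : ℕ, P {ω | X ω = j} = 1 := by
    simp only [hlaw]
    rw [← ENNReal.ofReal_tsum_of_nonneg (fun n => by positivity) (hasSum_one_poissonMeasure l).summable,
      (hasSum_one_poissonMeasure l).tsum_eq, ENNReal.ofReal_one]
  have hfin : ∀ᵐ ω ∂P, X ω ≠ ⊤ := by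
    have hU : P (⋃ j : ℕ, {ω | X ω = j}) = 1 := by
      rw [measure_iUnion _ hmeas, hsum]
      intro i j hij
      refine disjoint_left.2 fun ω h1 h2 => hij ?_
      have : (i : ℕ∞) = j := h1.symm.trans h2
      exact_mod_cast this
    have h2 : ∀ᵐ ω ∂P, ω ∈ ⋃ j : ℕ, {ω | X ω = j} := by
      rw [← prob_compl_eq_zero_iff (MeasurableSet.iUnion hmeas)] at hU
      exact measure_eq_zero_iff_ae_notMem.1 hU |>.mono fun ω h => by simpa using h
    filter_upwards [h2] with ω hω
    obtain ⟨j, hj⟩ := mem_iUnion.1 hω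
    rw [show X ω = j from hj]
    exact ENat.natCast_ne_top j
  refine ⟨?_, hfin.mono fun ω h => Set.encard_ne_top_iff.1 h⟩
  have hrep : ∀ᵐ ω ∂P, (X ω : ℝ≥0∞) = ∑' j : ℕ, {ω | X ω = j}.indicator (fun _ => (j : ℝ≥0∞)) ω := by
    filter_upwards [hfin] with ω hω
    obtain ⟨n, hn⟩ := ENat.ne_top_iff_exists.1 hω
    rw [tsum_eq_single n]
    · rw [indicator_of_mem (show ω ∈ {ω | X ω = n} from hn.symm), ← hn]; simp
    · intro j hj
      refine indicator_of_notMem (fun h => hj ?_) _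
      have : (j : ℕ∞) = n := (show X ω = j from h).symm.trans hn.symm
      exact_mod_cast this
  rw [lintegral_congr_ae hrep, lintegral_tsum fun j => (measurable_const.indicator (hmeas j)).aemeasurable]
  simp only [lintegral_indicator (hmeas _), lintegral_const, Measure.restrict_apply MeasurableSet.univ,
    univ_inter]
  rw [tsum_eq_zero_add' ENNReal.summable]
  have hstep : ∀ j : ℕ, ((j + 1 : ℕ) : ℝ≥0∞) * P {ω | X ω = ((j + 1 : ℕ) : ℕ∞)} =
      (l : ℝ≥0∞) * P {ω | X ω = j} := by
    intro j
    rw [hlaw, hlaw, ← ENNReal.ofReal_natCast, ← ENNReal.ofReal_coe_nnreal,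
      ← ENNReal.ofReal_mul (by positivity), ← ENNReal.ofReal_mul (by positivity)]
    congr 1
    rw [Nat.factorial_succ]
    push_cast
    field_simp
    ring
  simp only [hstep, ENNReal.tsum_mul_left, hsum]
  simp [hl, ENNReal.coe_toNNReal hΛ]

theorem ae_finite {E Ω : Type*} [MeasurableSpace E] [MeasurableSpace Ω] {P : Measure Ω}
    {Λ : Measure E} {N : Ω → Set E} [IsProbabilityMeasure P]
    (hN : IsPoissonProcess P Λ N)
    [IsFiniteMeasure Λ] : ∀ᵐ ω ∂P, (N ω).Finite := by
  simpa using (lintegral_encard hN MeasurableSet.univ (measure_ne_top Λ _)).2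

variable {E Ω : Type*} [TopologicalSpace E] [T2Space E] [SecondCountableTopology E]
  [MeasurableSpace E] [BorelSpace E] [MeasurableSpace Ω]

/-- The tuples with pairwise distinct entries are covered by countably many boxes with pairwise
disjoint sides. -/
theorem exists_disjoint_boxes (E : Type*) [TopologicalSpace E] [T2Space E]
    [SecondCountableTopology E] [MeasurableSpace E] [BorelSpace E] (j : ℕ) :
    ∃ Q : ℕ → Fin j → Set E, (∀ n i, MeasurableSet (Q n i)) ∧
      (∀ n, Pairwise fun i i' => Disjoint (Q n i) (Q n i')) ∧
      {x : Fin j → E | Function.Injective x} ⊆ ⋃ n, univ.pi (Q n) := by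
  let b := TopologicalSpace.countableBasis E
  have hb : Countable b := (TopologicalSpace.countable_countableBasis E).to_subtype
  let ι := {s : Fin j → b // Pairwise fun i i' => Disjoint (s i : Set E) (s i')}
  rcases isEmpty_or_nonempty ι with hι | hι
  · refine ⟨fun _ _ => ∅, fun _ _ => MeasurableSet.empty, fun _ _ _ _ => disjoint_bot_left, ?_⟩
    intro x hx
    exact (hι.false (exists_box x hx).choose).elim
  · obtain ⟨e, he⟩ := exists_surjective_nat ι
    refine ⟨fun n i => (e n).1 i, fun n i => ?_, fun n => (e n).2, fun x hx => ?_⟩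
    · exact ((TopologicalSpace.isBasis_countableBasis E).isOpen ((e n).1 i).2).measurableSet
    · obtain ⟨s, hs⟩ := exists_box x hx
      obtain ⟨n, rfl⟩ := he s
      exact mem_iUnion.2 ⟨n, fun i _ => hs i⟩
  where
  exists_box {j : ℕ} (x : Fin j → E) (hx : Function.Injective x) :
      ∃ s : {s : Fin j → TopologicalSpace.countableBasis E //
        Pairwise fun i i' => Disjoint (s i : Set E) (s i')}, ∀ i, x i ∈ (s.1 i : Set E) := by
    -- Finitely many distinct points have disjoint neighbourhoods, which shrink to members of a
    -- countable basis; there are only countably many choices of basis sets.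
    obtain ⟨U, hU, hd⟩ := (Set.finite_range x).t2_separation
    have : ∀ i, ∃ s : TopologicalSpace.countableBasis E, x i ∈ (s : Set E) ∧ (s : Set E) ⊆ U (x i) := by
      intro i
      obtain ⟨s, hs, h1, h2⟩ := (TopologicalSpace.isBasis_countableBasis E).exists_subset_of_mem_open
        (hU (x i)).1 (hU (x i)).2
      exact ⟨⟨s, hs⟩, h1, h2⟩
    choose s hs1 hs2 using this
    refine ⟨⟨s, fun i i' hne => ?_⟩, hs1⟩
    exact (hd (mem_range_self i) (mem_range_self i') (hx.ne hne)).mono (hs2 i) (hs2 i')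

/-- The tuples with two equal entries are null for powers of a diffuse measure. -/
theorem pi_not_injective (Λ : Measure E) [IsFiniteMeasure Λ] [NullSingletonClass Λ] (j : ℕ) :
    Measure.pi (fun _ : Fin j => Λ) {x | ¬ Function.Injective x} = 0 := by
  have hsub : {x : Fin j → E | ¬ Function.Injective x} ⊆
      ⋃ i, ⋃ i', ⋃ (_ : i ≠ i'), {x | x i = x i'} := by
    intro x hx
    simp only [Function.Injective, mem_ofPred_eq, not_forall] at hx
    obtain ⟨i, i', h, hne⟩ := hx
    exact mem_iUnion.2 ⟨i, mem_iUnion.2 ⟨i', mem_iUnion.2 ⟨hne, h⟩⟩⟩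
  refine measure_mono_null hsub ?_
  simp only [measure_iUnion_null_iff]
  intro i i' hne
  obtain _ | j := j
  · exact i.elim0
  obtain ⟨l, rfl⟩ := Fin.exists_succAbove_eq hne.symm
  -- Fubini with coordinate i separated: once the other coordinates are fixed, the diagonal
  -- condition confines x i to a single point.
  have hmp := measurePreserving_piFinSuccAbove (fun _ : Fin (j + 1) => Λ) i
  have hmeas : MeasurableSet {p : E × (Fin j → E) | p.1 = p.2 l} :=
    measurableSet_eq_fun measurable_fst ((measurable_pi_apply l).comp measurable_snd)
  have : {x : Fin (j + 1) → E | x i = x (i.succAbove l)} =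
      MeasurableEquiv.piFinSuccAbove (fun _ => E) i ⁻¹' {p : E × (Fin j → E) | p.1 = p.2 l} := by
    ext x; rfl
  rw [this, hmp.measure_preimage hmeas.nullMeasurableSet, Measure.prod_apply_symm hmeas]
  simp only [preimage_ofPred_eq, ofPred_eq_eq_singleton, measure_singleton, lintegral_zero]

theorem measurableSet_not_injective {j : ℕ} :
    MeasurableSet {x : Fin j → E | ¬ Function.Injective x} := by
  have : {x : Fin j → E | ¬ Function.Injective x} =
      ⋃ i, ⋃ i', ⋃ (_ : i ≠ i'), {x | x i = x i'} := by
    ext x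
    simp only [Function.Injective, mem_ofPred_eq, not_forall, mem_iUnion]
    exact ⟨fun ⟨i, i', h, hn⟩ => ⟨i, i', hn, h⟩, fun ⟨i, i', hn, h⟩ => ⟨i, i', h, hn⟩⟩
  rw [this]
  exact MeasurableSet.iUnion fun i => MeasurableSet.iUnion fun i' => MeasurableSet.iUnion fun _ =>
    measurableSet_eq_fun (measurable_pi_apply i) (measurable_pi_apply i')

theorem tupleMeasure_not_injective {j : ℕ} (X : Set E) :
    tupleMeasure j X {x | ¬ Function.Injective x} = 0 := by
  rw [tupleMeasure_apply _ measurableSet_not_injective, tupleSum, ENNReal.tsum_eq_zero]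
  intro x
  by_cases hx : Function.Injective x
  · rw [indicator_indicator, indicator_of_notMem fun h => h.2 hx]
  · exact indicator_of_notMem (fun h => hx h.1) _

variable {P : Measure Ω} [IsProbabilityMeasure P] {Λ : Measure E} {N : Ω → Set E}

/-- The multivariate Mecke formula for sums over tuples of distinct points. -/
theorem lintegral_tupleSum (hN : IsPoissonProcess P Λ N) [IsFiniteMeasure Λ] [NullSingletonClass Λ] {j : ℕ}
    {F : (Fin j → E) → ℝ≥0∞} (hF : Measurable F) :
    AEMeasurable (fun ω => tupleSum (N ω) F) P ∧
      ∫⁻ ω, tupleSum (N ω) F ∂P = ∫⁻ x, F x ∂Measure.pi (fun _ : Fin j => Λ) := by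
  classical
  obtain ⟨Q, hQm, hQd, hQc⟩ := exists_disjoint_boxes E j
  have hboxm : ∀ n, MeasurableSet (univ.pi (Q n)) := fun n => MeasurableSet.univ_pi (hQm n)
  -- N is finite only almost surely. Emptying it on the exceptional event makes all tuple measures
  -- finite, as the π-system criterion for measurability requires.
  let X : Ω → Set E := fun ω => if (N ω).Finite then N ω else ∅
  have hXfin : ∀ ω, (X ω).Finite := by
    intro ω; by_cases h : (N ω).Finite <;> simp [X, h]
  have hXN : ∀ᵐ ω ∂P, X ω = N ω := (ae_finite hN).mono fun ω h => by simp [X, h]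
  let κ : Ω → Measure (Fin j → E) := fun ω => tupleMeasure j (X ω)
  have hκfin : ∀ ω, IsFiniteMeasure (κ ω) := fun ω => isFiniteMeasure_tupleMeasure j (hXfin ω)
  have hcount : ∀ B, MeasurableSet B → Measurable fun ω => ((X ω ∩ B).encard : ℝ≥0∞) := by
    intro B hB
    have h1 : MeasurableSet {ω | (N ω).Finite} := by
      have := hN.measurable_count univ MeasurableSet.univ (measurableSet_singleton ⊤).compl
      convert this using 1
      ext ω; simp [Set.encard_eq_top_iff]
    have h2 : (fun ω => (X ω ∩ B).encard) =
        fun ω => if ω ∈ {ω | (N ω).Finite} then (N ω ∩ B).encard else 0 := by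
      ext ω; by_cases h : (N ω).Finite <;> simp [X, h]
    have h3 : Measurable fun ω => (X ω ∩ B).encard := by
      rw [h2]; exact Measurable.ite h1 (hN.measurable_count B hB) measurable_const
    exact (Measurable.of_discrete (f := ENat.toENNReal)).comp h3
  have hbox : ∀ n (s : Fin j → Set E), (∀ i, MeasurableSet (s i)) → ∀ ω,
      (κ ω).restrict (univ.pi (Q n)) (univ.pi s) = ∏ i, ((X ω ∩ (s i ∩ Q n i)).encard : ℝ≥0∞) := by
    intro n s hs ω
    rw [Measure.restrict_apply (MeasurableSet.univ_pi hs), ← pi_inter_distrib]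
    rw [tupleMeasure_apply _ (MeasurableSet.univ_pi fun i => (hs i).inter (hQm n i)), tupleSum_box]
    exact fun i i' hne => (hQd n hne).mono inter_subset_right inter_subset_right
  -- Inside a box with disjoint sides the mass of a rectangle is a product of counts, and rectangles
  -- form a generating π-system.
  have hκQ : ∀ n, Measurable fun ω => (κ ω).restrict (univ.pi (Q n)) := by
    intro n
    refine Measurable.measure_of_isPiSystem generateFrom_pi.symm isPiSystem_pi ?_ ?_
    · rintro _ ⟨s, hs, rfl⟩
      have hs' : ∀ i, MeasurableSet (s i) := fun i => hs i trivial
      simp only [hbox n s hs']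
      exact Finset.measurable_prod _ fun i _ => hcount _ ((hs' i).inter (hQm n i))
    · have := fun ω => hbox n (fun _ => univ) (fun _ => MeasurableSet.univ) ω
      simp only [pi_univ] at this
      simp only [this]
      exact Finset.measurable_prod _ fun i _ => hcount _ (MeasurableSet.univ.inter (hQm n i))
  have hdecomp : ∀ (ν : Measure (Fin j → E)), ν {x | ¬ Function.Injective x} = 0 →
      ν.restrict (⋃ n, univ.pi (Q n)) = ν := by
    intro ν hν
    rw [Measure.restrict_eq_self_of_ae_mem]
    refine (measure_eq_zero_iff_ae_notMem.1 hν).mono fun x hx => hQc ?_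
    simpa using hx
  have hκm : Measurable κ := by
    refine Measure.measurable_of_measurable_coe _ fun B hB => ?_
    have : ∀ ω, κ ω B = ∑' n, (κ ω).restrict (univ.pi (Q n))
        (B ∩ disjointed (fun n => univ.pi (Q n)) n) := by
      intro ω
      have hdm : ∀ n, MeasurableSet (disjointed (fun n => univ.pi (Q n)) n) :=
        fun n => MeasurableSet.disjointed hboxm n
      conv_lhs => rw [← hdecomp (κ ω) (tupleMeasure_not_injective _), Measure.restrict_apply hB,
        ← iUnion_disjointed, inter_iUnion]
      rw [measure_iUnion]
      · refine tsum_congr fun n => ?_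
        rw [Measure.restrict_apply (hB.inter (hdm n)), inter_assoc,
          inter_eq_left.2 (disjointed_subset (fun n => univ.pi (Q n)) n)]
      · exact fun a b hab => ((disjoint_disjointed fun n => univ.pi (Q n)) hab).mono
          inter_subset_right inter_subset_right
      · exact fun n => hB.inter (hdm n)
    simp only [this]
    exact Measurable.tsum fun n => (Measure.measurable_coe
      (hB.inter (MeasurableSet.disjointed hboxm n))).comp (hκQ n)
  -- Neither measure charges tuples with repeated entries, so it suffices to compare them on each
  -- box. There independence turns the expected product of counts into the product of the Λ-masses.
  have hbind : P.bind κ = Measure.pi fun _ : Fin j => Λ := by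
    rw [← hdecomp (Measure.pi fun _ : Fin j => Λ) (pi_not_injective Λ j),
      ← hdecomp (P.bind κ) ?_, Measure.restrict_iUnion_congr]
    · intro n
      rw [Measure.restrict_pi_pi]
      refine (Measure.pi_eq fun s hs => ?_).symm
      have hms : ∀ i, MeasurableSet (s i ∩ Q n i) := fun i => (hs i).inter (hQm n i)
      rw [Measure.restrict_apply (MeasurableSet.univ_pi hs), Measure.bind_apply
        ((MeasurableSet.univ_pi hs).inter (hboxm n)) hκm.aemeasurable]
      have h1 : ∀ᵐ ω ∂P, κ ω (univ.pi s ∩ univ.pi (Q n)) =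
          ∏ i, ((N ω ∩ (s i ∩ Q n i)).encard : ℝ≥0∞) := by
        filter_upwards [hXN] with ω hω
        rw [← Measure.restrict_apply (MeasurableSet.univ_pi hs), hbox n s hs, hω]
      rw [lintegral_congr_ae h1]
      have hind := hN.indep_count j (fun i => s i ∩ Q n i) hms fun i i' hne =>
        (hQd n hne).mono inter_subset_right inter_subset_right
      have hind2 := hind.comp (fun _ => ENat.toENNReal) fun _ => Measurable.of_discrete
      have := lintegral_prod_eq_prod_lintegral_of_indepFun Finset.univ _ hind2 fun i =>
        Measurable.of_discrete.comp (hN.measurable_count _ (hms i))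
      simp only [Function.comp_apply] at this
      rw [this]
      refine Finset.prod_congr rfl fun i _ => ?_
      rw [(lintegral_encard hN (hms i) (measure_ne_top Λ _)).1, Measure.restrict_apply (hs i)]
    · refine le_antisymm ?_ zero_le
      rw [Measure.bind_apply measurableSet_not_injective hκm.aemeasurable]
      simp [κ, tupleMeasure_not_injective]
  have hae : (fun ω => ∫⁻ x, F x ∂κ ω) =ᵐ[P] fun ω => tupleSum (N ω) F := by
    filter_upwards [hXN] with ω hω
    rw [lintegral_tupleMeasure _ hF, hω]
  refine ⟨((Measure.measurable_lintegral hF).comp hκm).aemeasurable.congr hae, ?_⟩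
  rw [← lintegral_congr_ae hae, ← hbind, Measure.lintegral_bind hκm.aemeasurable hF.aemeasurable]

end Mecke

/-! ### Products of sums over tuples -/

section Products

variable {E : Type*}

/-- The part of a product of two sums over tuples that comes from pairs of tuples with a common
point. -/
noncomputable def overlapSum {p q : ℕ} (X : Set E) (F : (Fin p → E) → ℝ≥0∞)
    (G : (Fin q → E) → ℝ≥0∞) : ℝ≥0∞ :=
  ∑' x, ∑' y, {z : (Fin p → E) × (Fin q → E) | ∃ i i', z.1 i = z.2 i'}.indicator
    (fun z => (injTuples p X).indicator F z.1 * (injTuples q X).indicator G z.2) (x, y)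

theorem append_mem_injTuples_iff {p q : ℕ} (X : Set E) (x : Fin p → E) (y : Fin q → E) :
    Fin.append x y ∈ injTuples (p + q) X ↔
      x ∈ injTuples p X ∧ y ∈ injTuples q X ∧ ¬ ∃ i i', x i = y i' := by
  simp only [injTuples, mem_ofPred_eq, Fin.append_injective_iff, Fin.forall_fin_add,
    Fin.append_left, Fin.append_right, not_exists]
  tauto

/-- Two tuples of distinct points either share a point or concatenate to a longer tuple of distinct
points. -/
theorem tupleSum_mul_tupleSum {p q : ℕ} (X : Set E) (F : (Fin p → E) → ℝ≥0∞)
    (G : (Fin q → E) → ℝ≥0∞) :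
    tupleSum X F * tupleSum X G =
      tupleSum X (fun z : Fin (p + q) → E =>
        F (fun i => z (Fin.castAdd q i)) * G (fun i => z (Fin.natAdd p i))) +
      overlapSum X F G := by
  have h1 : tupleSum X F * tupleSum X G =
      ∑' x, ∑' y, (injTuples p X).indicator F x * (injTuples q X).indicator G y := by
    rw [tupleSum, tupleSum, ← ENNReal.tsum_mul_right]
    simp only [ENNReal.tsum_mul_left]
  have h2 : tupleSum X (fun z : Fin (p + q) → E =>
        F (fun i => z (Fin.castAdd q i)) * G (fun i => z (Fin.natAdd p i))) =
      ∑' x, ∑' y, (injTuples (p + q) X).indicator (fun z => F (fun i => z (Fin.castAdd q i)) *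
        G (fun i => z (Fin.natAdd p i))) (Fin.append x y) := by
    rw [tupleSum, ← (Fin.appendEquiv p q).tsum_eq, ← ENNReal.tsum_prod]
    rfl
  rw [h1, h2, overlapSum, ← ENNReal.tsum_add]
  refine tsum_congr fun x => ?_
  rw [← ENNReal.tsum_add]
  refine tsum_congr fun y => ?_
  by_cases ho : ∃ i i', x i = y i'
  · rw [indicator_of_notMem (s := injTuples (p + q) X), indicator_of_mem (s :=
      {z : (Fin p → E) × (Fin q → E) | _}) (by exact ho), zero_add]
    exact fun h => ((append_mem_injTuples_iff X x y).1 h).2.2 ho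
  · rw [indicator_of_notMem (s := {z : (Fin p → E) × (Fin q → E) | _}) (by exact ho), add_zero]
    by_cases hx : x ∈ injTuples p X
    · by_cases hy : y ∈ injTuples q X
      · rw [indicator_of_mem hx, indicator_of_mem hy, indicator_of_mem
          ((append_mem_injTuples_iff X x y).2 ⟨hx, hy, ho⟩)]
        simp [Fin.append_left, Fin.append_right]
      · rw [indicator_of_notMem hy, mul_zero, indicator_of_notMem]
        rw [append_mem_injTuples_iff]; tauto
    · rw [indicator_of_notMem hx, zero_mul, indicator_of_notMem]
      rw [append_mem_injTuples_iff]; tauto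

theorem tupleSum_one_eq_encard (X : Set E) :
    tupleSum X (1 : (Fin 1 → E) → ℝ≥0∞) = (X.encard : ℝ≥0∞) := by
  rw [← tsum_indicator_one, tupleSum, ← (Equiv.funUnique (Fin 1) E).symm.tsum_eq]
  refine tsum_congr fun y => ?_
  by_cases hy : y ∈ X
  · rw [indicator_of_mem hy, indicator_of_mem]; rfl
    exact ⟨Function.injective_of_subsingleton _, fun _ => hy⟩
  · rw [indicator_of_notMem hy, indicator_of_notMem]
    exact fun h => hy (h.2 0)

theorem overlapSum_one_one_le (X : Set E) :
    overlapSum X (1 : (Fin 1 → E) → ℝ≥0∞) (1 : (Fin 1 → E) → ℝ≥0∞) ≤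
      tupleSum X (1 : (Fin 1 → E) → ℝ≥0∞) := by
  refine ENNReal.tsum_le_tsum fun x => ?_
  rw [tsum_eq_single x]
  · refine (indicator_le_self _ _ _).trans ?_
    by_cases hx : x ∈ injTuples 1 X
    · simp [indicator_of_mem hx]
    · simp [indicator_of_notMem hx]
  · intro y hy
    refine indicator_of_notMem (fun h => hy ?_) _
    obtain ⟨i, i', h : x i = y i'⟩ := h
    ext l
    rw [Subsingleton.elim l i', ← h, Subsingleton.elim i' i]

/-- Each tuple meets exactly the p one-point tuples formed by its own entries. This factor p is the
source of the factor k+1 in the covariance with the number of points. -/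
theorem le_overlapSum_one {p : ℕ} (X : Set E) (F : (Fin p → E) → ℝ≥0∞) :
    p * tupleSum X F ≤ overlapSum X F (1 : (Fin 1 → E) → ℝ≥0∞) := by
  rw [tupleSum, ← ENNReal.tsum_mul_left]
  refine ENNReal.tsum_le_tsum fun x => ?_
  by_cases hx : x ∈ injTuples p X
  · have hinj : Function.Injective fun (i : Fin p) (_ : Fin 1) => x i := fun i i' h =>
      hx.1 (congrFun h 0)
    refine le_trans ?_ (ENNReal.sum_le_tsum (Finset.univ.map ⟨_, hinj⟩))
    rw [Finset.sum_map, Finset.sum_congr rfl (g := fun _ => (injTuples p X).indicator F x)]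
    · simp
    · intro i _
      rw [indicator_of_mem, indicator_of_mem (s := injTuples 1 X)]
      · simp
      · exact ⟨Function.injective_of_subsingleton _, fun _ => hx.2 i⟩
      · exact ⟨i, 0, rfl⟩
  · simp [indicator_of_notMem hx]

theorem tupleSum_const_one (j : ℕ) {X : Set E} (hX : X.Finite) :
    tupleSum X (1 : (Fin j → E) → ℝ≥0∞) = (X.ncard.descFactorial j : ℕ) := by
  have := hX.fintype
  have e : injTuples j X ≃ (Fin j ↪ X) :=
    { toFun := fun x => ⟨fun i => ⟨x.1 i, x.2.2 i⟩, fun i i' h => x.2.1 (congrArg Subtype.val h)⟩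
      invFun := fun f => ⟨fun i => f i, fun i i' h => f.injective (Subtype.ext h), fun i => (f i).2⟩
      left_inv := fun _ => rfl
      right_inv := fun _ => rfl }
  rw [tupleSum, tsum_indicator_one, Set.encard, ENat.card_congr e, ENat.card_eq_coe_fintype_card,
    Fintype.card_embedding_eq, Fintype.card_fin, ← Nat.card_eq_fintype_card]
  rfl

/-- For n ≤ 2p the constant dominates; for n ≥ 2p every factor of the falling factorial is at least
n/2. -/
theorem pow_le_descFactorial (n p : ℕ) :
    n ^ p ≤ (2 * p) ^ p + 2 ^ p * n.descFactorial p := by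
  rcases le_total n (2 * p) with h | h
  · exact (Nat.pow_le_pow_left h p).trans (Nat.le_add_right _ _)
  · refine le_trans ?_ (Nat.le_add_left _ _)
    refine le_trans ?_ (Nat.mul_le_mul_left _ (Nat.pow_sub_le_descFactorial n p))
    rw [← mul_pow]
    exact Nat.pow_le_pow_left (by omega) p

/-- Replaces the square of a number of k-tuples by a number of 2k-tuples, whose mean the Mecke
formula gives. -/
theorem sq_tupleSum_const_one_le (k : ℕ) {X : Set E} (hX : X.Finite) :
    tupleSum X (1 : (Fin k → E) → ℝ≥0∞) ^ 2 ≤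
      (((4 * k) ^ (2 * k) + 2 ^ (2 * k) : ℕ) : ℝ≥0∞) *
        (1 + tupleSum X (1 : (Fin (2 * k) → E) → ℝ≥0∞)) := by
  rw [tupleSum_const_one k hX, tupleSum_const_one (2 * k) hX]
  have h := pow_le_descFactorial X.ncard (2 * k)
  have h2 : X.ncard.descFactorial k ^ 2 ≤ X.ncard ^ (2 * k) := by
    rw [mul_comm, pow_mul]; exact Nat.pow_le_pow_left (Nat.descFactorial_le_pow _ _) 2
  have h3 : X.ncard.descFactorial k ^ 2 ≤ ((4 * k) ^ (2 * k) + 2 ^ (2 * k)) *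
      (1 + X.ncard.descFactorial (2 * k)) := by
    refine h2.trans (h.trans ?_)
    rw [← mul_assoc]
    norm_num
    nlinarith [Nat.zero_le ((4 * k) ^ (2 * k) * X.ncard.descFactorial (2 * k)),
      Nat.zero_le (2 ^ (2 * k))]
  exact_mod_cast h3

/-- The overlap sum of a bounded, locally determined function with itself is bounded by the number
of points and the number of tuples of points in balls around points. -/
theorem overlapSum_self_le [PseudoMetricSpace E] {k : ℕ} {X : Set E} (hX : X.Finite)
    {F : (Fin (k + 1) → E) → ℝ≥0∞} {M : ℝ≥0∞} {ρ : ℝ} (hM : ∀ x, F x ≤ M)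
    (hρ : ∀ x, F x ≠ 0 → ∀ i i', dist (x i) (x i') ≤ ρ) :
    overlapSum X F F ≤ ((k + 1) ^ 2 * ((4 * k) ^ (2 * k) + 2 ^ (2 * k)) : ℕ) * M ^ 2 *
      ((X.encard : ℝ≥0∞) + tupleSum X
        ({z : Fin (2 * k + 1) → E | ∀ i : Fin (2 * k), z i.succ ∈
          Metric.closedBall (z 0) ρ}.indicator 1)) := by
  classical
  set C : ℕ := (4 * k) ^ (2 * k) + 2 ^ (2 * k) with hC
  -- The other k entries of a tuple through a with F ≠ 0 are distinct points of this set.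
  let Y : E → Set E := fun a => (X ∩ Metric.closedBall a ρ) \ {a}
  have hY : ∀ a, (Y a).Finite := fun a => (hX.inter_of_left _).sdiff
  let f : (Fin (k + 1) → E) → ℝ≥0∞ := (injTuples (k + 1) X).indicator F
  have hf : ∀ (i : Fin (k + 1)) (a : E) (x : Fin k → E), f (i.insertNth a x) ≤
      M * (injTuples k (Y a)).indicator 1 x := by
    intro i a x
    by_cases h : i.insertNth a x ∈ injTuples (k + 1) X
    · by_cases h0 : F (i.insertNth a x) = 0
      · simp [f, indicator_of_mem h, h0]
      · have hx : x ∈ injTuples k (Y a) := by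
          have e : ∀ l, x l = (i.insertNth a x : Fin (k + 1) → E) (i.succAbove l) := fun l =>
            (Fin.insertNth_apply_succAbove (α := fun _ => E) i a x l).symm
          have ea : a = (i.insertNth a x : Fin (k + 1) → E) i :=
            (Fin.insertNth_apply_same (α := fun _ => E) i a x).symm
          refine ⟨fun l l' hl => ?_, fun l => ⟨⟨?_, ?_⟩, ?_⟩⟩
          · rw [e, e] at hl
            exact Fin.succAbove_right_injective (h.1 hl)
          · rw [e]; exact h.2 _
          · rw [Metric.mem_closedBall, e]
            nth_rewrite 2 [ea]
            exact hρ _ h0 _ _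
          · intro hxa
            rw [mem_singleton_iff, e] at hxa
            nth_rewrite 2 [ea] at hxa
            exact Fin.succAbove_ne i l (h.1 hxa)
        rw [indicator_of_mem hx]
        simpa [f, indicator_of_mem h] using hM _
    · simp [f, indicator_of_notMem h]
  have hf0 : ∀ (i : Fin (k + 1)) (a : E) (x : Fin k → E), a ∉ X → f (i.insertNth a x) = 0 := by
    intro i a x ha
    refine indicator_of_notMem (fun h => ha ?_) _
    have := h.2 i
    rwa [Fin.insertNth_apply_same (α := fun _ => E)] at this
  -- Sum over the common point a, which sits at position i of one tuple and i' of the other. Given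
  -- a, each tuple reduces to a k-tuple of points of Y a.
  have hpair : ∀ i i' : Fin (k + 1),
      ∑' x, ∑' y, {z : (Fin (k + 1) → E) × (Fin (k + 1) → E) | z.1 i = z.2 i'}.indicator
        (fun z => f z.1 * f z.2) (x, y) ≤
      ∑' a, X.indicator (fun a => M ^ 2 * tupleSum (Y a) (1 : (Fin k → E) → ℝ≥0∞) ^ 2) a := by
    intro i i'
    rw [← (Fin.insertNthEquiv (fun _ => E) i).tsum_eq, ENNReal.tsum_prod']
    refine ENNReal.tsum_le_tsum fun a => ?_
    by_cases ha : a ∈ X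
    · rw [indicator_of_mem ha]
      have hy : ∀ x : Fin k → E, ∑' y, {z : (Fin (k + 1) → E) × (Fin (k + 1) → E) |
          z.1 i = z.2 i'}.indicator (fun z => f z.1 * f z.2)
            (Fin.insertNthEquiv (fun _ => E) i (a, x), y) ≤
          M ^ 2 * ((injTuples k (Y a)).indicator 1 x *
            tupleSum (Y a) (1 : (Fin k → E) → ℝ≥0∞)) := by
        intro x
        rw [← (Fin.insertNthEquiv (fun _ => E) i').tsum_eq, ENNReal.tsum_prod',
          tsum_eq_single a, tupleSum, ← ENNReal.tsum_mul_left, ← ENNReal.tsum_mul_left]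
        · refine ENNReal.tsum_le_tsum fun y => (indicator_le_self _ _ _).trans ?_
          refine (mul_le_mul' (hf i a x) (hf i' a y)).trans (le_of_eq ?_)
          ring
        · intro b hb
          refine ENNReal.tsum_eq_zero.2 fun y => indicator_of_notMem (fun h => hb ?_) _
          simp only [mem_ofPred_eq, Fin.insertNthEquiv_apply, Fin.insertNth_apply_same] at h
          exact h.symm
      refine (ENNReal.tsum_le_tsum hy).trans (le_of_eq ?_)
      rw [ENNReal.tsum_mul_left, ENNReal.tsum_mul_right, sq (tupleSum _ _)]
      rfl
    · rw [indicator_of_notMem ha, nonpos_iff_eq_zero]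
      refine ENNReal.tsum_eq_zero.2 fun x => ENNReal.tsum_eq_zero.2 fun y => ?_
      refine le_antisymm ((indicator_le_self _ _ _).trans ?_) zero_le
      exact (mul_eq_zero_of_left (hf0 i a x ha) _).le
  have hball : ∑' a, X.indicator (fun a => tupleSum (Y a) (1 : (Fin (2 * k) → E) → ℝ≥0∞)) a ≤
      tupleSum X ({z : Fin (2 * k + 1) → E | ∀ i : Fin (2 * k), z i.succ ∈
          Metric.closedBall (z 0) ρ}.indicator 1) := by
    rw [tupleSum, ← (Fin.consEquiv fun _ => E).tsum_eq, ENNReal.tsum_prod']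
    refine ENNReal.tsum_le_tsum fun a => ?_
    by_cases ha : a ∈ X
    · rw [indicator_of_mem ha]
      refine ENNReal.tsum_le_tsum fun x => ?_
      by_cases hx : x ∈ injTuples (2 * k) (Y a)
      · rw [indicator_of_mem hx, indicator_of_mem, indicator_of_mem]
        · rfl
        · intro i
          simpa [Fin.consEquiv] using (hx.2 i).1.2
        · refine ⟨Fin.cons_injective_iff.2 ⟨?_, hx.1⟩, ?_⟩
          · rintro ⟨i, hi⟩
            exact (hx.2 i).2 hi
          · intro i
            refine Fin.cases ha (fun i => ?_) i
            simpa [Fin.consEquiv] using (hx.2 i).1.1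
      · rw [indicator_of_notMem hx]; exact zero_le
    · rw [indicator_of_notMem ha]; exact zero_le
  -- Union bound over the (k+1)² pairs of positions of a common point.
  calc overlapSum X F F
      ≤ ∑' x, ∑' y, ∑' i, ∑' i', {z : (Fin (k + 1) → E) × (Fin (k + 1) → E) |
          z.1 i = z.2 i'}.indicator (fun z => f z.1 * f z.2) (x, y) := by
        refine ENNReal.tsum_le_tsum fun x => ENNReal.tsum_le_tsum fun y => ?_
        by_cases h : ∃ i i', x i = y i'
        · obtain ⟨i, i', h⟩ := h
          refine le_trans ?_ (ENNReal.le_tsum i)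
          refine le_trans ?_ (ENNReal.le_tsum i')
          rw [indicator_of_mem (s := {z : (Fin (k + 1) → E) × (Fin (k + 1) → E) |
            z.1 i = z.2 i'}) (by exact h)]
          exact indicator_le_self _ _ _
        · rw [indicator_of_notMem (by exact h)]; exact zero_le
    _ = ∑' i, ∑' i', ∑' x, ∑' y, {z : (Fin (k + 1) → E) × (Fin (k + 1) → E) |
          z.1 i = z.2 i'}.indicator (fun z => f z.1 * f z.2) (x, y) :=
        (tsum_congr fun x => ENNReal.tsum_comm.trans (tsum_congr fun i => ENNReal.tsum_comm)).trans
          (ENNReal.tsum_comm.trans (tsum_congr fun i => ENNReal.tsum_comm))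
    _ ≤ ∑' _i : Fin (k + 1), ∑' _i' : Fin (k + 1), ∑' a, X.indicator
          (fun a => M ^ 2 * tupleSum (Y a) (1 : (Fin k → E) → ℝ≥0∞) ^ 2) a :=
        ENNReal.tsum_le_tsum fun i => ENNReal.tsum_le_tsum fun i' => hpair i i'
    _ = (k + 1) ^ 2 * ∑' a, X.indicator
          (fun a => M ^ 2 * tupleSum (Y a) (1 : (Fin k → E) → ℝ≥0∞) ^ 2) a := by
        simp only [tsum_fintype, Finset.sum_const, Finset.card_univ, Fintype.card_fin,
          nsmul_eq_mul, sq (k + 1 : ℝ≥0∞), mul_assoc, Nat.cast_add, Nat.cast_one]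
    _ ≤ (k + 1) ^ 2 * (M ^ 2 * (C * ∑' a, (X.indicator 1 a + X.indicator
          (fun a => tupleSum (Y a) (1 : (Fin (2 * k) → E) → ℝ≥0∞)) a))) := by
        gcongr
        rw [← ENNReal.tsum_mul_left, ← ENNReal.tsum_mul_left]
        refine ENNReal.tsum_le_tsum fun a => ?_
        by_cases ha : a ∈ X
        · simp only [indicator_of_mem ha]
          gcongr
          exact sq_tupleSum_const_one_le k (hY a)
        · simp [indicator_of_notMem ha]
    _ ≤ _ := by
        rw [ENNReal.tsum_add, tsum_indicator_one]
        refine (mul_le_mul_right (mul_le_mul_right (mul_le_mul_right (add_le_add_right hball _) _) _) _).trans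
          (le_of_eq ?_)
        push_cast
        ring

end Products

/-! ### Moments of Poisson U-statistics -/

section Moments

theorem lintegral_pi_add {E : Type*} [MeasurableSpace E] (Λ : Measure E) [IsFiniteMeasure Λ]
    {p q : ℕ} {F : (Fin p → E) → ℝ≥0∞} {G : (Fin q → E) → ℝ≥0∞} (hF : Measurable F)
    (hG : Measurable G) :
    ∫⁻ z, F (fun i => z (Fin.castAdd q i)) * G (fun i => z (Fin.natAdd p i))
        ∂Measure.pi (fun _ : Fin (p + q) => Λ) =
      (∫⁻ x, F x ∂Measure.pi fun _ : Fin p => Λ) * ∫⁻ y, G y ∂Measure.pi fun _ : Fin q => Λ := by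
  have happ : Measurable fun z : (Fin p → E) × (Fin q → E) => Fin.append z.1 z.2 := by
    refine measurable_pi_iff.2 fun i => ?_
    refine Fin.addCases (fun i => ?_) (fun i => ?_) i
    · simp only [Fin.append_left]; fun_prop
    · simp only [Fin.append_right]; fun_prop
  have hmap : Measure.pi (fun _ : Fin (p + q) => Λ) =
      ((Measure.pi fun _ : Fin p => Λ).prod (Measure.pi fun _ : Fin q => Λ)).map
        fun z => Fin.append z.1 z.2 := by
    refine Measure.pi_eq fun s hs => ?_
    rw [Measure.map_apply happ (MeasurableSet.univ_pi hs)]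
    have : (fun z : (Fin p → E) × (Fin q → E) => Fin.append z.1 z.2) ⁻¹' univ.pi s =
        (univ.pi fun i => s (Fin.castAdd q i)) ×ˢ (univ.pi fun i => s (Fin.natAdd p i)) := by
      ext z
      simp [Fin.forall_fin_add, Fin.append_left, Fin.append_right]
    rw [this, Measure.prod_prod, Measure.pi_pi, Measure.pi_pi, Fin.prod_univ_add]
  rw [hmap, lintegral_map ?_ happ]
  · simp only [Fin.append_left, Fin.append_right]
    exact lintegral_prod_mul hF.aemeasurable hG.aemeasurable
  · exact (hF.comp (measurable_pi_iff.2 fun i => measurable_pi_apply _)).mul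
      (hG.comp (measurable_pi_iff.2 fun i => measurable_pi_apply _))

variable {E Ω : Type*} [MetricSpace E] [SecondCountableTopology E]
  [MeasurableSpace E] [BorelSpace E] [MeasurableSpace Ω]

theorem measurableSet_star (l : ℕ) (ρ : ℝ) :
    MeasurableSet {z : Fin (l + 1) → E | ∀ i : Fin l, z i.succ ∈ Metric.closedBall (z 0) ρ} := by
  simp only [Metric.mem_closedBall, ofPred_forall]
  exact MeasurableSet.iInter fun i => measurableSet_le
    ((measurable_pi_apply _).dist (measurable_pi_apply _)) measurable_const

/-- Given the centre, the l other points range independently over its ball. -/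
theorem pi_star_le (Λ : Measure E) [IsFiniteMeasure Λ] (l : ℕ) {ρ : ℝ} {L : ℝ≥0∞}
    (hL : ∀ x, Λ (Metric.closedBall x ρ) ≤ L) :
    Measure.pi (fun _ : Fin (l + 1) => Λ)
      {z | ∀ i : Fin l, z i.succ ∈ Metric.closedBall (z 0) ρ} ≤ Λ univ * L ^ l := by
  have hmp := measurePreserving_piFinSuccAbove (fun _ : Fin (l + 1) => Λ) 0
  have hmeas : MeasurableSet {p : E × (Fin l → E) | ∀ i, p.2 i ∈ Metric.closedBall p.1 ρ} := by
    simp only [Metric.mem_closedBall, ofPred_forall]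
    exact MeasurableSet.iInter fun i => measurableSet_le
      (((measurable_pi_apply _).comp measurable_snd).dist measurable_fst) measurable_const
  have : {z : Fin (l + 1) → E | ∀ i : Fin l, z i.succ ∈ Metric.closedBall (z 0) ρ} =
      MeasurableEquiv.piFinSuccAbove (fun _ => E) 0 ⁻¹'
        {p : E × (Fin l → E) | ∀ i, p.2 i ∈ Metric.closedBall p.1 ρ} := by
    ext z; rfl
  rw [this, hmp.measure_preimage hmeas.nullMeasurableSet, Measure.prod_apply hmeas]
  calc _ ≤ ∫⁻ _x, L ^ l ∂Λ := by
        refine lintegral_mono fun x => ?_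
        have : Prod.mk x ⁻¹' {p : E × (Fin l → E) | ∀ i, p.2 i ∈ Metric.closedBall p.1 ρ} =
            univ.pi fun _ => Metric.closedBall x ρ := by ext y; simp
        rw [this, Measure.pi_pi]
        simpa using pow_le_pow_left' (hL x) l
    _ = Λ univ * L ^ l := by rw [lintegral_const, mul_comm]

variable {P : Measure Ω} [IsProbabilityMeasure P] {Λ : Measure E} {N : Ω → Set E}

/-- The product over disjoint pairs has mean exactly the square of the first moment, so the
remaining term bounds the variance. -/
theorem lintegral_sq_tupleSum_le (hN : IsPoissonProcess P Λ N) [IsFiniteMeasure Λ]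
    [NullSingletonClass Λ] {k : ℕ} {F : (Fin (k + 1) → E) → ℝ≥0∞} (hF : Measurable F)
    {M L : ℝ≥0∞} {ρ : ℝ} (hM : ∀ x, F x ≤ M)
    (hρ : ∀ x, F x ≠ 0 → ∀ i i', dist (x i) (x i') ≤ ρ)
    (hL : ∀ x, Λ (Metric.closedBall x ρ) ≤ L) :
    ∫⁻ ω, tupleSum (N ω) F ^ 2 ∂P ≤
      (∫⁻ x, F x ∂Measure.pi fun _ : Fin (k + 1) => Λ) ^ 2 +
        ((k + 1) ^ 2 * ((4 * k) ^ (2 * k) + 2 ^ (2 * k)) : ℕ) * M ^ 2 *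
          (Λ univ * (1 + L ^ (2 * k))) := by
  have hstar := measurableSet_star (E := E) (2 * k) ρ
  have hprod : Measurable fun z : Fin (k + 1 + (k + 1)) → E =>
      F (fun i => z (Fin.castAdd (k + 1) i)) * F (fun i => z (Fin.natAdd (k + 1) i)) :=
    (hF.comp (measurable_pi_iff.2 fun i => measurable_pi_apply _)).mul
      (hF.comp (measurable_pi_iff.2 fun i => measurable_pi_apply _))
  have h1 := lintegral_tupleSum hN hprod
  have h2 := lintegral_tupleSum hN ((measurable_one (α := ℝ≥0∞)).indicator hstar)
  have h3 := lintegral_encard hN MeasurableSet.univ (measure_ne_top Λ univ)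
  simp only [inter_univ] at h3
  have hle : ∀ᵐ ω ∂P, tupleSum (N ω) F ^ 2 ≤
      tupleSum (N ω) (fun z : Fin (k + 1 + (k + 1)) → E =>
        F (fun i => z (Fin.castAdd (k + 1) i)) * F (fun i => z (Fin.natAdd (k + 1) i))) +
      ((k + 1) ^ 2 * ((4 * k) ^ (2 * k) + 2 ^ (2 * k)) : ℕ) * M ^ 2 *
      (((N ω).encard : ℝ≥0∞) + tupleSum (N ω)
        ({z : Fin (2 * k + 1) → E | ∀ i : Fin (2 * k), z i.succ ∈
          Metric.closedBall (z 0) ρ}.indicator 1)) := by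
    filter_upwards [ae_finite hN] with ω hω
    rw [sq, tupleSum_mul_tupleSum]
    gcongr
    exact overlapSum_self_le hω hM hρ
  refine (lintegral_mono_ae hle).trans ?_
  rw [lintegral_add_left' h1.1, h1.2, lintegral_pi_add Λ hF hF, ← sq]
  gcongr
  rw [lintegral_const_mul'']
  · rw [lintegral_add_right' _ h2.1, h2.2, h3.1, lintegral_indicator_one hstar, mul_add (Λ univ), mul_one]
    gcongr
    exact pi_star_le Λ _ hL
  · refine AEMeasurable.add ?_ h2.1
    have := (Measurable.of_discrete (f := ENat.toENNReal)).comp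
      (hN.measurable_count univ MeasurableSet.univ)
    simpa [Function.comp_def] using this.aemeasurable

/-- Disjoint pairs give the product of the two means, and the overlaps at least p times the mean of
the sum: the covariance with the number of points is at least p times that mean. -/
theorem le_lintegral_tupleSum_mul_encard (hN : IsPoissonProcess P Λ N) [IsFiniteMeasure Λ]
    [NullSingletonClass Λ] {p : ℕ} {F : (Fin p → E) → ℝ≥0∞} (hF : Measurable F) :
    (∫⁻ x, F x ∂Measure.pi fun _ : Fin p => Λ) * Λ univ +
        p * ∫⁻ x, F x ∂Measure.pi (fun _ : Fin p => Λ) ≤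
      ∫⁻ ω, tupleSum (N ω) F * (N ω).encard ∂P := by
  have hprod : Measurable fun z : Fin (p + 1) → E =>
      F (fun i => z (Fin.castAdd 1 i)) * (1 : (Fin 1 → E) → ℝ≥0∞) (fun i => z (Fin.natAdd p i)) :=
    (hF.comp (measurable_pi_iff.2 fun i => measurable_pi_apply _)).mul
      (measurable_one.comp (measurable_pi_iff.2 fun i => measurable_pi_apply _))
  have h1 := lintegral_tupleSum hN hprod
  have h2 := lintegral_tupleSum hN hF
  have h3 : ∫⁻ y, (1 : (Fin 1 → E) → ℝ≥0∞) y ∂Measure.pi (fun _ : Fin 1 => Λ) = Λ univ := by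
    simp [Measure.pi_univ]
  rw [← h2.2, ← h3, h2.2, ← lintegral_pi_add Λ hF measurable_one, ← h1.2, ← h2.2,
    ← lintegral_const_mul'' _ h2.1, ← lintegral_add_left' h1.1]
  refine lintegral_mono fun ω => ?_
  simp only
  rw [← tupleSum_one_eq_encard, tupleSum_mul_tupleSum]
  gcongr
  exact le_overlapSum_one _ _

theorem lintegral_sq_encard_le (hN : IsPoissonProcess P Λ N) [IsFiniteMeasure Λ]
    [NullSingletonClass Λ] :
    ∫⁻ ω, ((N ω).encard : ℝ≥0∞) ^ 2 ∂P ≤ Λ univ ^ 2 + Λ univ := by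
  have hprod : Measurable fun z : Fin (1 + 1) → E =>
      (1 : (Fin 1 → E) → ℝ≥0∞) (fun i => z (Fin.castAdd 1 i)) *
        (1 : (Fin 1 → E) → ℝ≥0∞) (fun i => z (Fin.natAdd 1 i)) := by
    simp only [Pi.one_apply]; exact measurable_const
  have h1 := lintegral_tupleSum hN hprod
  have h2 := lintegral_encard hN MeasurableSet.univ (measure_ne_top Λ univ)
  simp only [inter_univ] at h2
  have h3 : ∫⁻ y, (1 : (Fin 1 → E) → ℝ≥0∞) y ∂Measure.pi (fun _ : Fin 1 => Λ) = Λ univ := by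
    simp [Measure.pi_univ]
  calc ∫⁻ ω, ((N ω).encard : ℝ≥0∞) ^ 2 ∂P
      ≤ ∫⁻ ω, (tupleSum (N ω) (fun z : Fin (1 + 1) → E =>
          (1 : (Fin 1 → E) → ℝ≥0∞) (fun i => z (Fin.castAdd 1 i)) *
            (1 : (Fin 1 → E) → ℝ≥0∞) (fun i => z (Fin.natAdd 1 i))) + (N ω).encard) ∂P := by
        refine lintegral_mono fun ω => ?_
        simp only
        rw [sq, ← tupleSum_one_eq_encard, tupleSum_mul_tupleSum]
        gcongr
        exact overlapSum_one_one_le _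
    _ = _ := by
        rw [lintegral_add_left' h1.1, h1.2, h2.1,
          lintegral_pi_add Λ measurable_one measurable_one, h3, sq]

/-- Bounds on the variance of a sum over tuples of distinct points of a Poisson process. -/
theorem variance_tupleSum (hN : IsPoissonProcess P Λ N) [IsFiniteMeasure Λ]
    [NullSingletonClass Λ] {k : ℕ} {F : (Fin (k + 1) → E) → ℝ≥0∞} (hF : Measurable F)
    {M L : ℝ≥0∞} {ρ : ℝ} (hM : ∀ x, F x ≤ M) (hM' : M ≠ ⊤) (hL' : L ≠ ⊤)
    (hρ : ∀ x, F x ≠ 0 → ∀ i i', dist (x i) (x i') ≤ ρ)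
    (hL : ∀ x, Λ (Metric.closedBall x ρ) ≤ L) :
    MemLp (fun ω => (tupleSum (N ω) F).toReal) 2 P ∧
    Var[fun ω => (tupleSum (N ω) F).toReal; P] ≤
      ((k + 1) ^ 2 * ((4 * k) ^ (2 * k) + 2 ^ (2 * k)) : ℕ) * M.toReal ^ 2 *
          (Λ.real univ * (1 + L.toReal ^ (2 * k))) ∧
    ((k + 1) * (∫⁻ x, F x ∂Measure.pi fun _ : Fin (k + 1) => Λ).toReal) ^ 2 ≤
      Λ.real univ * Var[fun ω => (tupleSum (N ω) F).toReal; P] := by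
  set I := ∫⁻ x, F x ∂Measure.pi fun _ : Fin (k + 1) => Λ with hI
  set W : ℝ≥0∞ := ((k + 1) ^ 2 * ((4 * k) ^ (2 * k) + 2 ^ (2 * k)) : ℕ) * M ^ 2 *
          (Λ univ * (1 + L ^ (2 * k))) with hW
  have hI' : I ≠ ⊤ := by
    refine ne_top_of_le_ne_top ?_ (lintegral_mono hM)
    rw [lintegral_const]
    exact ENNReal.mul_ne_top hM' (measure_ne_top _ _)
  have hW' : W ≠ ⊤ := by
    refine ENNReal.mul_ne_top (ENNReal.mul_ne_top (ENNReal.natCast_ne_top _)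
      (ENNReal.pow_ne_top hM')) (ENNReal.mul_ne_top (measure_ne_top _ _) ?_)
    exact ENNReal.add_ne_top.2 ⟨ENNReal.one_ne_top, ENNReal.pow_ne_top hL'⟩
  obtain ⟨hTm, hT1⟩ := lintegral_tupleSum hN hF
  have hT2 := lintegral_sq_tupleSum_le hN hF hM hρ hL
  have hT2' : ∫⁻ ω, tupleSum (N ω) F ^ 2 ∂P ≠ ⊤ :=
    ne_top_of_le_ne_top (ENNReal.add_ne_top.2 ⟨ENNReal.pow_ne_top hI', hW'⟩) hT2
  have hNm : Measurable fun ω => ((N ω).encard : ℝ≥0∞) := by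
    have := (Measurable.of_discrete (f := ENat.toENNReal)).comp
      (hN.measurable_count univ MeasurableSet.univ)
    simpa [Function.comp_def] using this
  have hN1 := (lintegral_encard hN MeasurableSet.univ (measure_ne_top Λ univ)).1
  simp only [inter_univ] at hN1
  have hN2 := lintegral_sq_encard_le hN
  have hN2' : ∫⁻ ω, ((N ω).encard : ℝ≥0∞) ^ 2 ∂P ≠ ⊤ :=
    ne_top_of_le_ne_top (ENNReal.add_ne_top.2 ⟨ENNReal.pow_ne_top (measure_ne_top _ _),
      measure_ne_top _ _⟩) hN2
  have hTN := le_lintegral_tupleSum_mul_encard hN hF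
  have hTtop : ∀ᵐ ω ∂P, tupleSum (N ω) F < ⊤ := by
    refine ae_lt_top' hTm ?_
    rwa [hT1]
  have hNtop : ∀ᵐ ω ∂P, ((N ω).encard : ℝ≥0∞) < ⊤ := by
    refine ae_lt_top' hNm.aemeasurable ?_
    rw [hN1]; exact measure_ne_top _ _
  set U : Ω → ℝ := fun ω => (tupleSum (N ω) F).toReal with hU
  set V : Ω → ℝ := fun ω => ((N ω).encard : ℝ≥0∞).toReal with hV
  have hUL : MemLp U 2 P := by
    rw [memLp_two_iff_integrable_sq hTm.ennreal_toReal.aestronglyMeasurable]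
    simpa [U, ENNReal.toReal_pow] using
      integrable_toReal_of_lintegral_ne_top (hTm.pow_const 2) hT2'
  have hVL : MemLp V 2 P := by
    rw [memLp_two_iff_integrable_sq hNm.ennreal_toReal.aestronglyMeasurable]
    simpa [V, ENNReal.toReal_pow] using
      integrable_toReal_of_lintegral_ne_top (hNm.aemeasurable.pow_const 2) hN2'
  have hU1 : ∫ ω, U ω ∂P = I.toReal := by
    rw [hU, integral_toReal hTm hTtop, hT1]
  have hV1 : ∫ ω, V ω ∂P = Λ.real univ := by
    rw [hV, integral_toReal hNm.aemeasurable hNtop, hN1]; rfl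
  have hU2 : ∫ ω, (U ^ 2) ω ∂P ≤ I.toReal ^ 2 + W.toReal := by
    have : ∫ ω, (U ^ 2) ω ∂P = (∫⁻ ω, tupleSum (N ω) F ^ 2 ∂P).toReal := by
      rw [← integral_toReal (hTm.pow_const 2)
        (hTtop.mono fun ω h => ENNReal.pow_lt_top h)]
      simp [U, ENNReal.toReal_pow]
    rw [this, ← ENNReal.toReal_pow, ← ENNReal.toReal_add (ENNReal.pow_ne_top hI') hW']
    exact ENNReal.toReal_mono (ENNReal.add_ne_top.2 ⟨ENNReal.pow_ne_top hI', hW'⟩) hT2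
  have hV2 : ∫ ω, (V ^ 2) ω ∂P ≤ Λ.real univ ^ 2 + Λ.real univ := by
    have : ∫ ω, (V ^ 2) ω ∂P = (∫⁻ ω, ((N ω).encard : ℝ≥0∞) ^ 2 ∂P).toReal := by
      rw [← integral_toReal (hNm.aemeasurable.pow_const 2)
        (hNtop.mono fun ω h => ENNReal.pow_lt_top h)]
      simp [V, ENNReal.toReal_pow]
    rw [this, measureReal_def, ← ENNReal.toReal_pow, ← ENNReal.toReal_add
      (ENNReal.pow_ne_top (measure_ne_top _ _)) (measure_ne_top _ _)]
    exact ENNReal.toReal_mono (ENNReal.add_ne_top.2 ⟨ENNReal.pow_ne_top (measure_ne_top _ _),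
      measure_ne_top _ _⟩) hN2
  have hUV : I.toReal * Λ.real univ + (k + 1) * I.toReal ≤ ∫ ω, (U * V) ω ∂P := by
    have hint := MemLp.integrable_mul hUL hVL
    have : ENNReal.ofReal (∫ ω, (U * V) ω ∂P) = ∫⁻ ω, tupleSum (N ω) F * (N ω).encard ∂P := by
      rw [ofReal_integral_eq_lintegral_ofReal hint]
      · refine lintegral_congr_ae ?_
        filter_upwards [hTtop, hNtop] with ω h1 h2
        simp only [Pi.mul_apply, U, V]
        rw [← ENNReal.toReal_mul, ENNReal.ofReal_toReal (ENNReal.mul_ne_top h1.ne h2.ne)]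
      · exact Eventually.of_forall fun ω => mul_nonneg ENNReal.toReal_nonneg ENNReal.toReal_nonneg
    rw [← this, ← hI] at hTN
    have h0 : 0 ≤ ∫ ω, (U * V) ω ∂P := integral_nonneg fun ω =>
      mul_nonneg ENNReal.toReal_nonneg ENNReal.toReal_nonneg
    have := ENNReal.toReal_mono ENNReal.ofReal_ne_top hTN
    rw [ENNReal.toReal_ofReal h0, ENNReal.toReal_add (ENNReal.mul_ne_top hI' (measure_ne_top _ _))
      (ENNReal.mul_ne_top (ENNReal.natCast_ne_top _) hI'), ENNReal.toReal_mul,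
      ENNReal.toReal_mul, ENNReal.toReal_natCast] at this
    simpa [measureReal_def] using this
  have hvarU := variance_eq_sub hUL
  have hvarV := variance_eq_sub hVL
  have hcov := covariance_eq_sub hUL hVL
  rw [hU1, hV1] at hcov
  rw [hU1] at hvarU
  rw [hV1] at hvarV
  refine ⟨hUL, ?_, ?_⟩
  · have hWr : W.toReal = ((k + 1) ^ 2 * ((4 * k) ^ (2 * k) + 2 ^ (2 * k)) : ℕ) * M.toReal ^ 2 *
          (Λ.real univ * (1 + L.toReal ^ (2 * k))) := by
      rw [hW, ENNReal.toReal_mul, ENNReal.toReal_mul, ENNReal.toReal_mul, ENNReal.toReal_natCast,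
        ENNReal.toReal_pow, ENNReal.toReal_add ENNReal.one_ne_top (ENNReal.pow_ne_top hL'),
        ENNReal.toReal_pow, ENNReal.toReal_one, measureReal_def]
    rw [← hWr, hvarU]
    linarith
  -- Cauchy–Schwarz in the form Var(U - cV) ≥ 0, which needs only bounds on Cov(U, V) from below and
  -- on Var V from above. The best choice, made below, is c = (k+1) I / Λ(E).
  · have hquad : ∀ c : ℝ, 0 ≤ Var[U; P] - 2 * (c * cov[U, V; P]) + c ^ 2 * Var[V; P] := by
      intro c
      have := variance_sub hUL (hVL.const_mul c)
      rw [covariance_const_mul_right, variance_const_mul] at this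
      rw [← this]
      exact variance_nonneg _ _
    set l := Λ.real univ with hl
    have hl0 : 0 ≤ l := measureReal_nonneg
    have hJ0 : 0 ≤ (k + 1) * I.toReal := by positivity
    have hc : (k + 1) * I.toReal ≤ cov[U, V; P] := by rw [hcov]; linarith
    have hv : Var[V; P] ≤ l := by rw [hvarV]; linarith
    have key : ∀ c : ℝ, 0 ≤ c → 2 * c * ((k + 1) * I.toReal) ≤ Var[U; P] + c ^ 2 * l := by
      intro c hc0
      nlinarith [hquad c, mul_le_mul_of_nonneg_left hc hc0,
        mul_le_mul_of_nonneg_left hv (sq_nonneg c)]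
    rcases hl0.eq_or_lt with h0 | h0
    · have h1 : Λ univ = 0 := by
        rw [hl, measureReal_def, eq_comm, ENNReal.toReal_eq_zero_iff] at h0
        exact h0.resolve_right (measure_ne_top _ _)
      have : Measure.pi (fun _ : Fin (k + 1) => Λ) = 0 := by
        rw [← Measure.measure_univ_eq_zero, Measure.pi_univ]
        simp [h1]
      rw [← h0, hI, this]
      simp
    · have := key ((k + 1) * I.toReal / l) (by positivity)
      have h2 : l * (2 * ((k + 1) * I.toReal / l) * ((k + 1) * I.toReal)) ≤
          l * (Var[U; P] + ((k + 1) * I.toReal / l) ^ 2 * l) :=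
        mul_le_mul_of_nonneg_left this hl0
      have e1 : l * (2 * ((k + 1) * I.toReal / l) * ((k + 1) * I.toReal)) =
          2 * ((k + 1) * I.toReal) ^ 2 := by field_simp
      have e2 : l * (Var[U; P] + ((k + 1) * I.toReal / l) ^ 2 * l) =
          l * Var[U; P] + ((k + 1) * I.toReal) ^ 2 := by field_simp
      rw [e1, e2] at h2
      linarith

end Moments

/-- On a finite configuration the real series is a finite sum, so the value 0 given to non-summable
series never intervenes. -/
theorem uStat_eq_tupleSum {m k : ℕ} {h : ℝ → (Fin (k + 1) → Space m) → ℝ} {r : ℝ}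
    (h0 : ∀ x, 0 ≤ h r x) {X : Set (Space m)} (hX : X.Finite) :
    uStat k h X r = (1 / ((k + 1).factorial : ℝ)) *
      (tupleSum X fun x => ENNReal.ofReal (h r x)).toReal := by
  have := (injTuples_finite (k + 1) hX).to_subtype
  rw [uStat, tupleSum, ← tsum_subtype, ← ENNReal.ofReal_tsum_of_nonneg]
  · rw [ENNReal.toReal_ofReal]
    · rfl
    · exact tsum_nonneg fun x => h0 _
  · exact fun x => h0 _
  · exact Summable.of_finite

/-- Variance bounds for U-statistics of a Poisson process. -/
theorem variance_uStat {m k : ℕ} {Ω : Type*} [MeasurableSpace Ω] {P : Measure Ω}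
    [IsProbabilityMeasure P] {Λ : Measure (Space m)} [IsFiniteMeasure Λ] [NullSingletonClass Λ]
    {N : Ω → Set (Space m)} (hN : IsPoissonProcess P Λ N)
    {h : ℝ → (Fin (k + 1) → Space m) → ℝ} {r : ℝ} (hm : Measurable (h r)) (h0 : ∀ x, 0 ≤ h r x)
    {M L ρ : ℝ} (hM : ∀ x, h r x ≤ M) (hL0 : 0 ≤ L)
    (hρ : ∀ x, h r x ≠ 0 → ∀ i i', dist (x i) (x i') ≤ ρ)
    (hL : ∀ x, Λ (Metric.closedBall x ρ) ≤ ENNReal.ofReal L) :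
    MemLp (fun ω => uStat k h (N ω) r) 2 P ∧
    Var[fun ω => uStat k h (N ω) r; P] ≤
      ((k + 1) ^ 2 * ((4 * k) ^ (2 * k) + 2 ^ (2 * k)) : ℕ) * M ^ 2 *
          (Λ.real univ * (1 + L ^ (2 * k))) ∧
    (∫⁻ x, ENNReal.ofReal (h r x) ∂Measure.pi fun _ : Fin (k + 1) => Λ).toReal ^ 2 ≤
      (k.factorial : ℝ) ^ 2 * Λ.real univ * Var[fun ω => uStat k h (N ω) r; P] := by
  have hM0 : 0 ≤ M := (h0 fun _ => 0).trans (hM _)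
  obtain ⟨h1, h2, h3⟩ := variance_tupleSum hN (F := fun x => ENNReal.ofReal (h r x))
    (M := ENNReal.ofReal M) (L := ENNReal.ofReal L) hm.ennreal_ofReal
    (fun x => ENNReal.ofReal_le_ofReal (hM x))
    ENNReal.ofReal_ne_top ENNReal.ofReal_ne_top
    (fun x hx => hρ x fun h => hx (by rw [h, ENNReal.ofReal_zero])) hL
  have hae : (fun ω => uStat k h (N ω) r) =ᵐ[P] fun ω => (1 / ((k + 1).factorial : ℝ)) *
      (tupleSum (N ω) fun x => ENNReal.ofReal (h r x)).toReal := by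
    filter_upwards [ae_finite hN] with ω hω
    exact uStat_eq_tupleSum h0 hω
  have hvar : Var[fun ω => uStat k h (N ω) r; P] = (1 / ((k + 1).factorial : ℝ)) ^ 2 *
      Var[fun ω => (tupleSum (N ω) fun x => ENNReal.ofReal (h r x)).toReal; P] := by
    rw [variance_congr hae, variance_const_mul]
  rw [ENNReal.toReal_ofReal hM0, ENNReal.toReal_ofReal hL0] at h2
  have hfac : (0 : ℝ) < (k + 1).factorial := by exact_mod_cast Nat.factorial_pos _
  refine ⟨(memLp_congr_ae hae).2 (h1.const_mul _), ?_, ?_⟩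
  · rw [hvar]
    refine le_trans ?_ h2
    refine mul_le_of_le_one_left (variance_nonneg _ _) ?_
    have : (1 : ℝ) ≤ (k + 1).factorial := by exact_mod_cast Nat.factorial_pos _
    rw [div_pow, one_pow, div_le_one (by positivity)]
    exact one_le_pow₀ this
  · rw [hvar]
    -- The factor k+1 of (k+1)! cancels the one gained in the covariance, leaving k!.
    have e : ((k + 1).factorial : ℝ) = (k + 1) * k.factorial := by
      rw [Nat.factorial_succ]; push_cast; ring
    have hk : (0 : ℝ) < k.factorial := by exact_mod_cast Nat.factorial_pos _
    have hk1 : (0 : ℝ) < (k : ℝ) + 1 := by positivity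
    rw [e]
    rw [mul_pow] at h3
    have : (k.factorial : ℝ) ^ 2 * Λ.real univ * ((1 / (((k : ℝ) + 1) * k.factorial)) ^ 2 *
        Var[fun ω => (tupleSum (N ω) fun x => ENNReal.ofReal (h r x)).toReal; P]) =
        (Λ.real univ * Var[fun ω => (tupleSum (N ω) fun x => ENNReal.ofReal (h r x)).toReal; P]) /
          ((k : ℝ) + 1) ^ 2 := by
      field_simp
    rw [this, le_div_iff₀ (by positivity)]
    linarith

/-! ### Gauges and support functions -/

section Gauge

variable {m : ℕ} {D : Set (Space m)}

theorem exists_mul_gauge_le_norm (hDo : IsOpen D) (hD0 : (0 : Space m) ∈ D) :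
    ∃ c : ℝ, 0 < c ∧ ∀ x, c * gauge D x ≤ ‖x‖ := by
  obtain ⟨c, hc, hs⟩ := Metric.mem_nhds_iff.1 (hDo.mem_nhds hD0)
  exact ⟨c, hc, fun x => mul_gauge_le_norm hs⟩

theorem exists_norm_le_mul_gauge (hDo : IsOpen D) (hDb : Bornology.IsBounded D)
    (hD0 : (0 : Space m) ∈ D) : ∃ R : ℝ, 0 < R ∧ ∀ x, ‖x‖ ≤ R * gauge D x := by
  obtain ⟨R, hR, hs⟩ := hDb.subset_closedBall_lt 0 0
  refine ⟨R, hR, fun x => ?_⟩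
  have := le_gauge_of_subset_closedBall (x := x) (absorbent_nhds_zero (hDo.mem_nhds hD0)) hR.le hs
  rwa [div_le_iff₀' hR] at this

theorem inner_le_supportFn (hDb : Bornology.IsBounded D) (θ : Space m) {x : Space m} (hx : x ∈ D) :
    inner ℝ θ x ≤ supportFn D θ := by
  obtain ⟨R, hR⟩ := hDb.exists_norm_le
  rw [real_inner_comm]
  refine le_csSup ⟨R * ‖θ‖, ?_⟩ (mem_image_of_mem _ hx)
  rintro _ ⟨y, hy, rfl⟩
  exact (real_inner_le_norm _ _).trans (by gcongr; exact hR y hy)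

/-- From a point of the open set D one can still move a little in direction θ. -/
theorem inner_lt_supportFn (hDo : IsOpen D) (hDb : Bornology.IsBounded D) {θ : Space m}
    (hθ : ‖θ‖ = 1) {x : Space m} (hx : x ∈ D) : inner ℝ θ x < supportFn D θ := by
  obtain ⟨ε, hε, hs⟩ := Metric.isOpen_iff.1 hDo x hx
  have h : x + (ε / 2) • θ ∈ D := hs (by
    rw [Metric.mem_ball, dist_self_add_left, norm_smul, hθ, Real.norm_eq_abs, abs_of_pos (by positivity)]
    linarith)
  have := inner_le_supportFn hDb θ h
  rw [inner_add_right, inner_smul_right, real_inner_self_eq_norm_sq, hθ] at this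
  linarith

theorem supportFn_pos (hDo : IsOpen D) (hDb : Bornology.IsBounded D) (hD0 : (0 : Space m) ∈ D)
    {θ : Space m} (hθ : ‖θ‖ = 1) : 0 < supportFn D θ := by
  simpa using inner_lt_supportFn hDo hDb hθ hD0

theorem inner_le_supportFn_mul_gauge (hDo : IsOpen D) (hDb : Bornology.IsBounded D)
    (hD0 : (0 : Space m) ∈ D) {θ : Space m} (hθ : ‖θ‖ = 1) (x : Space m) :
    inner ℝ θ x ≤ supportFn D θ * gauge D x := by
  have hζ := supportFn_pos hDo hDb hD0 hθ
  refine le_of_forall_gt_imp_ge_of_dense fun b hb => ?_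
  have hlt : gauge D x < b / supportFn D θ := by rwa [lt_div_iff₀' hζ]
  obtain ⟨s, hs, hsb, y, hy, rfl⟩ := exists_lt_of_gauge_lt
    (absorbent_nhds_zero (hDo.mem_nhds hD0)) hlt
  have := inner_le_supportFn hDb θ hy
  simp only [inner_smul_right]
  calc s * inner ℝ θ y ≤ s * supportFn D θ := by gcongr
    _ ≤ b / supportFn D θ * supportFn D θ := by gcongr
    _ = b := by field_simp

theorem mem_smul_outerHalfspace_iff {θ : Space m} {t : ℝ} (ht : 0 < t) {x : Space m} :
    x ∈ t • outerHalfspace D θ ↔ t * supportFn D θ ≤ inner ℝ θ x := by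
  rw [mem_smul_set_iff_inv_smul_mem₀ ht.ne', outerHalfspace, mem_ofPred_eq, inner_smul_right,
    inv_mul_eq_div, le_div_iff₀' ht]

/-- The halfspace supports tD from outside. For decreasing g this bounds the density on it by g(t).
-/
theorem le_gauge_of_mem (hDo : IsOpen D) (hDb : Bornology.IsBounded D) (hD0 : (0 : Space m) ∈ D)
    {θ : Space m} (hθ : ‖θ‖ = 1) {t : ℝ} (ht : 0 < t) {x : Space m}
    (hx : x ∈ t • outerHalfspace D θ) : t ≤ gauge D x := by
  have hζ := supportFn_pos hDo hDb hD0 hθ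
  have h1 := (mem_smul_outerHalfspace_iff ht).1 hx
  have h2 := inner_le_supportFn_mul_gauge hDo hDb hD0 hθ x
  by_contra h
  push Not at h
  nlinarith

end Gauge

/-! ### Horizontal and vertical coordinates -/

section Coordinates

variable {m : ℕ}

@[simp] theorem joinUV_castSucc (u : Horiz m) (v : ℝ) (i : Fin m) : joinUV u v i.castSucc = u i := by
  simp [joinUV]

@[simp] theorem joinUV_last (u : Horiz m) (v : ℝ) : joinUV u v (Fin.last m) = v := by
  simp [joinUV]

/-- The pair of coordinates `(u, v)` as a linear equivalence. -/
noncomputable def joinL (m : ℕ) : (Horiz m × ℝ) ≃L[ℝ] Space m :=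
  LinearEquiv.toContinuousLinearEquiv
    { toFun := fun z => joinUV z.1 z.2
      invFun := fun x => (WithLp.toLp 2 fun i => x i.castSucc, vert x)
      map_add' := fun z z' => by
        ext i; refine Fin.lastCases ?_ (fun i => ?_) i <;> simp
      map_smul' := fun c z => by
        ext i; refine Fin.lastCases ?_ (fun i => ?_) i <;> simp
      left_inv := fun z => by
        refine Prod.ext ?_ ?_
        · ext i; simp
        · simp [vert]
      right_inv := fun x => by
        ext i; refine Fin.lastCases ?_ (fun i => ?_) i <;> simp [vert] }

theorem joinL_apply (z : Horiz m × ℝ) : joinL m z = joinUV z.1 z.2 := rfl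

theorem vert_joinUV (u : Horiz m) (v : ℝ) : vert (joinUV u v) = v := by simp [vert]

end Coordinates

/-! ### Second order Taylor expansion -/

section Taylor

variable {E : Type*} [NormedAddCommGroup E] [NormedSpace ℝ E]

/-- By symmetry of the second derivative H, the remainder has derivative Df(p+x) - Df(p) - Hx, which
is o(‖x‖); apply the mean value inequality on the ball of radius ‖w‖. -/
theorem taylor_two_isLittleO {f : E → ℝ} {p : E} (hf : ContDiffAt ℝ 2 f p) :
    (fun w => f (p + w) - f p - fderiv ℝ f p w - (1 / 2) * fderiv ℝ (fderiv ℝ f) p w w)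
      =o[𝓝 0] fun w => ‖w‖ ^ 2 := by
  have hsymm : IsSymmSndFDerivAt ℝ f p := hf.isSymmSndFDerivAt (by simp)
  have hd1 : ∀ᶠ w in 𝓝 (0 : E), DifferentiableAt ℝ f (p + w) := by
    have h1 : ∀ᶠ x in 𝓝 p, DifferentiableAt ℝ f x :=
      (hf.eventually (by simp)).mono fun x hx => hx.differentiableAt (by simp)
    have : Tendsto (fun w : E => p + w) (𝓝 0) (𝓝 p) := by
      have hc : Continuous fun w : E => p + w := by fun_prop
      simpa using hc.tendsto 0
    exact this.eventually h1
  have hd2 : DifferentiableAt ℝ (fderiv ℝ f) p :=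
    (hf.fderiv_right (m := 1) (by norm_num)).differentiableAt (by simp)
  set H := fderiv ℝ (fderiv ℝ f) p with hH
  have hlo : (fun w => fderiv ℝ f (p + w) - fderiv ℝ f p - H w) =o[𝓝 0] fun w => w :=
    hasFDerivAt_iff_isLittleO_nhds_zero.1 hd2.hasFDerivAt
  rw [isLittleO_iff]
  intro ε hε
  obtain ⟨δ, hδ, hball⟩ := Metric.eventually_nhds_iff_ball.1 (hd1.and (isLittleO_iff.1 hlo hε))
  refine Metric.eventually_nhds_iff_ball.2 ⟨δ, hδ, fun w hw => ?_⟩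
  rw [mem_ball_zero_iff] at hw
  have hsub : ∀ x ∈ Metric.closedBall (0 : E) ‖w‖, x ∈ Metric.ball (0 : E) δ := by
    intro x hx
    rw [mem_closedBall_zero_iff] at hx
    exact mem_ball_zero_iff.2 (hx.trans_lt hw)
  have hder : ∀ x ∈ Metric.closedBall (0 : E) ‖w‖, HasFDerivWithinAt
      (fun w => f (p + w) - f p - fderiv ℝ f p w - (1 / 2) * H w w)
      (fderiv ℝ f (p + x) - fderiv ℝ f p - H x) (Metric.closedBall (0 : E) ‖w‖) x := by
    intro x hx
    have h1 : HasFDerivAt (fun w => f (p + w)) (fderiv ℝ f (p + x)) x := by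
      have := (hball x (hsub x hx)).1.hasFDerivAt
      rw [hasFDerivAt_comp_add_left]
      exact this
    have h2 : HasFDerivAt (fun w => H w w) ((H x) + H.flip x) x := by
      exact (H.hasFDerivAt (x := x)).clm_apply (hasFDerivAt_id x)
    have h3 : H.flip x = H x := by
      ext y
      exact hsymm y x
    have h4 := ((h1.sub_const (f p)).sub (fderiv ℝ f p).hasFDerivAt).sub (h2.const_mul (1 / 2))
    rw [h3] at h4
    refine HasFDerivAt.hasFDerivWithinAt (h4.congr_fderiv ?_)
    ext y
    simp only [sub_apply, smul_apply,
      add_apply, smul_eq_mul]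
    ring
  have hbound : ∀ x ∈ Metric.closedBall (0 : E) ‖w‖,
      ‖fderiv ℝ f (p + x) - fderiv ℝ f p - H x‖ ≤ ε * ‖w‖ := by
    intro x hx
    refine (hball x (hsub x hx)).2.trans ?_
    rw [mem_closedBall_zero_iff] at hx
    gcongr
  have := (convex_closedBall (0 : E) ‖w‖).norm_image_sub_le_of_norm_hasFDerivWithin_le hder hbound
    (x := 0) (y := w) (by simp) (by simp)
  simp only [add_zero, sub_self, map_zero, mul_zero, sub_zero] at this
  rw [norm_pow, norm_norm, sq, ← mul_assoc]
  simpa using this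

end Taylor

/-! ### Existence of initial transformations -/

section InitialTransformation

variable {m : ℕ} {D : Set (Space m)}

/-- Diagonalise H on the hyperplane orthogonal to θ and rescale. The value 2 is chosen for H =
D²(γ²): then γ² - 1 ~ ‖u‖² along the family, hence γ - 1 ~ ‖u‖²/2. -/
theorem exists_orthogonal_family {θ : Space m} (hθ : θ ≠ 0)
    (H : Space m →L[ℝ] Space m →L[ℝ] ℝ) (hsymm : ∀ x y, H x y = H y x)
    (hpos : ∀ w, w ≠ 0 → 0 < H w w) :
    ∃ b : Fin m → Space m, (∀ i, inner ℝ θ (b i) = 0) ∧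
      ∀ i j, H (b i) (b j) = if i = j then 2 else 0 := by
  let K := (ℝ ∙ θ)ᗮ
  have hfact : Fact (Module.finrank ℝ (Space m) = m + 1) := ⟨by simp⟩
  have hK : Module.finrank ℝ K = m := Submodule.finrank_orthogonal_span_singleton hθ
  let B : LinearMap.BilinForm ℝ K := LinearMap.mk₂ ℝ (fun x y => H (x : Space m) (y : Space m))
    (fun x x' y => by simp) (fun c x y => by simp) (fun x y y' => by simp) (fun c x y => by simp)
  have hB : LinearMap.IsSymm B := ⟨fun x y => hsymm x y⟩
  have : Invertible (2 : ℝ) := invertibleOfNonzero two_ne_zero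
  obtain ⟨v, hv⟩ := LinearMap.BilinForm.exists_orthogonal_basis hB
  let e : Fin m ≃ Fin (Module.finrank ℝ K) := finCongr hK.symm
  have hv0 : ∀ i, (v i : Space m) ≠ 0 := fun i h => v.ne_zero i (Subtype.ext h)
  refine ⟨fun i => √(2 / H (v (e i)) (v (e i))) • (v (e i) : Space m), fun i => ?_, fun i j => ?_⟩
  · rw [inner_smul_right, Submodule.mem_orthogonal_singleton_iff_inner_right.1 (v (e i)).2, mul_zero]
  · simp only [map_smul, smul_apply, smul_eq_mul]
    split_ifs with hij
    · subst hij
      have hp := hpos _ (hv0 (e i))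
      rw [← mul_assoc, Real.mul_self_sqrt (by positivity)]
      field_simp
    · have : H (v (e i)) (v (e j)) = 0 := hv (e.injective.ne hij)
      rw [this]; simp

/-- A sends e_d to the maximiser p of ⟨θ, ·⟩ on the closure of D, and the horizontal space to the
hyperplane orthogonal to θ by a basis normalised for the Hessian of γ² at p. -/
theorem exists_isInitialTransformation (hD : IsRotund D) {θ : Space m} (hθ : ‖θ‖ = 1) :
    ∃ A : Space m ≃L[ℝ] Space m, IsInitialTransformation D θ A := by
  have hDo := hD.isOpen
  have hDb := hD.isBounded
  have hD0 := hD.zero_mem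
  have hnhds : D ∈ 𝓝 (0 : Space m) := hDo.mem_nhds hD0
  have hζ := supportFn_pos hDo hDb hD0 hθ
  set ζ := supportFn D θ with hζd
  have hcont : Continuous fun x : Space m => inner ℝ θ x := by fun_prop
  obtain ⟨p, hpD, hpmax⟩ := hDb.isCompact_closure.exists_isMaxOn ⟨0, subset_closure hD0⟩
    hcont.continuousOn
  have hcl : ∀ x ∈ closure D, inner ℝ θ x ≤ ζ := fun x hx =>
    closure_minimal (fun y hy => inner_le_supportFn hDb θ hy)
      (isClosed_le hcont continuous_const) hx
  have hpζ : inner ℝ θ p = ζ := by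
    refine le_antisymm (hcl p hpD) (csSup_le (Nonempty.image _ ⟨0, hD0⟩) ?_)
    rintro _ ⟨y, hy, rfl⟩
    simp only [real_inner_comm θ]
    exact hpmax (subset_closure hy)
  have hpfr : p ∈ frontier D := by
    rw [hDo.frontier_eq]
    exact ⟨hpD, fun h => (inner_lt_supportFn hDo hDb hθ h).ne hpζ⟩
  have hgp : gauge D p = 1 := (gauge_eq_one_iff_mem_frontier hD.convex hnhds).2 hpfr
  have hp0 : p ≠ 0 := by rintro rfl; simp at hgp
  have hcontact : frontier D ∩ outerHalfspace D θ = {p} := by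
    -- The midpoint of two contact points would be interior to the closure of D, hence in D, where
    -- ⟨θ, ·⟩ < ζ.
    refine Subset.antisymm (fun q hq => ?_) (singleton_subset_iff.2 ⟨hpfr, hpζ.ge⟩)
    by_contra hne
    have hmid := hD.strictConvex hpD (frontier_subset_closure hq.1) (Ne.symm hne)
      (a := 1 / 2) (b := 1 / 2) (by norm_num) (by norm_num) (by norm_num)
    rw [hD.convex.interior_closure_eq_interior_of_nonempty_interior
      (by rw [hDo.interior_eq]; exact ⟨0, hD0⟩), hDo.interior_eq] at hmid
    have h1 := inner_lt_supportFn hDo hDb hθ hmid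
    have h2 : ζ ≤ inner ℝ θ q := hq.2
    rw [inner_add_right, inner_smul_right, inner_smul_right, hpζ] at h1
    linarith
  let F : Space m → ℝ := fun y => gauge D y ^ 2
  have hF : ContDiffAt ℝ 2 F p :=
    ((hD.contDiffOn_gauge.contDiffAt (isOpen_compl_singleton.mem_nhds hp0)).pow 2)
  set H := fderiv ℝ (fderiv ℝ F) p with hH
  have hsymm : ∀ x y, H x y = H y x := fun x y => (hF.isSymmSndFDerivAt (by simp)) x y
  have hpos : ∀ w, w ≠ 0 → 0 < H w w := by
    intro w hw
    have := hD.hessian_pos p hp0 w hw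
    rw [iteratedFDeriv_two_apply] at this
    exact this
  obtain ⟨b, hb1, hb2⟩ := exists_orthogonal_family (norm_ne_zero_iff.1 (hθ ▸ one_ne_zero)) H hsymm hpos
  let B : Horiz m →ₗ[ℝ] Space m :=
    { toFun := fun u => ∑ i, u i • b i
      map_add' := fun u u' => by simp [add_smul, Finset.sum_add_distrib]
      map_smul' := fun c u => by simp [Finset.smul_sum, smul_smul] }
  have hBθ : ∀ u, inner ℝ θ (B u) = 0 := fun u => by
    simp [B, inner_sum, inner_smul_right, hb1]
  have hBH : ∀ u, H (B u) (B u) = 2 * ‖u‖ ^ 2 := fun u => by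
    simp only [B, LinearMap.coe_mk, AddHom.coe_mk, map_sum, map_smul,
      sum_apply, smul_apply, smul_eq_mul, hb2,
      EuclideanSpace.real_norm_sq_eq, Finset.mul_sum]
    refine Finset.sum_congr rfl fun i _ => ?_
    simp
    ring
  let T : (Horiz m × ℝ) →ₗ[ℝ] Space m := B.coprod ((LinearMap.id : ℝ →ₗ[ℝ] ℝ).smulRight p)
  have hT : ∀ u v, T (u, v) = B u + v • p := fun u v => by simp [T]
  let A₀ : Space m →ₗ[ℝ] Space m := T ∘ₗ ((joinL m).symm : Space m →ₗ[ℝ] Horiz m × ℝ)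
  have hA₀ : ∀ u v, A₀ (joinUV u v) = B u + v • p := fun u v => by
    rw [← hT]
    simp only [A₀, LinearMap.comp_apply]
    congr 1
    exact (joinL m).symm_apply_apply (u, v)
  have hrep : ∀ x : Space m, ∃ u v, x = joinUV u v := fun x =>
    ⟨_, _, ((joinL m).apply_symm_apply x).symm⟩
  have hinner : ∀ u v, inner ℝ θ (A₀ (joinUV u v)) = v * ζ := fun u v => by
    rw [hA₀, inner_add_right, inner_smul_right, hBθ, hpζ, zero_add]
  -- The pairing with θ recovers v, and the definiteness of H on the image of B then recovers u.
  have hinj : Function.Injective A₀ := by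
    refine (injective_iff_map_eq_zero A₀).2 fun x hx => ?_
    obtain ⟨u, v, rfl⟩ := hrep x
    have h1 := hinner u v
    rw [hx, inner_zero_right, eq_comm, mul_eq_zero, or_iff_left hζ.ne'] at h1
    rw [hA₀, h1, zero_smul, add_zero] at hx
    have h2 := hBH u
    rw [hx, map_zero, eq_comm] at h2
    simp only [mul_eq_zero, OfNat.ofNat_ne_zero, false_or, ne_eq, not_false_eq_true,
      pow_eq_zero_iff, norm_eq_zero] at h2
    rw [h1, h2]
    exact (joinL m).map_zero
  let A : Space m ≃L[ℝ] Space m := (LinearEquiv.ofInjectiveEndo A₀ hinj).toContinuousLinearEquiv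
  have hA : ∀ x, A x = A₀ x := fun x => rfl
  have hAe : A (joinUV 0 1) = p := by rw [hA, hA₀, map_zero, zero_add, one_smul]
  refine ⟨A, ?_, ?_, ?_⟩
  · rw [hcontact, hAe]
  · ext y
    constructor
    · rintro ⟨x, hx, rfl⟩
      obtain ⟨u, v, rfl⟩ := hrep x
      rw [mem_ofPred_eq, vert_joinUV] at hx
      rw [outerHalfspace, mem_ofPred_eq, hA, hinner]
      nlinarith
    · intro hy
      refine ⟨A.symm y, ?_, A.apply_symm_apply y⟩
      obtain ⟨u, v, huv⟩ := hrep (A.symm y)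
      rw [mem_ofPred_eq, huv, vert_joinUV]
      have h1 : y = A₀ (joinUV u v) := by rw [← huv, ← hA, A.apply_symm_apply]
      rw [outerHalfspace, mem_ofPred_eq, h1, hinner] at hy
      by_contra hlt
      push Not at hlt
      nlinarith
  · have hA1 : ∀ u, A (joinUV u 1) = p + B u := fun u => by
      rw [hA, hA₀, one_smul, add_comm]
    have hBc : Continuous B := B.continuous_of_finiteDimensional
    have hmin : ∀ w, inner ℝ θ w = 0 → 1 ≤ gauge D (p + w) := by
      intro w hw
      have h1 := inner_le_supportFn_mul_gauge hDo hDb hD0 hθ (p + w)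
      rw [inner_add_right, hw, hpζ, add_zero] at h1
      by_contra h
      push Not at h
      nlinarith
    -- p minimises the gauge on the supporting hyperplane, so the first order term of the expansion
    -- vanishes there.
    have hFB : ∀ u, fderiv ℝ F p (B u) = 0 := by
      intro u
      have h1 : HasDerivAt (fun s : ℝ => F (p + s • B u)) (fderiv ℝ F p (B u)) 0 := by
        have h2 : HasDerivAt (fun s : ℝ => p + s • B u) (B u) 0 := by
          simpa using ((hasDerivAt_id (0 : ℝ)).smul_const (B u)).const_add p
        have h3 : HasFDerivAt F (fderiv ℝ F p) (p + (0 : ℝ) • B u) := by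
          simpa using (hF.differentiableAt (by simp)).hasFDerivAt
        exact h3.comp_hasDerivAt (0 : ℝ) h2
      have h2 : IsLocalMin (fun s : ℝ => F (p + s • B u)) 0 := by
        refine Eventually.of_forall fun s => ?_
        simp only [F, zero_smul, add_zero, hgp]
        have := hmin (s • B u) (by rw [inner_smul_right, hBθ, mul_zero])
        nlinarith
      exact h2.hasDerivAt_eq_zero h1
    have hB0 : Tendsto B (𝓝 0) (𝓝 0) := by simpa using hBc.tendsto 0
    have ht := (taylor_two_isLittleO hF).comp_tendsto hB0
    have hBO : (fun u => ‖B u‖ ^ 2) =O[𝓝 0] fun u : Horiz m => ‖u‖ ^ 2 := by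
      obtain ⟨K, hK⟩ := (LinearMap.toContinuousLinearMap B).isBoundedLinearMap.bound
      refine IsBigO.of_bound (K ^ 2) (Eventually.of_forall fun u => ?_)
      rw [norm_pow, norm_norm, norm_pow, norm_norm, ← mul_pow]
      exact pow_le_pow_left₀ (norm_nonneg _) (hK.2 u) 2
    have hF1 : (fun u => F (p + B u) - 1) ~[𝓝 0] fun u : Horiz m => ‖u‖ ^ 2 := by
      refine IsLittleO.congr_left (ht.trans_isBigO hBO) fun u => ?_
      simp only [Function.comp_apply, hFB u, ← hH, hBH u, F, hgp, Pi.sub_apply]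
      ring
    -- γ - 1 = (γ² - 1)/(γ + 1), and the denominator tends to 2.
    have hden : (fun u => gauge D (p + B u) + 1) ~[𝓝 0] fun _ : Horiz m => (2 : ℝ) := by
      refine (isEquivalent_const_iff_tendsto two_ne_zero).2 ?_
      have : Continuous fun u => gauge D (p + B u) + 1 :=
        ((continuous_gauge hD.convex hnhds).comp (continuous_const.add hBc)).add continuous_const
      have h2 := this.tendsto 0
      rw [map_zero, add_zero, hgp] at h2
      norm_num at h2
      exact h2
    have hdiv := hF1.div hden
    refine hdiv.congr_left (Eventually.of_forall fun u => ?_)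
    simp only [Pi.div_apply, F, hA1, map_zero, add_zero, hgp]
    have : gauge D (p + B u) + 1 ≠ 0 := by have := gauge_nonneg (s := D) (p + B u); positivity
    field_simp
    ring

end InitialTransformation

/-! ### The gauge in initial coordinates -/

section InitialCoordinates

variable {m : ℕ} {D : Set (Space m)} {θ : Space m} {A : Space m ≃L[ℝ] Space m}

theorem IsInitialTransformation.mem_smul_iff (hA : IsInitialTransformation D θ A) {t : ℝ}
    (ht : 0 < t) (w : Horiz m) (s : ℝ) : A (joinUV w s) ∈ t • outerHalfspace D θ ↔ t ≤ s := by
  rw [mem_smul_set_iff_inv_smul_mem₀ ht.ne', ← hA.image_halfspace, ← map_smul,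
    A.injective.mem_set_image, mem_ofPred_eq]
  have : vert (t⁻¹ • joinUV w s) = t⁻¹ * s := by simp [vert]
  rw [this, inv_mul_eq_div, one_le_div ht]

theorem IsInitialTransformation.gauge_contact (hDo : IsOpen D) (hDc : Convex ℝ D)
    (hD0 : (0 : Space m) ∈ D) (hA : IsInitialTransformation D θ A) :
    gauge D (A (joinUV 0 1)) = 1 := by
  rw [gauge_eq_one_iff_mem_frontier hDc (hDo.mem_nhds hD0)]
  have : A (joinUV 0 1) ∈ frontier D ∩ outerHalfspace D θ := by rw [hA.contact]; rfl
  exact this.1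

theorem gauge_joinUV (D : Set (Space m)) (A : Space m ≃L[ℝ] Space m) (w : Horiz m) {s : ℝ}
    (hs : 0 < s) : gauge D (A (joinUV w s)) = s * gauge D (A (joinUV (s⁻¹ • w) 1)) := by
  have : joinUV w s = s • joinUV (s⁻¹ • w) 1 := by
    simp only [← joinL_apply (_, _), ← map_smul]
    congr 1
    ext <;> simp [hs.ne']
  rw [this, map_smul, gauge_smul_of_nonneg hs.le, smul_eq_mul]

theorem IsInitialTransformation.exists_gauge_bounds (hDo : IsOpen D) (hDc : Convex ℝ D)
    (hD0 : (0 : Space m) ∈ D) (hA : IsInitialTransformation D θ A) :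
    ∃ δ : ℝ, 0 < δ ∧ ∀ w : Horiz m, ‖w‖ ≤ δ →
      1 + ‖w‖ ^ 2 / 4 ≤ gauge D (A (joinUV w 1)) ∧ gauge D (A (joinUV w 1)) ≤ 1 + ‖w‖ ^ 2 := by
  have h := hA.correct_position
  rw [hA.gauge_contact hDo hDc hD0] at h
  obtain ⟨δ, hδ, hb⟩ := Metric.eventually_nhds_iff_ball.1
    (isLittleO_iff.1 h (show (0 : ℝ) < 1 / 2 by norm_num))
  refine ⟨δ / 2, by positivity, fun w hw => ?_⟩
  have := hb w (mem_ball_zero_iff.2 (by linarith))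
  simp only [Pi.sub_apply, Real.norm_eq_abs] at this
  rw [abs_of_nonneg (show 0 ≤ ‖w‖ ^ 2 / 2 by positivity), abs_le] at this
  constructor
  · linarith [this.1]
  · nlinarith [this.2, sq_nonneg ‖w‖]

/-- Growth is quadratic near the contact point; beyond radius δ, convexity along rays from the
contact point makes it at least linear. -/
theorem IsInitialTransformation.exists_le_gauge (hDo : IsOpen D) (hDc : Convex ℝ D)
    (hD0 : (0 : Space m) ∈ D) (hA : IsInitialTransformation D θ A) :
    ∃ c : ℝ, 0 < c ∧ ∀ w : Horiz m,
      1 + c * min (‖w‖ ^ 2) ‖w‖ ≤ gauge D (A (joinUV w 1)) := by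
  obtain ⟨δ, hδ, hb⟩ := hA.exists_gauge_bounds hDo hDc hD0
  refine ⟨min (1 / 4) (δ / 4), by positivity, fun w => ?_⟩
  rcases le_total ‖w‖ δ with h | h
  · refine le_trans ?_ (hb w h).1
    have : min (1 / 4) (δ / 4) * min (‖w‖ ^ 2) ‖w‖ ≤ 1 / 4 * ‖w‖ ^ 2 := by
      gcongr
      · exact min_le_left _ _
      · exact min_le_left _ _
    linarith
  · have hw : 0 < ‖w‖ := hδ.trans_le h
    set l := δ / ‖w‖ with hl
    have hl0 : 0 < l := by positivity
    have hl1 : l ≤ 1 := by rw [hl, div_le_one hw]; exact h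
    have hnorm : ‖l • w‖ = δ := by
      rw [norm_smul, Real.norm_eq_abs, abs_of_pos hl0, hl]; field_simp
    have h1 := (hb (l • w) hnorm.le).1
    -- The point at radius δ is a convex combination of the contact point and the given point, so
    -- the bound at radius δ propagates outward.
    have hsplit : A (joinUV (l • w) 1) = l • A (joinUV w 1) + (1 - l) • A (joinUV 0 1) := by
      rw [← map_smul, ← map_smul, ← map_add]
      congr 1
      simp only [← joinL_apply (_, _), ← map_smul, ← map_add]
      congr 1
      ext <;> simp
    have h2 : gauge D (A (joinUV (l • w) 1)) ≤ l * gauge D (A (joinUV w 1)) + (1 - l) := by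
      rw [hsplit]
      refine (gauge_add_le hDc (absorbent_nhds_zero (hDo.mem_nhds hD0)) _ _).trans ?_
      rw [gauge_smul_of_nonneg hl0.le, gauge_smul_of_nonneg (by linarith),
        hA.gauge_contact hDo hDc hD0, smul_eq_mul, smul_eq_mul, mul_one]
    rw [hnorm] at h1
    have h3 : l * (δ / 4 * ‖w‖) = δ ^ 2 / 4 := by rw [hl]; field_simp
    have h4 : δ / 4 * ‖w‖ ≤ gauge D (A (joinUV w 1)) - 1 :=
      le_of_mul_le_mul_left (by linarith) hl0
    have : min (1 / 4) (δ / 4) * min (‖w‖ ^ 2) ‖w‖ ≤ δ / 4 * ‖w‖ := by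
      gcongr
      · exact min_le_right _ _
      · exact min_le_right _ _
    linarith

/-- A horizontal displacement w raises the gauge by about ‖w‖²/t, so displacements of order √(at)
cost only O(a), the same as vertical displacements of order a. -/
theorem IsInitialTransformation.gauge_le_add (hDo : IsOpen D) (hDc : Convex ℝ D)
    (hD0 : (0 : Space m) ∈ D) (hA : IsInitialTransformation D θ A) {R : ℝ} (hR : 0 ≤ R) :
    ∃ ε : ℝ, 0 < ε ∧ ∀ t a : ℝ, 0 < t → 0 < a → a / t ≤ ε → ∀ (w : Horiz m) (s : ℝ),
      ‖w‖ ≤ R * √(a * t) → t ≤ s → s ≤ t + R * a →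
        gauge D (A (joinUV w s)) ≤ t + (R + R ^ 2) * a := by
  obtain ⟨δ, hδ, hb⟩ := hA.exists_gauge_bounds hDo hDc hD0
  refine ⟨(δ / (R + 1)) ^ 2, by positivity, fun t a ht ha hat w s hw hts hs => ?_⟩
  have hs0 : 0 < s := ht.trans_le hts
  rw [gauge_joinUV D A w hs0]
  have hn : ‖s⁻¹ • w‖ = ‖w‖ / s := by
    rw [norm_smul, Real.norm_eq_abs, abs_of_pos (by positivity)]; field_simp
  have hsq : ‖w‖ ^ 2 ≤ R ^ 2 * (a * t) := by
    calc ‖w‖ ^ 2 ≤ (R * √(a * t)) ^ 2 := by gcongr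
      _ = R ^ 2 * (a * t) := by rw [mul_pow, Real.sq_sqrt (by positivity)]
  have hsmall : ‖w‖ / s ≤ δ := by
    rw [div_le_iff₀ hs0]
    refine abs_le_of_sq_le_sq' ?_ (by positivity) |>.2
    have h1 : a ≤ (δ / (R + 1)) ^ 2 * t := (div_le_iff₀ ht).1 hat
    calc ‖w‖ ^ 2 ≤ R ^ 2 * (a * t) := hsq
      _ ≤ R ^ 2 * (((δ / (R + 1)) ^ 2 * t) * t) := by gcongr
      _ = (R / (R + 1)) ^ 2 * (δ * t) ^ 2 := by field_simp
      _ ≤ 1 ^ 2 * (δ * s) ^ 2 := by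
        gcongr
        rw [div_le_one (by positivity)]; linarith
      _ = (δ * s) ^ 2 := by ring
  have h2 := (hb (s⁻¹ • w) (hn ▸ hsmall)).2
  rw [hn] at h2
  calc s * gauge D (A (joinUV (s⁻¹ • w) 1)) ≤ s * (1 + (‖w‖ / s) ^ 2) := by gcongr
    _ = s + ‖w‖ ^ 2 / s := by field_simp
    _ ≤ (t + R * a) + R ^ 2 * (a * t) / t := by gcongr
    _ = t + (R + R ^ 2) * a := by field_simp; ring

/-- With u = ‖w‖/√(at) and v = (s-t)/a, the excess of the gauge over t is at least of order u + v in
units of a. If u ≤ 1+v, the vertical part v suffices. Otherwise s ≤ t(1+v) ≤ tu, so the quadratic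
branch of the horizontal growth is at least au; the linear branch is √(at) u, and a ≤ √(at). -/
theorem IsInitialTransformation.exists_mul_le_gauge_sub (hDo : IsOpen D) (hDc : Convex ℝ D)
    (hD0 : (0 : Space m) ∈ D) (hA : IsInitialTransformation D θ A) :
    ∃ c : ℝ, 0 < c ∧ ∀ t a : ℝ, 0 < t → 0 < a → a ≤ t → ∀ (w : Horiz m) (s : ℝ), t ≤ s →
      c * (1 + ‖w‖ / √(a * t) + (s - t) / a) ≤ 1 + (gauge D (A (joinUV w s)) - t) / a := by
  obtain ⟨c, hc, hb⟩ := hA.exists_le_gauge hDo hDc hD0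
  refine ⟨min (1 / 2) c, by positivity, fun t a ht ha hat w s hts => ?_⟩
  have hs0 : 0 < s := ht.trans_le hts
  have hb0 : 0 < √(a * t) := by positivity
  set b := √(a * t) with hbd
  have hb2 : b ^ 2 = a * t := Real.sq_sqrt (by positivity)
  set u := ‖w‖ / b with hu
  set v := (s - t) / a with hv
  have hu0 : 0 ≤ u := by positivity
  have hv0 : 0 ≤ v := div_nonneg (by linarith) ha.le
  have hwu : ‖w‖ = b * u := by rw [hu]; field_simp
  have hsv : s = t + a * v := by rw [hv]; field_simp; ring
  rw [gauge_joinUV D A w hs0]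
  have hn : ‖s⁻¹ • w‖ = ‖w‖ / s := by
    rw [norm_smul, Real.norm_eq_abs, abs_of_pos (by positivity)]; field_simp
  have h1 := hb (s⁻¹ • w)
  rw [hn] at h1
  set γ := gauge D (A (joinUV (s⁻¹ • w) 1)) with hγ
  have hγ1 : 1 ≤ γ := by
    have : 0 ≤ c * min ((‖w‖ / s) ^ 2) (‖w‖ / s) := by positivity
    linarith
  have hgoal1 : v ≤ (s * γ - t) / a := by
    rw [le_div_iff₀ ha, hv, div_mul_cancel₀ _ ha.ne']
    nlinarith
  rcases le_total u (1 + v) with huv | huv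
  · have : min (1 / 2) c * (1 + u + v) ≤ 1 / 2 * (1 + u + v) := by
      gcongr; exact min_le_left _ _
    linarith
  · have hab : a ≤ b := by
      refine abs_le_of_sq_le_sq' ?_ hb0.le |>.2
      rw [hb2]; nlinarith
    have hkey : a * u ≤ s * min ((‖w‖ / s) ^ 2) (‖w‖ / s) := by
      rw [mul_min_of_nonneg _ _ hs0.le]
      refine le_min ?_ ?_
      · have : s * (‖w‖ / s) ^ 2 = a * t * u ^ 2 / s := by
          rw [hwu, div_pow, mul_pow, hb2]; field_simp
        rw [this, le_div_iff₀ hs0]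
        have h3 : s ≤ t * (1 + v) := by rw [hsv]; nlinarith
        calc a * u * s ≤ a * u * (t * (1 + v)) := by gcongr
          _ ≤ a * u * (t * u) := by gcongr
          _ = a * t * u ^ 2 := by ring
      · have : s * (‖w‖ / s) = b * u := by rw [hwu]; field_simp
        rw [this]; gcongr
    have h4 : v + c * u ≤ (s * γ - t) / a := by
      rw [le_div_iff₀ ha]
      have h5 : s * (1 + c * min ((‖w‖ / s) ^ 2) (‖w‖ / s)) ≤ s * γ := by gcongr
      have h6 : c * (a * u) ≤ c * (s * min ((‖w‖ / s) ^ 2) (‖w‖ / s)) := by gcongr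
      nlinarith
    have h7 : min (1 / 2) c * (1 + v) ≤ 1 / 2 * (1 + v) := by gcongr; exact min_le_left _ _
    have h8 : min (1 / 2) c * u ≤ c * u := by gcongr; exact min_le_right _ _
    linarith

end InitialCoordinates

/-! ### Von Mises functions -/

section VonMises

variable {ψ : ℝ → ℝ}

theorem IsVonMises.monotoneOn (hψ : IsVonMises ψ) : MonotoneOn ψ (Ici 0) :=
  monotoneOn_of_deriv_nonneg (convex_Ici 0) hψ.continuousOn
    (by
      rw [interior_Ici]
      exact hψ.contDiffOn.differentiableOn (by norm_num))
    (fun x hx => (hψ.deriv_pos x (by simpa using hx)).le)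

theorem IsVonMises.scaleFn_pos (hψ : IsVonMises ψ) {t : ℝ} (ht : 0 < t) : 0 < scaleFn ψ t :=
  one_div_pos.2 (hψ.deriv_pos t ht)

theorem IsVonMises.hasDerivAt (hψ : IsVonMises ψ) {t : ℝ} (ht : 0 < t) :
    HasDerivAt ψ (1 / scaleFn ψ t) t := by
  have := ((hψ.contDiffOn.differentiableOn (by norm_num)).differentiableAt
    (Ioi_mem_nhds ht)).hasDerivAt
  simpa [scaleFn] using this

theorem IsVonMises.differentiableAt_scaleFn (hψ : IsVonMises ψ) {t : ℝ} (ht : 0 < t) :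
    DifferentiableAt ℝ (scaleFn ψ) t := by
  have h1 : DifferentiableAt ℝ (deriv ψ) t :=
    (((contDiffOn_succ_iff_deriv_of_isOpen (n := 1) isOpen_Ioi).1 hψ.contDiffOn).2.2.differentiableOn
      (by norm_num)).differentiableAt (Ioi_mem_nhds ht)
  exact (differentiableAt_const 1).div h1 (hψ.deriv_pos t ht).ne'

/-- a' → 0 and the mean value inequality; all estimates on ψ below rest on this slow variation of a.
-/
theorem IsVonMises.abs_scaleFn_sub_le (hψ : IsVonMises ψ) {ε : ℝ} (hε : 0 < ε) :
    ∃ T : ℝ, 0 < T ∧ ∀ t, T ≤ t → ∀ s, t ≤ s → |scaleFn ψ s - scaleFn ψ t| ≤ ε * (s - t) := by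
  obtain ⟨T, hT⟩ := eventually_atTop.1 (hψ.tendsto_deriv.eventually (Metric.ball_mem_nhds 0 hε))
  refine ⟨max T 1, by positivity, fun t ht s hts => ?_⟩
  have hd : ∀ x ∈ Icc t s, DifferentiableAt ℝ (scaleFn ψ) x := fun x hx =>
    hψ.differentiableAt_scaleFn (zero_lt_one.trans_le ((le_max_right T 1).trans (ht.trans hx.1)))
  have hbound : ∀ x ∈ Icc t s, ‖deriv (scaleFn ψ) x‖ ≤ ε := by
    intro x hx
    have := hT x ((le_max_left T 1).trans (ht.trans hx.1))
    rw [dist_zero_right] at this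
    exact this.le
  have := (convex_Icc t s).norm_image_sub_le_of_norm_deriv_le hd hbound
    (left_mem_Icc.2 hts) (right_mem_Icc.2 hts)
  simpa [Real.norm_eq_abs, abs_of_nonneg (sub_nonneg.2 hts)] using this

theorem IsVonMises.scaleFn_div_tendsto (hψ : IsVonMises ψ) :
    Tendsto (fun t => scaleFn ψ t / t) atTop (𝓝 0) := by
  rw [Metric.tendsto_atTop]
  intro ε hε
  obtain ⟨T, hT0, hT⟩ := hψ.abs_scaleFn_sub_le (show 0 < ε / 2 by positivity)
  refine ⟨max T (4 * (scaleFn ψ T / ε)) , fun t ht => ?_⟩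
  have hTt : T ≤ t := (le_max_left _ _).trans ht
  have ht0 : 0 < t := hT0.trans_le hTt
  have h1 := (abs_le.1 (hT T le_rfl t hTt)).2
  have h2 : 4 * (scaleFn ψ T / ε) ≤ t := (le_max_right _ _).trans ht
  have h3 : scaleFn ψ T ≤ t * ε / 4 := by
    have : scaleFn ψ T = 4 * (scaleFn ψ T / ε) * ε / 4 := by field_simp
    rw [this]; gcongr
  rw [dist_zero_right, Real.norm_eq_abs, abs_of_pos (div_pos (hψ.scaleFn_pos ht0) ht0),
    div_lt_iff₀ ht0]
  nlinarith

/-- With Lipschitz constant 1/(2(C+1)), a stays above a(t)/2 on a window of length C a(t), so ψ' ≤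
2/a(t) there. -/
theorem IsVonMises.sub_le (hψ : IsVonMises ψ) {C : ℝ} (hC : 0 ≤ C) :
    ∃ T : ℝ, 0 < T ∧ ∀ t, T ≤ t → ψ (t + C * scaleFn ψ t) - ψ t ≤ 2 * C := by
  obtain ⟨T, hT0, hT⟩ := hψ.abs_scaleFn_sub_le (show 0 < 1 / (2 * (C + 1)) by positivity)
  refine ⟨T, hT0, fun t ht => ?_⟩
  have ht0 : 0 < t := hT0.trans_le ht
  have ha := hψ.scaleFn_pos ht0
  set a := scaleFn ψ t with had
  have hts : t ≤ t + C * a := by nlinarith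
  have hderiv : ∀ x ∈ Icc t (t + C * a), HasDerivWithinAt ψ (1 / scaleFn ψ x) (Icc t (t + C * a)) x :=
    fun x hx => (hψ.hasDerivAt (ht0.trans_le hx.1)).hasDerivWithinAt
  have hbound : ∀ x ∈ Icc t (t + C * a), ‖1 / scaleFn ψ x‖ ≤ 2 / a := by
    intro x hx
    have h1 := (abs_le.1 (hT t ht x hx.1)).1
    have h2 : 1 / (2 * (C + 1)) * (x - t) ≤ a / 2 := by
      calc 1 / (2 * (C + 1)) * (x - t) ≤ 1 / (2 * (C + 1)) * ((C + 1) * a) := by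
            gcongr; nlinarith [hx.2]
        _ = a / 2 := by field_simp
    have h3 : a / 2 ≤ scaleFn ψ x := by linarith
    have h4 : 0 < scaleFn ψ x := by linarith
    rw [Real.norm_eq_abs, abs_of_pos (by positivity), div_le_div_iff₀ h4 ha]
    linarith
  have := (convex_Icc t (t + C * a)).norm_image_sub_le_of_norm_hasDerivWithin_le hderiv hbound
    (left_mem_Icc.2 hts) (right_mem_Icc.2 hts)
  rw [add_sub_cancel_left, Real.norm_eq_abs, Real.norm_eq_abs,
    abs_of_nonneg (mul_nonneg hC ha.le)] at this
  have h5 : 2 / a * (C * a) = 2 * C := by field_simp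
  rw [h5] at this
  exact (le_abs_self _).trans this

/-- Once a has slope at most 1/p, ψ'(x) ≥ 1/(a(t) + (x-t)/p), and the right side integrates to the
logarithm. So exp(-ψ) decays at scale a(t) at least like a power of order p, for any prescribed p.
-/
theorem IsVonMises.mul_log_le_sub (hψ : IsVonMises ψ) {p : ℝ} (hp : 0 < p) :
    ∃ T : ℝ, 0 < T ∧ ∀ t, T ≤ t → ∀ s, t ≤ s →
      p * Real.log (1 + (s - t) / (p * scaleFn ψ t)) ≤ ψ s - ψ t := by
  obtain ⟨T, hT0, hT⟩ := hψ.abs_scaleFn_sub_le (show 0 < 1 / p by positivity)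
  refine ⟨T, hT0, fun t ht s hts => ?_⟩
  have ht0 : 0 < t := hT0.trans_le ht
  have ha := hψ.scaleFn_pos ht0
  set a := scaleFn ψ t with had
  let F : ℝ → ℝ := fun x => ψ x - p * Real.log (1 + (x - t) / (p * a))
  have harg : ∀ x, t ≤ x → 0 < 1 + (x - t) / (p * a) := fun x hx => by
    have : 0 ≤ (x - t) / (p * a) := div_nonneg (by linarith) (by positivity)
    linarith
  have hder : ∀ x, t ≤ x → HasDerivAt F
      (1 / scaleFn ψ x - p * ((1 / (p * a)) / (1 + (x - t) / (p * a)))) x := by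
    intro x hx
    have h1 : HasDerivAt (fun x => 1 + (x - t) / (p * a)) (1 / (p * a)) x := by
      simpa using (((hasDerivAt_id x).sub_const t).div_const (p * a)).const_add 1
    exact (hψ.hasDerivAt (ht0.trans_le hx)).sub ((h1.log (harg x hx).ne').const_mul p)
  have hmono : MonotoneOn F (Ici t) := by
    refine monotoneOn_of_deriv_nonneg (convex_Ici t)
      (fun x hx => (hder x hx).continuousAt.continuousWithinAt)
      (fun x hx => (hder x (interior_subset hx)).differentiableAt.differentiableWithinAt) ?_
    intro x hx
    have hx' : t ≤ x := interior_subset hx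
    rw [(hder x hx').deriv]
    have h2 := (abs_le.1 (hT t ht x hx')).2
    have hax := hψ.scaleFn_pos (ht0.trans_le hx')
    have h3 : p * ((1 / (p * a)) / (1 + (x - t) / (p * a))) = 1 / (a + 1 / p * (x - t)) := by
      have := harg x hx'
      have h5 : a + 1 / p * (x - t) = a * (1 + (x - t) / (p * a)) := by field_simp
      rw [h5]
      field_simp
    rw [h3, sub_nonneg]
    exact one_div_le_one_div_of_le hax (by linarith)
  have := hmono self_mem_Ici hts hts
  simp only [F, sub_self, zero_div, add_zero, Real.log_one, mul_zero, sub_zero] at this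
  linarith

end VonMises

/-! ### Volumes in initial coordinates -/

section Volumes

theorem lintegral_comp_inv_smul {E : Type*} [NormedAddCommGroup E] [NormedSpace ℝ E]
    [MeasurableSpace E] [BorelSpace E] [FiniteDimensional ℝ E] (μ : Measure E) [μ.IsAddHaarMeasure]
    {f : E → ℝ≥0∞} (hf : Measurable f) {r : ℝ} (hr : 0 < r) :
    ∫⁻ x, f (r⁻¹ • x) ∂μ = ENNReal.ofReal (r ^ Module.finrank ℝ E) * ∫⁻ x, f x ∂μ := by
  rw [← lintegral_map (g := fun x => r⁻¹ • x) hf (measurable_const_smul _),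
    Measure.map_addHaar_smul μ (inv_ne_zero hr.ne'), lintegral_smul_measure, inv_pow, inv_inv,
    abs_of_pos (by positivity), smul_eq_mul]

variable {m : ℕ}

/-- The linear coordinates `(u, v) ↦ A (u, v)`. -/
noncomputable def coordL (A : Space m ≃L[ℝ] Space m) : (Horiz m × ℝ) ≃L[ℝ] Space m :=
  (joinL m).trans A

theorem coordL_apply (A : Space m ≃L[ℝ] Space m) (w : Horiz m) (s : ℝ) :
    coordL A (w, s) = A (joinUV w s) := rfl

theorem measurableSet_coordL_image (A : Space m ≃L[ℝ] Space m) {E : Set (Horiz m × ℝ)}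
    (hE : MeasurableSet E) : MeasurableSet (coordL A '' E) :=
  ((coordL A).toHomeomorph.toMeasurableEquiv.measurableSet_image).2 hE

/-- Uniqueness of Haar measure; only the positivity of the Jacobian factor matters, not its value.
-/
theorem exists_volume_coordL (A : Space m ≃L[ℝ] Space m) :
    ∃ κ : ℝ, 0 < κ ∧
      (∀ E : Set (Horiz m × ℝ), MeasurableSet E →
        volume (coordL A '' E) = ENNReal.ofReal κ * volume E) ∧
      ∀ f : Space m → ℝ≥0∞, Measurable f →
        ∫⁻ x, f x = ENNReal.ofReal κ * ∫⁻ z, f (coordL A z) := by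
  have hH := (coordL A).symm.isAddHaarMeasure_map (volume : Measure (Space m))
  set ν := Measure.map (coordL A).symm (volume : Measure (Space m)) with hν
  have hI : (volume : Measure (Horiz m × ℝ)).IsAddHaarMeasure := by
    rw [Measure.volume_eq_prod]; infer_instance
  set c := Measure.addHaarScalarFactor ν (volume : Measure (Horiz m × ℝ)) with hcd
  have hc : 0 < c := Measure.addHaarScalarFactor_pos_of_isAddHaarMeasure _ _
  have heq : ν = (c : ℝ≥0∞) • volume := Measure.isAddLeftInvariant_eq_smul _ _
  have hm : Measurable (coordL A).symm := (coordL A).symm.continuous.measurable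
  refine ⟨c, hc, fun E hE => ?_, fun f hf => ?_⟩
  · rw [ENNReal.ofReal_coe_nnreal, ← smul_eq_mul, ← Measure.smul_apply, ← heq,
      hν, Measure.map_apply hm hE]
    congr 1
    exact (coordL A).toEquiv.image_eq_preimage_symm E
  · rw [ENNReal.ofReal_coe_nnreal, ← smul_eq_mul, ← lintegral_smul_measure, ← heq, hν,
      lintegral_map (f := fun z => f (coordL A z)) (hf.comp (coordL A).continuous.measurable) hm]
    simp

/-- For b = √(a(t) t) and a = a(t) the factor b^m a is q. -/
theorem volume_box (u : Horiz m) {b a R : ℝ} (hb : 0 < b) (s : ℝ) :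
    (volume : Measure (Horiz m × ℝ)) (Metric.ball u (b * R) ×ˢ Icc s (s + a)) =
      ENNReal.ofReal (b ^ m * a) * volume (Metric.ball (0 : Horiz m) R) := by
  rw [Measure.volume_eq_prod, Measure.prod_prod, Measure.addHaar_ball_mul_of_pos _ _ hb,
    Real.volume_Icc, finrank_euclideanSpace_fin, add_sub_cancel_left,
    ENNReal.ofReal_mul (by positivity)]
  ring

end Volumes

/-! ### Mass of halfspaces for light tails -/

section Light

variable {m : ℕ} {D : Set (Space m)} {θ : Space m} {A : Space m ≃L[ℝ] Space m} {g ψ : ℝ → ℝ} {C : ℝ}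

theorem qFn_eq (hψ : IsVonMises ψ) {t : ℝ} (ht : 0 < t) :
    qFn m ψ t = √(scaleFn ψ t * t) ^ m * scaleFn ψ t := by
  have h0 : 0 ≤ scaleFn ψ t * t := (mul_pos (hψ.scaleFn_pos ht) ht).le
  rw [qFn, Real.sqrt_eq_rpow, ← Real.rpow_natCast, ← Real.rpow_mul h0]
  congr 2
  ring

theorem qFn_pos (hψ : IsVonMises ψ) {t : ℝ} (ht : 0 < t) : 0 < qFn m ψ t := by
  have h0 := hψ.scaleFn_pos ht
  rw [qFn_eq hψ ht]
  positivity

/-- Values of the density close to the contact point. -/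
theorem exists_le_homDensity (hDo : IsOpen D) (hDc : Convex ℝ D)
    (hD0 : (0 : Space m) ∈ D) (hA : IsInitialTransformation D θ A) (hC : 0 < C)
    (hψ : IsVonMises ψ) (hg : ∀ s, 0 ≤ s → g s = C * Real.exp (-ψ s)) {R : ℝ} (hR : 0 ≤ R) :
    ∃ c : ℝ, 0 < c ∧ ∀ᶠ t in atTop, ∀ (w : Horiz m) (s : ℝ), ‖w‖ ≤ R * √(scaleFn ψ t * t) →
      t ≤ s → s ≤ t + R * scaleFn ψ t → c * g t ≤ homDensity D g (coordL A (w, s)) := by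
  obtain ⟨ε, hε, hgauge⟩ := hA.gauge_le_add hDo hDc hD0 hR
  obtain ⟨T, hT0, hT⟩ := hψ.sub_le (show 0 ≤ R + R ^ 2 by positivity)
  refine ⟨Real.exp (-(2 * (R + R ^ 2))), Real.exp_pos _, ?_⟩
  filter_upwards [eventually_ge_atTop T, hψ.scaleFn_div_tendsto.eventually (ge_mem_nhds hε)]
    with t ht hat w s hw hts hs
  have ht0 : 0 < t := hT0.trans_le ht
  have ha := hψ.scaleFn_pos ht0
  have h1 := hgauge t _ ht0 ha hat w s hw hts hs
  have hmono := hψ.monotoneOn (gauge_nonneg (s := D) (A (joinUV w s)))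
    (show (0 : ℝ) ≤ t + (R + R ^ 2) * scaleFn ψ t by positivity) h1
  have h2 := hT t ht
  rw [homDensity, coordL_apply, hg _ (gauge_nonneg _), hg t ht0.le, mul_left_comm, ← Real.exp_add]
  gcongr
  linarith

/-- The box of horizontal size √(at) and height a at the contact point has volume of order q and
carries density of order g(t). -/
theorem exists_ofReal_le_lintegral_light (hDo : IsOpen D) (hDc : Convex ℝ D)
    (hD0 : (0 : Space m) ∈ D) (hA : IsInitialTransformation D θ A) (hC : 0 < C) (hψ : IsVonMises ψ)
    (hg : ∀ s, 0 ≤ s → g s = C * Real.exp (-ψ s)) :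
    ∃ c : ℝ, 0 < c ∧ ∀ᶠ t in atTop, ENNReal.ofReal (c * (qFn m ψ t * g t)) ≤
      ∫⁻ x in t • outerHalfspace D θ, ENNReal.ofReal (homDensity D g x) := by
  obtain ⟨c, hc, hev⟩ := exists_le_homDensity hDo hDc hD0 hA hC hψ hg zero_le_one
  obtain ⟨κ, hκ, hvol, -⟩ := exists_volume_coordL A
  obtain ⟨B, hB, hball⟩ : ∃ B : ℝ, volume (Metric.ball (0 : Horiz m) 1) = ENNReal.ofReal B ∧ 0 < B :=
    ⟨_, (ENNReal.ofReal_toReal measure_ball_lt_top.ne).symm,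
      ENNReal.toReal_pos (Metric.measure_ball_pos _ _ one_pos).ne' measure_ball_lt_top.ne⟩
  refine ⟨c * (κ * B), by positivity, ?_⟩
  filter_upwards [hev, eventually_gt_atTop 0] with t ht ht0
  have ha := hψ.scaleFn_pos ht0
  have hb : 0 < √(scaleFn ψ t * t) := by positivity
  set E : Set (Horiz m × ℝ) :=
    Metric.ball 0 (√(scaleFn ψ t * t) * 1) ×ˢ Icc t (t + scaleFn ψ t) with hE
  have hEm : MeasurableSet E := Metric.isOpen_ball.measurableSet.prod measurableSet_Icc
  have hgt : 0 ≤ g t := by rw [hg t ht0.le]; positivity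
  have hq := (qFn_pos (m := m) hψ ht0).le
  have hsub : coordL A '' E ⊆ t • outerHalfspace D θ := by
    rintro _ ⟨⟨w, s⟩, ⟨hw, hs⟩, rfl⟩
    exact (hA.mem_smul_iff ht0 w s).2 hs.1
  calc _ = ENNReal.ofReal (c * g t) * volume (coordL A '' E) := by
        rw [hvol E hEm, hE, volume_box _ hb, ← qFn_eq hψ ht0,
          hB, ← ENNReal.ofReal_mul hq, ← ENNReal.ofReal_mul hκ.le, ← ENNReal.ofReal_mul (by positivity)]
        congr 1
        ring
    _ = ∫⁻ _ in coordL A '' E, ENNReal.ofReal (c * g t) := by rw [setLIntegral_const]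
    _ ≤ ∫⁻ x in coordL A '' E, ENNReal.ofReal (homDensity D g x) := by
        refine setLIntegral_mono' (measurableSet_coordL_image A hEm) ?_
        rintro _ ⟨⟨w, s⟩, ⟨hw, hs⟩, rfl⟩
        refine ENNReal.ofReal_le_ofReal (ht w s ?_ hs.1 ?_)
        · have := (mem_ball_zero_iff.1 hw).le
          linarith
        · linarith [hs.2]
    _ ≤ _ := lintegral_mono_set hsub

/-- Polynomial domination of the density in the halfspace. -/
theorem exists_homDensity_le (hDo : IsOpen D) (hDb : Bornology.IsBounded D) (hDc : Convex ℝ D)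
    (hD0 : (0 : Space m) ∈ D) (hθ : ‖θ‖ = 1) (hA : IsInitialTransformation D θ A) (hC : 0 < C)
    (hψ : IsVonMises ψ) (hg : ∀ s, 0 ≤ s → g s = C * Real.exp (-ψ s)) {p : ℝ} (hp : 1 ≤ p) :
    ∃ K : ℝ, 0 < K ∧ ∀ᶠ t in atTop, ∀ (w : Horiz m) (s : ℝ), t ≤ s →
      homDensity D g (coordL A (w, s)) ≤ g t * K *
        ((1 + ‖(√(scaleFn ψ t * t))⁻¹ • w‖) ^ (-p) *
          (1 + ‖(scaleFn ψ t)⁻¹ • (s - t)‖) ^ (-p)) := by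
  obtain ⟨c, hc, hgauge⟩ := hA.exists_mul_le_gauge_sub hDo hDc hD0
  -- Exponent 2p, because 1+u+v dominates both 1+u and 1+v and each of the two receives the power p.
  obtain ⟨T, hT0, hT⟩ := hψ.mul_log_le_sub (show 0 < 2 * p by positivity)
  refine ⟨(c / (2 * p)) ^ (-(2 * p)), by positivity, ?_⟩
  filter_upwards [eventually_ge_atTop T,
    hψ.scaleFn_div_tendsto.eventually (ge_mem_nhds zero_lt_one)] with t ht hat w s hts
  have ht0 : 0 < t := hT0.trans_le ht
  have ha := hψ.scaleFn_pos ht0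
  have hat' : scaleFn ψ t ≤ t := by rwa [div_le_one ht0] at hat
  set a := scaleFn ψ t with had
  have hb : 0 < √(a * t) := by positivity
  set γ := gauge D (A (joinUV w s)) with hγd
  have hγ : t ≤ γ := hts.trans (le_gauge_of_mem hDo hDb hD0 hθ (ht0.trans_le hts)
    ((hA.mem_smul_iff (ht0.trans_le hts) w s).2 le_rfl))
  have h1 := hgauge t a ht0 ha hat' w s hts
  have hu : ‖(√(a * t))⁻¹ • w‖ = ‖w‖ / √(a * t) := by
    rw [norm_smul, Real.norm_eq_abs, abs_of_pos (by positivity)]; field_simp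
  have hv : ‖a⁻¹ • (s - t)‖ = (s - t) / a := by
    rw [norm_smul, Real.norm_eq_abs, Real.norm_eq_abs, abs_of_pos (by positivity),
      abs_of_nonneg (sub_nonneg.2 hts)]; field_simp
  rw [hu, hv]
  set u := ‖w‖ / √(a * t) with hud
  set v := (s - t) / a with hvd
  have hu0 : 0 ≤ u := by positivity
  have hv0 : 0 ≤ v := div_nonneg (sub_nonneg.2 hts) ha.le
  set τ := (γ - t) / a with hτ
  have hτ0 : 0 ≤ τ := div_nonneg (sub_nonneg.2 hγ) ha.le
  have h2 := hT t ht γ hγ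
  have h3 : (γ - t) / (2 * p * a) = τ / (2 * p) := by rw [hτ]; field_simp
  rw [h3] at h2
  have harg : 0 < 1 + τ / (2 * p) := by positivity
  have h4 : Real.exp (-(ψ γ - ψ t)) ≤ (1 + τ / (2 * p)) ^ (-(2 * p)) := by
    rw [Real.rpow_def_of_pos harg]
    gcongr
    linarith
  have h5 : c / (2 * p) * (1 + u + v) ≤ 1 + τ / (2 * p) := by
    calc c / (2 * p) * (1 + u + v) = (c * (1 + u + v)) / (2 * p) := by ring
      _ ≤ (1 + τ) / (2 * p) := by gcongr
      _ ≤ 1 + τ / (2 * p) := by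
        rw [add_div]
        gcongr
        rw [div_le_one (by positivity)]; linarith
  have h6 : (1 + τ / (2 * p)) ^ (-(2 * p)) ≤ (c / (2 * p)) ^ (-(2 * p)) *
      ((1 + u) ^ (-p) * (1 + v) ^ (-p)) := by
    calc (1 + τ / (2 * p)) ^ (-(2 * p)) ≤ (c / (2 * p) * (1 + u + v)) ^ (-(2 * p)) :=
          Real.rpow_le_rpow_of_nonpos (by positivity) h5 (by linarith)
      _ = (c / (2 * p)) ^ (-(2 * p)) * ((1 + u + v) ^ (-p) * (1 + u + v) ^ (-p)) := by
          rw [Real.mul_rpow (by positivity) (by positivity), ← Real.rpow_add (by positivity)]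
          congr 2; ring
      _ ≤ _ := by
          refine mul_le_mul_of_nonneg_left (mul_le_mul ?_ ?_ (by positivity) (by positivity))
            (by positivity)
          · exact Real.rpow_le_rpow_of_nonpos (by positivity) (by linarith) (by linarith)
          · exact Real.rpow_le_rpow_of_nonpos (by positivity) (by linarith) (by linarith)
  rw [homDensity, coordL_apply, hg _ (gauge_nonneg _), hg t ht0.le]
  calc C * Real.exp (-ψ γ) = C * Real.exp (-ψ t) * Real.exp (-(ψ γ - ψ t)) := by
        rw [mul_assoc, ← Real.exp_add]; congr 2; ring
    _ ≤ C * Real.exp (-ψ t) * ((c / (2 * p)) ^ (-(2 * p)) * ((1 + u) ^ (-p) * (1 + v) ^ (-p))) := by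
        gcongr
        exact h4.trans h6
    _ = _ := by ring

theorem measurable_homDensity_of_monotone (hDo : IsOpen D) (hDc : Convex ℝ D)
    (hD0 : (0 : Space m) ∈ D) (hg : AntitoneOn g (Ici 0)) : Measurable (homDensity D g) := by
  have h1 : Antitone fun s => g (max s 0) := fun s s' h =>
    hg (mem_Ici.2 (le_max_right _ _)) (mem_Ici.2 (le_max_right _ _)) (max_le_max_right 0 h)
  have h2 : homDensity D g = (fun s => g (max s 0)) ∘ gauge D := by
    ext x; simp [homDensity, max_eq_left (gauge_nonneg (s := D) x)]
  rw [h2]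
  exact h1.measurable.comp (continuous_gauge hDc (hDo.mem_nhds hD0)).measurable

theorem IsVonMises.antitoneOn (hψ : IsVonMises ψ) (hC : 0 < C)
    (hg : ∀ s, 0 ≤ s → g s = C * Real.exp (-ψ s)) : AntitoneOn g (Ici 0) := by
  intro s hs s' hs' hss
  rw [hg s hs, hg s' hs']
  have := hψ.monotoneOn hs hs' hss
  gcongr

/-- The polynomial bound separates the variables; rescaling by √(at) and a produces the factors of
q, and the remaining integrals do not depend on t. -/
theorem exists_lintegral_le_light (hDo : IsOpen D) (hDb : Bornology.IsBounded D)
    (hDc : Convex ℝ D) (hD0 : (0 : Space m) ∈ D) (hθ : ‖θ‖ = 1)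
    (hA : IsInitialTransformation D θ A) (hC : 0 < C) (hψ : IsVonMises ψ)
    (hg : ∀ s, 0 ≤ s → g s = C * Real.exp (-ψ s)) :
    ∃ K : ℝ, 0 < K ∧ ∀ᶠ t in atTop,
      ∫⁻ x in t • outerHalfspace D θ, ENNReal.ofReal (homDensity D g x) ≤
        ENNReal.ofReal (K * (qFn m ψ t * g t)) := by
  -- Exceeds both m and 1, the dimensions of the two integrals.
  set p : ℝ := m + 2 with hp
  obtain ⟨K, hK, hev⟩ := exists_homDensity_le hDo hDb hDc hD0 hθ hA hC hψ hg
    (show 1 ≤ p by rw [hp]; linarith [(Nat.cast_nonneg m : (0 : ℝ) ≤ m)])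
  obtain ⟨κ, hκ, -, hint⟩ := exists_volume_coordL A
  have hc1 : ∫⁻ w : Horiz m, ENNReal.ofReal ((1 + ‖w‖) ^ (-p)) < ⊤ :=
    finite_integral_one_add_norm (by rw [finrank_euclideanSpace_fin, hp]; linarith)
  have hc2 : ∫⁻ s : ℝ, ENNReal.ofReal ((1 + ‖s‖) ^ (-p)) < ⊤ :=
    finite_integral_one_add_norm (by
      rw [Module.finrank_self, hp]; push_cast; linarith [(Nat.cast_nonneg m : (0 : ℝ) ≤ m)])
  set I₁ := ∫⁻ w : Horiz m, ENNReal.ofReal ((1 + ‖w‖) ^ (-p)) with hI₁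
  set I₂ := ∫⁻ s : ℝ, ENNReal.ofReal ((1 + ‖s‖) ^ (-p)) with hI₂
  refine ⟨κ * K * (I₁.toReal * I₂.toReal + 1), by positivity, ?_⟩
  filter_upwards [hev, eventually_gt_atTop 0] with t ht ht0
  have ha := hψ.scaleFn_pos ht0
  have hb : 0 < √(scaleFn ψ t * t) := by positivity
  have hgt : 0 ≤ g t := by rw [hg t ht0.le]; positivity
  have hq := (qFn_pos (m := m) hψ ht0).le
  have hHm : MeasurableSet (t • outerHalfspace D θ) := by
    have : t • outerHalfspace D θ = {x | t * supportFn D θ ≤ inner ℝ θ x} := by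
      ext x; exact mem_smul_outerHalfspace_iff ht0
    rw [this]
    exact measurableSet_le measurable_const (by fun_prop)
  have hfm := measurable_homDensity_of_monotone hDo hDc hD0 (hψ.antitoneOn hC hg)
  have hm1 : ∀ {E : Type} [NormedAddCommGroup E] [MeasurableSpace E] [BorelSpace E],
      Measurable fun w : E => ENNReal.ofReal ((1 + ‖w‖) ^ (-p)) := by
    intro E _ _ _
    exact (measurable_const.add measurable_norm).pow_const _ |>.ennreal_ofReal
  rw [← lintegral_indicator hHm, hint _ (hfm.ennreal_ofReal.indicator hHm)]
  calc _ ≤ ENNReal.ofReal κ * ∫⁻ z : Horiz m × ℝ, ENNReal.ofReal (g t * K) *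
          (ENNReal.ofReal ((1 + ‖(√(scaleFn ψ t * t))⁻¹ • z.1‖) ^ (-p)) *
            ENNReal.ofReal ((1 + ‖(scaleFn ψ t)⁻¹ • (z.2 - t)‖) ^ (-p))) := by
        gcongr with z
        by_cases hz : coordL A z ∈ t • outerHalfspace D θ
        · rw [indicator_of_mem hz, ← ENNReal.ofReal_mul (by positivity),
            ← ENNReal.ofReal_mul (by positivity)]
          exact ENNReal.ofReal_le_ofReal (ht z.1 z.2 ((hA.mem_smul_iff ht0 _ _).1 hz))
        · rw [indicator_of_notMem hz]; exact zero_le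
    _ = ENNReal.ofReal κ * (ENNReal.ofReal (g t * K) *
          ((ENNReal.ofReal (√(scaleFn ψ t * t) ^ m) * I₁) *
            (ENNReal.ofReal (scaleFn ψ t) * I₂))) := by
        have e1 : ∫⁻ w : Horiz m, ENNReal.ofReal ((1 + ‖(√(scaleFn ψ t * t))⁻¹ • w‖) ^ (-p)) =
            ENNReal.ofReal (√(scaleFn ψ t * t) ^ m) * I₁ := by
          rw [lintegral_comp_inv_smul volume hm1 hb, finrank_euclideanSpace_fin]
        have e2 : ∫⁻ s : ℝ, ENNReal.ofReal ((1 + ‖(scaleFn ψ t)⁻¹ • (s - t)‖) ^ (-p)) =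
            ENNReal.ofReal (scaleFn ψ t) * I₂ := by
          rw [lintegral_sub_right_eq_self (fun s : ℝ =>
              ENNReal.ofReal ((1 + ‖(scaleFn ψ t)⁻¹ • s‖) ^ (-p))) t,
            lintegral_comp_inv_smul volume hm1 ha, Module.finrank_self, pow_one]
        have hmu : Measurable fun w : Horiz m =>
            ENNReal.ofReal ((1 + ‖(√(scaleFn ψ t * t))⁻¹ • w‖) ^ (-p)) :=
          hm1.comp (measurable_const_smul _)
        have hmv : Measurable fun s : ℝ =>
            ENNReal.ofReal ((1 + ‖(scaleFn ψ t)⁻¹ • (s - t)‖) ^ (-p)) :=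
          hm1.comp (show Measurable fun s : ℝ => (scaleFn ψ t)⁻¹ • (s - t) by fun_prop)
        rw [lintegral_const_mul' _ _ ENNReal.ofReal_ne_top,
          Measure.volume_eq_prod, lintegral_prod_mul hmu.aemeasurable hmv.aemeasurable, e1, e2]
    _ = ENNReal.ofReal (κ * K * (I₁.toReal * I₂.toReal) * (qFn m ψ t * g t)) := by
        rw [← ENNReal.ofReal_toReal hc1.ne, ← ENNReal.ofReal_toReal hc2.ne, qFn_eq hψ ht0,
          ← ENNReal.ofReal_mul (by positivity), ← ENNReal.ofReal_mul (by positivity),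
          ← ENNReal.ofReal_mul (by positivity), ← ENNReal.ofReal_mul (by positivity),
          ← ENNReal.ofReal_mul (by positivity), ENNReal.toReal_ofReal ENNReal.toReal_nonneg,
          ENNReal.toReal_ofReal ENNReal.toReal_nonneg]
        congr 1
        ring
    _ ≤ _ := by
        refine ENNReal.ofReal_le_ofReal ?_
        gcongr
        linarith

end Light

/-! ### Mass of halfspaces for regularly varying tails -/

section Heavy

variable {m : ℕ} {D : Set (Space m)} {θ : Space m} {g : ℝ → ℝ} {α : ℝ}

/-- A Potter bound. -/
theorem IsRegVarying.le_rpow_mul (hgv : IsRegVarying g α) (hg : AntitoneOn g (Ici 0))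
    (hg0 : ∀ s, 0 ≤ s → 0 < g s) {α' : ℝ} (hα' : 0 < α') (hαα : α' < α) :
    ∃ T : ℝ, 0 < T ∧ ∀ t, T ≤ t → ∀ x, 1 ≤ x → g (t * x) ≤ 2 ^ α' * x ^ (-α') * g t := by
  have h2 : (2 : ℝ) ^ (-α) < 2 ^ (-α') := by
    rw [Real.rpow_lt_rpow_left_iff one_lt_two]; linarith
  obtain ⟨T₀, hT₀⟩ := eventually_atTop.1 ((hgv 2 two_pos).eventually (gt_mem_nhds h2))
  refine ⟨max T₀ 1, by positivity, fun t ht x hx => ?_⟩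
  have ht0 : 0 < t := lt_of_lt_of_le one_pos ((le_max_right _ _).trans ht)
  have hstep : ∀ s, t ≤ s → g (s * 2) ≤ 2 ^ (-α') * g s := fun s hs => by
    have := (hT₀ s ((le_max_left _ _).trans (ht.trans hs))).le
    rwa [div_le_iff₀ (hg0 s (ht0.le.trans hs))] at this
  -- Iterated doubling controls g along t 2^j; between consecutive powers monotonicity loses at most
  -- the factor 2^α'.
  have hpow : ∀ j : ℕ, g (t * 2 ^ j) ≤ (2 ^ (-α')) ^ j * g t := by
    intro j
    induction j with
    | zero => simp
    | succ j ih =>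
      have h1 : t ≤ t * 2 ^ j := le_mul_of_one_le_right ht0.le (one_le_pow₀ one_le_two)
      calc g (t * 2 ^ (j + 1)) = g (t * 2 ^ j * 2) := by rw [pow_succ, mul_assoc]
        _ ≤ 2 ^ (-α') * g (t * 2 ^ j) := hstep _ h1
        _ ≤ 2 ^ (-α') * ((2 ^ (-α')) ^ j * g t) := by gcongr
        _ = _ := by ring
  obtain ⟨j, hj1, hj2⟩ := exists_nat_pow_near hx one_lt_two
  have hmono : g (t * x) ≤ g (t * 2 ^ j) :=
    hg (mem_Ici.2 (by positivity)) (mem_Ici.2 (by positivity)) (by gcongr)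
  refine hmono.trans ((hpow j).trans ?_)
  have := (hg0 t ht0.le).le
  gcongr
  calc ((2 : ℝ) ^ (-α')) ^ j = 2 ^ α' * ((2 : ℝ) ^ (j + 1)) ^ (-α') := by
        rw [← Real.rpow_natCast, ← Real.rpow_natCast, ← Real.rpow_mul two_pos.le,
          ← Real.rpow_mul two_pos.le, ← Real.rpow_add two_pos]
        congr 1; push_cast; ring
    _ ≤ 2 ^ α' * x ^ (-α') := by
        gcongr 2 ^ α' * ?_
        exact Real.rpow_le_rpow_of_nonpos (by positivity) hj2.le (by linarith)

theorem measurableSet_smul_outerHalfspace (D : Set (Space m)) (θ : Space m) (t : ℝ) :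
    MeasurableSet (t • outerHalfspace D θ) := by
  rcases eq_or_ne t 0 with rfl | ht
  · exact (subsingleton_zero_smul_set _).measurableSet
  · refine MeasurableSet.const_smul_of_ne_zero ?_ ht
    exact measurableSet_le measurable_const (by fun_prop)

/-- A Potter bound with exponent α' strictly between d and α still leaves an integrable function of
x/t, and rescaling gives t^d. -/
theorem exists_lintegral_le_heavy (hDo : IsOpen D) (hDb : Bornology.IsBounded D)
    (hD0 : (0 : Space m) ∈ D) (hθ : ‖θ‖ = 1)
    (hg : AntitoneOn g (Ici 0)) (hg0 : ∀ s, 0 ≤ s → 0 < g s)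
    (hgv : IsRegVarying g α) (hα : (m : ℝ) + 1 < α) :
    ∃ K : ℝ, 0 < K ∧ ∀ᶠ t in atTop,
      ∫⁻ x in t • outerHalfspace D θ, ENNReal.ofReal (homDensity D g x) ≤
        ENNReal.ofReal (K * (t ^ (m + 1) * g t)) := by
  have hm0 : (0 : ℝ) ≤ m := Nat.cast_nonneg m
  obtain ⟨α', h1, h2⟩ := exists_between hα
  have hα' : 0 < α' := by linarith
  obtain ⟨T, hT0, hT⟩ := hgv.le_rpow_mul hg hg0 hα' h2
  obtain ⟨R, hR, hgauge⟩ := exists_norm_le_mul_gauge hDo hDb hD0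
  have hfin : ∫⁻ x : Space m, ENNReal.ofReal ((1 + ‖x‖) ^ (-α')) < ⊤ :=
    finite_integral_one_add_norm (by rw [finrank_euclideanSpace_fin]; push_cast; exact h1)
  obtain ⟨I, hI, hI0⟩ : ∃ I : ℝ, ∫⁻ x : Space m, ENNReal.ofReal ((1 + ‖x‖) ^ (-α')) =
      ENNReal.ofReal I ∧ 0 ≤ I :=
    ⟨_, (ENNReal.ofReal_toReal hfin.ne).symm, ENNReal.toReal_nonneg⟩
  refine ⟨2 ^ α' * (1 + R) ^ α' * (I + 1), by positivity, ?_⟩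
  filter_upwards [eventually_ge_atTop T] with t ht
  have ht0 : 0 < t := hT0.trans_le ht
  have hgt := (hg0 t ht0.le).le
  have hm1 : Measurable fun x : Space m => ENNReal.ofReal ((1 + ‖x‖) ^ (-α')) :=
    ((measurable_const.add measurable_norm).pow_const _).ennreal_ofReal
  calc _ ≤ ∫⁻ x in t • outerHalfspace D θ,
        ENNReal.ofReal (2 ^ α' * (1 + R) ^ α' * g t) *
          ENNReal.ofReal ((1 + ‖t⁻¹ • x‖) ^ (-α')) := by
        refine setLIntegral_mono' (measurableSet_smul_outerHalfspace D θ t) fun x hx => ?_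
        rw [← ENNReal.ofReal_mul (by positivity)]
        refine ENNReal.ofReal_le_ofReal ?_
        have hγ := le_gauge_of_mem hDo hDb hD0 hθ ht0 hx
        have hγ1 : 1 ≤ gauge D x / t := by rwa [one_le_div ht0]
        have h3 := hT t ht _ hγ1
        rw [mul_div_cancel₀ _ ht0.ne'] at h3
        have h4 : 1 + ‖t⁻¹ • x‖ ≤ (1 + R) * (gauge D x / t) := by
          rw [norm_smul, Real.norm_eq_abs, abs_of_pos (inv_pos.2 ht0)]
          have : t⁻¹ * ‖x‖ ≤ R * (gauge D x / t) := by
            calc t⁻¹ * ‖x‖ ≤ t⁻¹ * (R * gauge D x) := by gcongr; exact hgauge x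
              _ = _ := by ring
          linarith
        have h5 : ((1 + R) * (gauge D x / t)) ^ (-α') ≤ (1 + ‖t⁻¹ • x‖) ^ (-α') :=
          Real.rpow_le_rpow_of_nonpos (by positivity) h4 (by linarith)
        rw [Real.mul_rpow (by positivity) (by positivity)] at h5
        have h6 : (gauge D x / t) ^ (-α') ≤ (1 + R) ^ α' * (1 + ‖t⁻¹ • x‖) ^ (-α') := by
          rw [Real.rpow_neg (by positivity) α', inv_mul_le_iff₀ (by positivity)] at h5
          exact h5
        calc homDensity D g x ≤ 2 ^ α' * (gauge D x / t) ^ (-α') * g t := h3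
          _ ≤ 2 ^ α' * ((1 + R) ^ α' * (1 + ‖t⁻¹ • x‖) ^ (-α')) * g t := by gcongr
          _ = _ := by ring
    _ ≤ ∫⁻ x, ENNReal.ofReal (2 ^ α' * (1 + R) ^ α' * g t) *
          ENNReal.ofReal ((1 + ‖t⁻¹ • x‖) ^ (-α')) := setLIntegral_le_lintegral _ _
    _ = ENNReal.ofReal (2 ^ α' * (1 + R) ^ α' * I * (t ^ (m + 1) * g t)) := by
        rw [lintegral_const_mul' _ _ ENNReal.ofReal_ne_top,
          lintegral_comp_inv_smul volume hm1 ht0, finrank_euclideanSpace_fin, hI,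
          ← ENNReal.ofReal_mul (by positivity), ← ENNReal.ofReal_mul (by positivity)]
        congr 1
        ring
    _ ≤ _ := by
        refine ENNReal.ofReal_le_ofReal ?_
        gcongr
        linarith

/-- A large ball in the halfspace, on which the density is comparable to its maximum. -/
theorem exists_ball_le_homDensity (hDo : IsOpen D)
    (hD0 : (0 : Space m) ∈ D) (hθ : ‖θ‖ = 1)
    (hg : AntitoneOn g (Ici 0)) (hg0 : ∀ s, 0 ≤ s → 0 < g s) (hgv : IsRegVarying g α) :
    ∃ (v : Space m) (c : ℝ), 0 < c ∧ ∀ᶠ t in atTop,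
      Metric.closedBall (t • v) (2 * t) ⊆ t • outerHalfspace D θ ∧
      ∀ x ∈ Metric.closedBall (t • v) (2 * t), c * g t ≤ homDensity D g x := by
  obtain ⟨c, hc, hgauge⟩ := exists_mul_gauge_le_norm hDo hD0
  -- On the ball of radius 2t about tv the pairing with θ is at least t(ζ+2) - 2t = tζ. The
  -- concentric ball of radius t then has room for neighbourhoods of radius up to t.
  set v := (supportFn D θ + 2) • θ with hv
  set C := (‖v‖ + 2) / c with hC
  have hC0 : 0 < C := by positivity
  have hlim : C ^ (-α) / 2 < C ^ (-α) := half_lt_self (by positivity)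
  refine ⟨v, C ^ (-α) / 2, by positivity, ?_⟩
  filter_upwards [(hgv C hC0).eventually (lt_mem_nhds hlim), eventually_gt_atTop 0] with t ht ht0
  have hgt := hg0 t ht0.le
  rw [lt_div_iff₀ hgt] at ht
  refine ⟨fun x hx => ?_, fun x hx => ht.le.trans ?_⟩
  · rw [mem_smul_outerHalfspace_iff ht0]
    have h1 : inner ℝ θ (t • v) = t * (supportFn D θ + 2) := by
      rw [hv, inner_smul_right, inner_smul_right, real_inner_self_eq_norm_sq, hθ]; ring
    have h2 : |inner ℝ θ (x - t • v)| ≤ 2 * t := by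
      refine (abs_real_inner_le_norm _ _).trans ?_
      rw [hθ, one_mul, ← dist_eq_norm]; exact hx
    rw [inner_sub_right, h1] at h2
    linarith [(abs_le.1 h2).1]
  · refine hg (mem_Ici.2 (gauge_nonneg _)) (mem_Ici.2 (by positivity)) ?_
    have h1 : ‖x‖ ≤ t * (‖v‖ + 2) := by
      have h2 : ‖x - t • v‖ ≤ 2 * t := by rw [← dist_eq_norm]; exact hx
      have h3 : ‖t • v‖ = t * ‖v‖ := by rw [norm_smul, Real.norm_eq_abs, abs_of_pos ht0]
      linarith [norm_le_norm_add_norm_sub' x (t • v)]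
    have h4 := (hgauge x).trans h1
    rw [hC, mul_div_assoc', le_div_iff₀ hc]
    linarith

theorem volume_closedBall_space (x : Space m) {s : ℝ} (hs : 0 ≤ s) :
    volume (Metric.closedBall x s) =
      ENNReal.ofReal (s ^ (m + 1)) * volume (Metric.closedBall (0 : Space m) 1) := by
  rw [Measure.addHaar_closedBall' _ _ hs, finrank_euclideanSpace_fin]

end Heavy

/-! ### The conditional intensity measure -/

section Intensity

variable {m : ℕ} {D : Set (Space m)} {θ : Space m} {g : ℝ → ℝ}

theorem integrable_homDensity (hf : ∫ x, homDensity D g x = 1) : Integrable (homDensity D g) :=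
  Integrable.of_integral_ne_zero (by rw [hf]; exact one_ne_zero)

theorem isFiniteMeasure_condIntensity (hf : ∫ x, homDensity D g x = 1) (t : ℝ) (n : ℕ) :
    IsFiniteMeasure (condIntensity D g θ t n) := by
  refine isFiniteMeasure_withDensity_ofReal (Integrable.hasFiniteIntegral ?_)
  exact (((integrable_homDensity hf).indicator
    (measurableSet_smul_outerHalfspace D θ t)).div_const _).const_mul _

instance nullSingletonClass_condIntensity (t : ℝ) (n : ℕ) :
    NullSingletonClass (condIntensity D g θ t n) := by
  unfold condIntensity; infer_instance

theorem homDensity_pos (hg0 : ∀ s, 0 ≤ s → 0 < g s) (x : Space m) : 0 < homDensity D g x :=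
  hg0 _ (gauge_nonneg _)

theorem ofReal_integral_homDensity (hg0 : ∀ s, 0 ≤ s → 0 < g s)
    (hf : ∫ x, homDensity D g x = 1) (S : Set (Space m)) :
    ENNReal.ofReal (∫ x in S, homDensity D g x) =
      ∫⁻ x in S, ENNReal.ofReal (homDensity D g x) :=
  ofReal_integral_eq_lintegral_ofReal (integrable_homDensity hf).integrableOn
    (Eventually.of_forall fun x => (homDensity_pos hg0 x).le)

theorem condIntensity_apply (hg0 : ∀ s, 0 ≤ s → 0 < g s) (t : ℝ) (n : ℕ) {B : Set (Space m)} (hB : MeasurableSet B) :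
    condIntensity D g θ t n B =
      ENNReal.ofReal (n / ∫ x in t • outerHalfspace D θ, homDensity D g x) *
        ∫⁻ x in B ∩ t • outerHalfspace D θ, ENNReal.ofReal (homDensity D g x) := by
  have hH := measurableSet_smul_outerHalfspace D θ t
  rw [condIntensity, withDensity_apply _ hB, ← lintegral_const_mul' _ _ ENNReal.ofReal_ne_top,
    inter_comm, ← setLIntegral_indicator hH]
  congr 1 with x
  by_cases hx : x ∈ t • outerHalfspace D θ
  · rw [indicator_of_mem hx, condDensity, indicator_of_mem hx,
      ← ENNReal.ofReal_mul' (homDensity_pos hg0 x).le]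
    congr 1; ring
  · rw [indicator_of_notMem hx, condDensity, indicator_of_notMem hx]; simp

/-- Equality holds unless the normalising integral is 0, when division by zero makes the density 0.
-/
theorem condIntensity_univ_le (hg0 : ∀ s, 0 ≤ s → 0 < g s) (hf : ∫ x, homDensity D g x = 1)
    (t : ℝ) (n : ℕ) : condIntensity D g θ t n univ ≤ ENNReal.ofReal n := by
  have h0 : 0 ≤ ∫ x in t • outerHalfspace D θ, homDensity D g x :=
    integral_nonneg fun x => (homDensity_pos hg0 x).le
  rw [condIntensity_apply hg0 t n MeasurableSet.univ, univ_inter,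
    ← ofReal_integral_homDensity hg0 hf, ← ENNReal.ofReal_mul (by positivity)]
  refine ENNReal.ofReal_le_ofReal ?_
  rcases h0.eq_or_lt with h | h
  · rw [← h]; simp
  · rw [div_mul_cancel₀ _ h.ne']

/-- The density is at most g(t) on the halfspace and the normalisation at least q g(t), so g(t)
cancels. -/
theorem condIntensity_le_mul_volume (hDo : IsOpen D) (hDb : Bornology.IsBounded D)
    (hD0 : (0 : Space m) ∈ D) (hθ : ‖θ‖ = 1) (hg0 : ∀ s, 0 ≤ s → 0 < g s)
    (hg : AntitoneOn g (Ici 0)) (hf : ∫ x, homDensity D g x = 1) {t q : ℝ} (ht : 0 < t)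
    (hq : 0 < q) (n : ℕ) (hZ : ENNReal.ofReal (q * g t) ≤
      ∫⁻ x in t • outerHalfspace D θ, ENNReal.ofReal (homDensity D g x))
    {B : Set (Space m)} (hB : MeasurableSet B) :
    condIntensity D g θ t n B ≤ ENNReal.ofReal (n / q) * volume B := by
  have hH := measurableSet_smul_outerHalfspace D θ t
  have hgt := hg0 t ht.le
  rw [← ofReal_integral_homDensity hg0 hf, ENNReal.ofReal_le_ofReal_iff
    (integral_nonneg fun x => (homDensity_pos hg0 x).le)] at hZ
  rw [condIntensity_apply hg0 t n hB]
  calc _ ≤ ENNReal.ofReal (n / (q * g t)) *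
        ∫⁻ x in B ∩ t • outerHalfspace D θ, ENNReal.ofReal (g t) := by
        gcongr ENNReal.ofReal ?_ * ?_
        · gcongr
        refine setLIntegral_mono' (hB.inter hH) fun x hx => ENNReal.ofReal_le_ofReal ?_
        exact hg (mem_Ici.2 ht.le) (mem_Ici.2 (gauge_nonneg _))
          (le_gauge_of_mem hDo hDb hD0 hθ ht hx.2)
    _ = ENNReal.ofReal (n / q) * volume (B ∩ t • outerHalfspace D θ) := by
        rw [setLIntegral_const, ← mul_assoc, ← ENNReal.ofReal_mul (by positivity)]
        congr 2; field_simp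
    _ ≤ _ := by gcongr; exact inter_subset_left

theorem smul_restrict_le_condIntensity (hg0 : ∀ s, 0 ≤ s → 0 < g s)
    (hf : ∫ x, homDensity D g x = 1) {t q c : ℝ} (ht : 0 < t) (n : ℕ)
    (hZ0 : 0 < ∫⁻ x in t • outerHalfspace D θ, ENNReal.ofReal (homDensity D g x))
    (hZ : ∫⁻ x in t • outerHalfspace D θ, ENNReal.ofReal (homDensity D g x) ≤
      ENNReal.ofReal (q * g t)) {S : Set (Space m)} (hS : MeasurableSet S)
    (hSH : S ⊆ t • outerHalfspace D θ) (hSf : ∀ x ∈ S, c * g t ≤ homDensity D g x) :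
    ENNReal.ofReal (n * (c / q)) • volume.restrict S ≤ condIntensity D g θ t n := by
  have hgt := hg0 t ht.le
  refine Measure.le_iff.2 fun B hB => ?_
  rw [← ofReal_integral_homDensity hg0 hf] at hZ hZ0
  rw [ENNReal.ofReal_pos] at hZ0
  have hq : 0 < q := by
    by_contra hq
    rw [ENNReal.ofReal_of_nonpos (mul_nonpos_of_nonpos_of_nonneg (not_lt.1 hq) hgt.le)] at hZ
    exact (ENNReal.ofReal_pos.2 hZ0).not_ge hZ
  rw [ENNReal.ofReal_le_ofReal_iff (by positivity)] at hZ
  rw [condIntensity_apply hg0 t n hB, Measure.smul_apply, Measure.restrict_apply hB, smul_eq_mul]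
  calc ENNReal.ofReal (n * (c / q)) * volume (B ∩ S) =
        ENNReal.ofReal (n / (q * g t)) * ∫⁻ x in B ∩ S, ENNReal.ofReal (c * g t) := by
        rw [setLIntegral_const, ← mul_assoc, ← ENNReal.ofReal_mul (by positivity)]
        congr 2; field_simp
    _ ≤ ENNReal.ofReal (n / ∫ x in t • outerHalfspace D θ, homDensity D g x) *
          ∫⁻ x in B ∩ S, ENNReal.ofReal (homDensity D g x) := by
        gcongr ENNReal.ofReal (_ / ?_) * ?_
        exact setLIntegral_mono' (hB.inter hS) fun x hx => ENNReal.ofReal_le_ofReal (hSf x hx.2)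
    _ ≤ _ := by
        gcongr

end Intensity

/-! ### Product measures -/

/-- Comparison on rectangles suffices, since the outer product measure is the largest outer measure
with the prescribed bound on rectangles. -/
theorem smul_pi_le_pi {E : Type*} [MeasurableSpace E] {j : ℕ} {μ Λ : Fin j → Measure E}
    [∀ i, SigmaFinite (μ i)] {β : ℝ≥0∞} (h : ∀ i, β • μ i ≤ Λ i) :
    β ^ j • Measure.pi μ ≤ Measure.pi Λ := by
  refine Measure.le_iff.2 fun S hS => ?_
  have : (β ^ j • Measure.pi μ).toOuterMeasure ≤
      OuterMeasure.pi fun i => (Λ i).toOuterMeasure := by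
    rw [OuterMeasure.le_pi]
    intro s _
    change β ^ j * Measure.pi μ (univ.pi s) ≤ ∏ i, Λ i (s i)
    rw [Measure.pi_pi]
    calc β ^ j * ∏ i, μ i (s i) = ∏ i, (β • μ i) (s i) := by
          simp [Finset.prod_mul_distrib]
      _ ≤ _ := Finset.prod_le_prod' fun i _ => h i (s i)
  refine (this S).trans (le_of_eq ?_)
  rw [Measure.pi, toMeasure_apply _ _ hS]

/-! ### Kernels -/

section Kernel

variable {m k : ℕ} {h : ℝ → (Fin (k + 1) → Space m) → ℝ}

theorem IsUKernel.eq_one (hh : IsUKernel k h) {s : ℝ} (hs : 0 < s) (x : Fin (k + 1) → Space m) :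
    h s x = h 1 (s⁻¹ • x) := by
  have := hh.scaling 1 zero_le_one s⁻¹ (inv_pos.2 hs) x
  rw [one_div, inv_inv] at this
  exact this.symm

theorem IsUKernel.exists_dist_le (hh : IsUKernel k h) :
    ∃ κ : ℝ, 0 < κ ∧ ∀ s, 0 < s → ∀ x, h s x ≠ 0 → ∀ i i', dist (x i) (x i') ≤ κ * s := by
  obtain ⟨κ, hκ⟩ := hh.locally_determined
  refine ⟨max κ 1, by positivity, fun s hs x hx i i' => ?_⟩
  rw [hh.eq_one hs] at hx
  have h1 := hκ _ (lt_of_le_of_ne (hh.nonneg 1 zero_le_one _) hx.symm)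
  -- The range is finite, hence bounded, so its diameter really bounds distances; `Metric.diam` of
  -- an unbounded set would be 0.
  have h2 := (Metric.dist_le_diam_of_mem (finite_range (s⁻¹ • x)).isBounded
    (mem_range_self i) (mem_range_self i')).trans (h1.trans (le_max_left κ 1))
  rw [Pi.smul_apply, Pi.smul_apply, dist_smul₀, Real.norm_eq_abs, abs_of_pos (inv_pos.2 hs),
    inv_mul_le_iff₀ hs] at h2
  linarith

/-- The total mass of the kernel `h_1` seen from one of its points. -/
noncomputable def kernelMass (k : ℕ) (h : ℝ → (Fin (k + 1) → Space m) → ℝ) : ℝ≥0∞ :=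
  ∫⁻ y : Fin k → Space m, ENNReal.ofReal (h 1 (Fin.cons 0 y))

theorem IsUKernel.measurable_cons (hh : IsUKernel k h) :
    Measurable fun y : Fin k → Space m => ENNReal.ofReal (h 1 (Fin.cons 0 y)) := by
  refine ((hh.measurable 1 zero_le_one).comp (measurable_pi_lambda _ fun i => ?_)).ennreal_ofReal
  refine Fin.cases ?_ (fun i => ?_) i
  · simp
  · simpa using measurable_pi_apply i

/-- Translation moves the first point to 0, and dilation reduces h_s to h_1 with Jacobian s^(kd). -/
theorem IsUKernel.lintegral_cons (hh : IsUKernel k h) {s : ℝ} (hs : 0 < s) (x : Space m) :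
    ∫⁻ y : Fin k → Space m, ENNReal.ofReal (h s (Fin.cons x y)) =
      ENNReal.ofReal (s ^ (k * (m + 1))) * kernelMass k h := by
  have hI : (volume : Measure (Fin k → Space m)).IsAddHaarMeasure := by
    rw [volume_pi]; infer_instance
  have h1 : ∀ y : Fin k → Space m, h s (Fin.cons x fun i => x + y i) = h s (Fin.cons 0 y) := by
    intro y
    rw [← hh.translation_invariant s hs.le x (Fin.cons 0 y)]
    congr 1 with i
    refine Fin.cases ?_ (fun i => ?_) i
    · simp
    · simp [add_comm]
  rw [← lintegral_add_left_eq_self (μ := (volume : Measure (Fin k → Space m))) _ (fun _ => x)]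
  have h2 : ∀ y : Fin k → Space m, h s (Fin.cons x ((fun _ => x) + y)) =
      h 1 (Fin.cons 0 (s⁻¹ • y)) := by
    intro y
    rw [show ((fun _ => x) + y : Fin k → Space m) = fun i => x + y i from rfl, h1, hh.eq_one hs]
    congr 1
    ext i : 1
    refine Fin.cases ?_ (fun i => ?_) i
    · simp
    · simp
  simp only [h2]
  rw [lintegral_comp_inv_smul (f := fun y : Fin k → Space m => ENNReal.ofReal (h 1 (Fin.cons 0 y)))
    volume hh.measurable_cons hs,
    Module.finrank_pi_fintype]
  simp [kernelMass]

/-- Place the first point in S. Where the kernel is nonzero the others lie within ρ, hence in S', so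
restricting them to S' loses nothing of the integral over the whole space. -/
theorem IsUKernel.le_lintegral_pi (hh : IsUKernel k h) {s ρ : ℝ} (hs : 0 < s) (hρ0 : 0 ≤ ρ)
    (hρ : ∀ x, h s x ≠ 0 → ∀ i i', dist (x i) (x i') ≤ ρ) {Λ : Measure (Space m)}
    {β : ℝ≥0∞} {S S' : Set (Space m)} (hS : MeasurableSet S) (hS' : MeasurableSet S')
    (hSS : ∀ x ∈ S, Metric.closedBall x ρ ⊆ S') (hΛ : β • volume.restrict S' ≤ Λ) :
    β ^ (k + 1) * (volume S * (ENNReal.ofReal (s ^ (k * (m + 1))) * kernelMass k h)) ≤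
      ∫⁻ x, ENNReal.ofReal (h s x) ∂Measure.pi fun _ : Fin (k + 1) => Λ := by
  have hmp := measurePreserving_piFinSuccAbove
    (fun _ : Fin (k + 1) => (volume.restrict S' : Measure (Space m))) 0
  have hF : Measurable fun x => ENNReal.ofReal (h s x) := (hh.measurable s hs.le).ennreal_ofReal
  have hpi : MeasurableSet (univ.pi fun _ : Fin k => S') := MeasurableSet.univ_pi fun _ => hS'
  calc _ ≤ β ^ (k + 1) * ∫⁻ x, ENNReal.ofReal (h s x)
          ∂Measure.pi fun _ : Fin (k + 1) => volume.restrict S' := by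
        gcongr
        rw [← hmp.symm.lintegral_comp hF, lintegral_prod (fun z => ENNReal.ofReal (h s
          ((MeasurableEquiv.piFinSuccAbove (fun _ => Space m) 0).symm z)))
          (hF.comp (MeasurableEquiv.measurable _)).aemeasurable]
        calc volume S * (ENNReal.ofReal (s ^ (k * (m + 1))) * kernelMass k h) =
              ∫⁻ x in S', S.indicator (fun _ =>
                ENNReal.ofReal (s ^ (k * (m + 1))) * kernelMass k h) x := by
              rw [lintegral_indicator_const hS, Measure.restrict_apply hS,
                inter_eq_left.2 fun x hx => hSS x hx (Metric.mem_closedBall_self hρ0), mul_comm]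
          _ ≤ _ := by
              refine lintegral_mono fun x => ?_
              by_cases hx : x ∈ S
              · rw [indicator_of_mem hx, ← hh.lintegral_cons hs x, ← Measure.restrict_pi_pi,
                  ← lintegral_indicator hpi]
                refine lintegral_mono fun y => ?_
                have hins : (MeasurableEquiv.piFinSuccAbove (fun _ : Fin (k + 1) => Space m) 0).symm
                    (x, y) = Fin.cons x y := Fin.insertNth_zero' x y
                by_cases hy : y ∈ univ.pi fun _ : Fin k => S'
                · rw [indicator_of_mem hy, hins]
                · have h0 : h s (Fin.cons x y) = 0 := by
                    by_contra hne
                    refine hy fun i _ => hSS x hx ?_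
                    exact hρ _ hne i.succ 0
                  rw [h0, ENNReal.ofReal_zero]; exact zero_le
              · rw [indicator_of_notMem hx]; exact zero_le
    _ = ∫⁻ x, ENNReal.ofReal (h s x)
          ∂(β ^ (k + 1) • Measure.pi fun _ : Fin (k + 1) => volume.restrict S') := by
        rw [lintegral_smul_measure, smul_eq_mul]
    _ ≤ _ := lintegral_mono' (smul_pi_le_pi fun _ => hΛ) le_rfl

end Kernel

/-! ### Variance asymptotics -/

section Asymptotic

variable {m k : ℕ} {Ω : Type*} [MeasurableSpace Ω] {P : Measure Ω} [IsProbabilityMeasure P]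
  {D : Set (Space m)} {θ : Space m} {g : ℝ → ℝ} {h : ℝ → (Fin (k + 1) → Space m) → ℝ}
  {r t Q : ℕ → ℝ} {N : ℕ → Ω → Set (Space m)}

theorem memLp_uStat (hh : IsUKernel k h) (hf : ∫ x, homDensity D g x = 1)
    (hN : ∀ n, IsPoissonProcess P (condIntensity D g θ (t n) n) (N n)) (hr : ∀ n, 0 < r n) (n : ℕ) :
    MemLp (fun ω => uStat k h (N n ω) (r n)) 2 P := by
  have := isFiniteMeasure_condIntensity (θ := θ) hf (t n) n
  obtain ⟨κ, -, hκ⟩ := hh.exists_dist_le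
  obtain ⟨M, hM⟩ := hh.bounded
  exact (variance_uStat (L := (condIntensity D g θ (t n) n).real univ) (hN n)
    (hh.measurable _ (hr n).le) (hh.nonneg _ (hr n).le)
    (hM _ (hr n).le) ENNReal.toReal_nonneg (hκ _ (hr n)) (fun x => by
      rw [ofReal_measureReal]
      exact measure_mono (subset_univ _))).1

/-- Q ≤ Cn makes the ball bound L = Cn/Q at least 1, so that 1 + L^(2k) ≤ 2 L^(2k). -/
theorem isBigO_variance_uStat (hh : IsUKernel k h) (hg0 : ∀ s, 0 ≤ s → 0 < g s)
    (hf : ∫ x, homDensity D g x = 1)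
    (hN : ∀ n, IsPoissonProcess P (condIntensity D g θ (t n) n) (N n)) (hr : ∀ n, 0 < r n)
    {κ C : ℝ} (hκ : ∀ s, 0 < s → ∀ x, h s x ≠ 0 → ∀ i i', dist (x i) (x i') ≤ κ * s)
    (hQ : ∀ᶠ n : ℕ in atTop, 0 < Q n ∧ Q n ≤ C * n)
    (hΛ : ∀ᶠ n : ℕ in atTop, ∀ x, condIntensity D g θ (t n) n (Metric.closedBall x (κ * r n)) ≤
      ENNReal.ofReal (C * n / Q n)) :
    (fun n => variance (fun ω => uStat k h (N n ω) (r n)) P)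
      =O[atTop] fun n : ℕ => (n : ℝ) ^ (2 * k + 1) / Q n ^ (2 * k) := by
  obtain ⟨M, hM⟩ := hh.bounded
  set K : ℝ := (((k + 1) ^ 2 * ((4 * k) ^ (2 * k) + 2 ^ (2 * k)) : ℕ) : ℝ) * M ^ 2 with hK
  refine IsBigO.of_bound (K * (2 * C ^ (2 * k))) ?_
  filter_upwards [hQ, hΛ] with n hQn hΛn
  have := isFiniteMeasure_condIntensity (θ := θ) hf (t n) n
  have hL1 : 1 ≤ C * n / Q n := (one_le_div hQn.1).2 hQn.2
  obtain ⟨-, h2, -⟩ := variance_uStat (hN n) (hh.measurable _ (hr n).le)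
    (hh.nonneg _ (hr n).le) (hM _ (hr n).le) (zero_le_one.trans hL1) (hκ _ (hr n)) hΛn
  have hu : (condIntensity D g θ (t n) n).real univ ≤ n :=
    ENNReal.toReal_le_of_le_ofReal (Nat.cast_nonneg n) (condIntensity_univ_le hg0 hf _ _)
  have hp : 1 ≤ (C * n / Q n) ^ (2 * k) := one_le_pow₀ hL1
  have hK0 : 0 ≤ K := by positivity
  have hQ0 := hQn.1
  rw [Real.norm_of_nonneg (variance_nonneg _ _), Real.norm_of_nonneg (by positivity)]
  calc _ ≤ K * ((condIntensity D g θ (t n) n).real univ * (1 + (C * n / Q n) ^ (2 * k))) := h2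
    _ ≤ K * (n * (2 * (C * n / Q n) ^ (2 * k))) := by
        gcongr
        linarith
    _ = _ := by
        rw [div_pow, mul_pow]; ring

theorem isBigO_variance_uStat_rev (hh : IsUKernel k h) (hg0 : ∀ s, 0 ≤ s → 0 < g s)
    (hf : ∫ x, homDensity D g x = 1)
    (hN : ∀ n, IsPoissonProcess P (condIntensity D g θ (t n) n) (N n)) (hr : ∀ n, 0 < r n)
    {c : ℝ} (hc : 0 < c) (hQ : ∀ᶠ n : ℕ in atTop, 0 < Q n)
    (hI : ∀ᶠ n : ℕ in atTop, ENNReal.ofReal (c * (n ^ (k + 1) / Q n ^ k)) ≤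
      ∫⁻ x, ENNReal.ofReal (h (r n) x)
        ∂Measure.pi fun _ : Fin (k + 1) => condIntensity D g θ (t n) n) :
    (fun n : ℕ => (n : ℝ) ^ (2 * k + 1) / Q n ^ (2 * k))
      =O[atTop] fun n => variance (fun ω => uStat k h (N n ω) (r n)) P := by
  obtain ⟨M, hM⟩ := hh.bounded
  obtain ⟨κ, -, hκ⟩ := hh.exists_dist_le
  refine IsBigO.of_bound ((k.factorial : ℝ) ^ 2 / c ^ 2) ?_
  filter_upwards [hQ, hI, eventually_gt_atTop 0] with n hQn hIn hn
  have hn0 : (0 : ℝ) < n := by exact_mod_cast hn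
  have := isFiniteMeasure_condIntensity (θ := θ) hf (t n) n
  -- The lower bound does not involve L, so the crude choice of the total mass is enough.
  obtain ⟨-, -, h3⟩ := variance_uStat (L := (condIntensity D g θ (t n) n).real univ) (hN n)
    (hh.measurable _ (hr n).le) (hh.nonneg _ (hr n).le) (hM _ (hr n).le) ENNReal.toReal_nonneg
    (hκ _ (hr n)) (fun x => by
      rw [ofReal_measureReal]
      exact measure_mono (subset_univ _))
  have hu : (condIntensity D g θ (t n) n).real univ ≤ n :=
    ENNReal.toReal_le_of_le_ofReal (Nat.cast_nonneg n) (condIntensity_univ_le hg0 hf _ _)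
  have hfin : ∫⁻ x, ENNReal.ofReal (h (r n) x)
      ∂Measure.pi (fun _ : Fin (k + 1) => condIntensity D g θ (t n) n) ≠ ⊤ := by
    refine ((lintegral_mono fun x => ENNReal.ofReal_le_ofReal (hM _ (hr n).le x)).trans_lt ?_).ne
    rw [lintegral_const]
    exact ENNReal.mul_lt_top ENNReal.ofReal_lt_top (measure_lt_top _ _)
  have hJ := (ENNReal.ofReal_le_iff_le_toReal hfin).1 hIn
  have hV := variance_nonneg (fun ω => uStat k h (N n ω) (r n)) P
  rw [Real.norm_of_nonneg hV, Real.norm_of_nonneg (by positivity)]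
  have h4 : (c * (n ^ (k + 1) / Q n ^ k)) ^ 2 ≤
      (k.factorial : ℝ) ^ 2 * n * Var[fun ω => uStat k h (N n ω) (r n); P] :=
    ((pow_le_pow_left₀ (by positivity) hJ 2).trans h3).trans (by gcongr)
  have h5 : (c * (n ^ (k + 1) / Q n ^ k)) ^ 2 =
      n * (c ^ 2 * (n ^ (2 * k + 1) / Q n ^ (2 * k))) := by
    rw [mul_pow, div_pow]; ring
  rw [h5, mul_assoc, mul_left_comm _ (n : ℝ)] at h4
  have h6 := le_of_mul_le_mul_left h4 hn0
  rw [div_mul_eq_mul_div, le_div_iff₀ (by positivity)]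
  linarith

variable {rlim : ℝ}

/-- The upper bound in terms of the mass of the halfspaces. -/
theorem isBigO_variance_of_le_mass (hDo : IsOpen D) (hDb : Bornology.IsBounded D)
    (hD0 : (0 : Space m) ∈ D) (hθ : ‖θ‖ = 1) (hh : IsUKernel k h)
    (hg0 : ∀ s, 0 ≤ s → 0 < g s) (hg : AntitoneOn g (Ici 0)) (hf : ∫ x, homDensity D g x = 1)
    (hN : ∀ n, IsPoissonProcess P (condIntensity D g θ (t n) n) (N n)) (hr : ∀ n, 0 < r n)
    (hrlim : Tendsto r atTop (𝓝 rlim)) (ht : Tendsto t atTop atTop)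
    (hQ : ∀ᶠ n : ℕ in atTop, 0 < Q n ∧ Q n ≤ n) {c : ℝ} (hc : 0 < c)
    (hZ : ∀ᶠ n in atTop, ENNReal.ofReal (c * (Q n * g (t n))) ≤
      ∫⁻ x in t n • outerHalfspace D θ, ENNReal.ofReal (homDensity D g x)) :
    (fun n => variance (fun ω => uStat k h (N n ω) (r n)) P)
      =O[atTop] fun n : ℕ => (n : ℝ) ^ (2 * k + 1) / Q n ^ (2 * k) := by
  obtain ⟨κ, hκ0, hκ⟩ := hh.exists_dist_le
  obtain ⟨B, hB, hB0⟩ : ∃ B : ℝ, volume (Metric.closedBall (0 : Space m) 1) = ENNReal.ofReal B ∧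
      0 ≤ B :=
    ⟨_, (ENNReal.ofReal_toReal measure_closedBall_lt_top.ne).symm, ENNReal.toReal_nonneg⟩
  set V := (κ * (rlim + 1)) ^ (m + 1) * B with hV
  have hr0 : 0 ≤ rlim := ge_of_tendsto' hrlim fun n => (hr n).le
  -- V bounds the volume of the balls of radius κ r_n once r_n < r + 1; the summand 1 in the
  -- constant serves Q ≤ Cn.
  refine isBigO_variance_uStat hh hg0 hf hN hr (C := V / c + 1) hκ ?_ ?_
  · filter_upwards [hQ] with n hn
    refine ⟨hn.1, hn.2.trans (le_mul_of_one_le_left (Nat.cast_nonneg n) ?_)⟩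
    have : 0 ≤ V / c := by positivity
    linarith
  · filter_upwards [hQ, hZ, ht.eventually_gt_atTop 0,
      hrlim.eventually (gt_mem_nhds (lt_add_one rlim))] with n hQn hZn htn hrn x
    have hQ0 := hQn.1
    have hrn0 := hr n
    rw [← mul_assoc] at hZn
    refine (condIntensity_le_mul_volume hDo hDb hD0 hθ hg0 hg hf htn
      (show 0 < c * Q n by positivity) n hZn Metric.isClosed_closedBall.measurableSet).trans ?_
    rw [volume_closedBall_space x (by positivity), hB, ← ENNReal.ofReal_mul (by positivity),
      ← ENNReal.ofReal_mul (by positivity)]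
    refine ENNReal.ofReal_le_ofReal ?_
    calc n / (c * Q n) * ((κ * r n) ^ (m + 1) * B) ≤ n / (c * Q n) * V := by
          rw [hV]; gcongr
      _ = V / c * n / Q n := by field_simp
      _ ≤ _ := by gcongr; linarith

/-- The lower bound in terms of a region of high density. -/
theorem isBigO_variance_rev_of_region (hh : IsUKernel k h)
    (hg0 : ∀ s, 0 ≤ s → 0 < g s) (hf : ∫ x, homDensity D g x = 1)
    (hN : ∀ n, IsPoissonProcess P (condIntensity D g θ (t n) n) (N n)) (hr : ∀ n, 0 < r n)
    (hrlim0 : 0 < rlim) (hrlim : Tendsto r atTop (𝓝 rlim)) (ht : Tendsto t atTop atTop)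
    (hQ : ∀ᶠ n : ℕ in atTop, 0 < Q n) (hmass : kernelMass k h ≠ 0)
    {c₀ K : ℝ} (hc₀ : 0 < c₀) (hK : 0 < K)
    (hZ0 : ∀ᶠ n in atTop, ENNReal.ofReal (c₀ * (Q n * g (t n))) ≤
      ∫⁻ x in t n • outerHalfspace D θ, ENNReal.ofReal (homDensity D g x))
    (hZ : ∀ᶠ n in atTop, ∫⁻ x in t n • outerHalfspace D θ, ENNReal.ofReal (homDensity D g x) ≤
      ENNReal.ofReal (K * (Q n * g (t n))))
    (hreg : ∀ ρ : ℝ, 0 < ρ → ∃ c c₁ : ℝ, 0 < c ∧ 0 < c₁ ∧ ∀ᶠ n in atTop,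
      ∃ S S' : Set (Space m), MeasurableSet S ∧
      MeasurableSet S' ∧ (∀ x ∈ S, Metric.closedBall x ρ ⊆ S') ∧
      S' ⊆ t n • outerHalfspace D θ ∧ (∀ x ∈ S', c * g (t n) ≤ homDensity D g x) ∧
      ENNReal.ofReal (c₁ * Q n) ≤ volume S) :
    (fun n : ℕ => (n : ℝ) ^ (2 * k + 1) / Q n ^ (2 * k))
      =O[atTop] fun n => variance (fun ω => uStat k h (N n ω) (r n)) P := by
  obtain ⟨κ, hκ0, hκ⟩ := hh.exists_dist_le
  obtain ⟨η, hη0, hη⟩ : ∃ η : ℝ, 0 < η ∧ ENNReal.ofReal η ≤ kernelMass k h := by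
    obtain ⟨q, hq0, hq⟩ := ENNReal.lt_iff_exists_nnreal_btwn.1 (pos_iff_ne_zero.2 hmass)
    exact ⟨q, by exact_mod_cast hq0, by rw [ENNReal.ofReal_coe_nnreal]; exact hq.le⟩
  -- An eventual upper bound for the range κ r_n of the kernels, so one region works for all large
  -- n.
  have hr1 : 0 < κ * (rlim + 1) := by positivity
  obtain ⟨c, c₁, hc, hc₁, hreg⟩ := hreg _ hr1
  refine isBigO_variance_uStat_rev hh hg0 hf hN hr
    (c := (c / K) ^ (k + 1) * (c₁ * ((rlim / 2) ^ (k * (m + 1)) * η))) (by positivity) hQ ?_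
  filter_upwards [hQ, hZ0, hZ, hreg, ht.eventually_gt_atTop 0,
    hrlim.eventually (gt_mem_nhds (lt_add_one rlim)),
    hrlim.eventually (lt_mem_nhds (half_lt_self hrlim0))]
    with n hQn hZ0n hZn ⟨S, S', hS, hS', hSS, hSH, hSf, hvol⟩ htn hrn hrn'
  have hrn0 := hr n
  have hgt := hg0 _ htn.le
  have hZpos := lt_of_lt_of_le (ENNReal.ofReal_pos.2 (show 0 < c₀ * (Q n * g (t n)) by positivity)) hZ0n
  rw [← mul_assoc] at hZn
  have hΛ := smul_restrict_le_condIntensity hg0 hf htn n hZpos hZn hS' hSH hSf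
  refine le_trans ?_ (hh.le_lintegral_pi hrn0 hr1.le
    (fun x hx i i' => (hκ _ hrn0 x hx i i').trans (by gcongr)) hS hS' hSS hΛ)
  calc _ = ENNReal.ofReal (n * (c / (K * Q n))) ^ (k + 1) * (ENNReal.ofReal (c₁ * Q n) *
        (ENNReal.ofReal ((rlim / 2) ^ (k * (m + 1))) * ENNReal.ofReal η)) := by
        rw [← ENNReal.ofReal_pow (by positivity), ← ENNReal.ofReal_mul (by positivity),
          ← ENNReal.ofReal_mul (by positivity), ← ENNReal.ofReal_mul (by positivity)]
        congr 1
        rw [show n * (c / (K * Q n)) = c / K * (n / Q n) by field_simp, mul_pow, div_pow (n : ℝ)]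
        generalize c / K = z
        field_simp
        ring
    _ ≤ _ := by gcongr

end Asymptotic

/-! ### Positivity of the limit integrals -/

section Positivity

variable {m k : ℕ} {h : ℝ → (Fin (k + 1) → Space m) → ℝ}

theorem IsUKernel.ae_eq_zero_of_kernelMass (hh : IsUKernel k h) (hmass : kernelMass k h = 0) :
    ∀ᵐ y : Fin k → Space m, h 1 (Fin.cons 0 y) = 0 := by
  rw [kernelMass, lintegral_eq_zero_iff hh.measurable_cons] at hmass
  filter_upwards [hmass] with y hy
  exact le_antisymm (ENNReal.ofReal_eq_zero.1 hy) (hh.nonneg 1 zero_le_one _)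

/-- If h_1(0, ·) vanished almost everywhere, so would the integrand. -/
theorem IsUKernel.kernelMass_ne_zero_of_heavy (hh : IsUKernel k h) {D : Set (Space m)} {θ : Space m}
    {α : ℝ} (hpos : 0 < limitIntegralHeavy k h D θ α) : kernelMass k h ≠ 0 := by
  intro hmass
  refine hpos.ne' ?_
  rw [limitIntegralHeavy]
  have h0 : ∀ x : Space m, ∫⁻ y : Fin k → Space m, ∫⁻ y' : Fin k → Space m,
      ENNReal.ofReal (h 1 (Fin.cons 0 y) * h 1 (Fin.cons 0 y') *
        gauge D x ^ (-(α * (2 * k + 1)))) = 0 := fun x => by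
    rw [lintegral_congr_ae (g := fun _ => 0) ?_, lintegral_zero]
    filter_upwards [hh.ae_eq_zero_of_kernelMass hmass] with y hy
    simp [hy]
  simp only [h0, lintegral_zero]

theorem IsUKernel.kernelMass_ne_zero_of_exp (hh : IsUKernel k h) {D : Set (Space m)}
    {A : Space m ≃L[ℝ] Space m} {r ξinv : ℝ} (hpos : 0 < limitIntegralExp k h D A r ξinv) :
    kernelMass k h ≠ 0 := by
  classical
  intro hmass
  refine hpos.ne' ?_
  rw [limitIntegralExp, mul_eq_zero]
  right
  refine (lintegral_congr fun u => ?_).trans lintegral_zero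
  refine (lintegral_congr fun v => ?_).trans lintegral_zero
  refine (lintegral_congr_ae ?_).trans lintegral_zero
  filter_upwards [hh.ae_eq_zero_of_kernelMass hmass] with y hy
  simp [hy]

end Positivity

/-! ### Variance bounds for regularly varying tails and for light tails with ξ > 0 -/

section Regions

variable {m k : ℕ} {Ω : Type*} [MeasurableSpace Ω] {P : Measure Ω} [IsProbabilityMeasure P]
  {D : Set (Space m)} {θ : Space m} {g ψ : ℝ → ℝ} {h : ℝ → (Fin (k + 1) → Space m) → ℝ}
  {r t : ℕ → ℝ} {N : ℕ → Ω → Set (Space m)} {rlim α C : ℝ} {A : Space m ≃L[ℝ] Space m}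

theorem exists_ofReal_volume_ball {E : Type*} [NormedAddCommGroup E] [NormedSpace ℝ E]
    [MeasurableSpace E] [BorelSpace E] [FiniteDimensional ℝ E] (μ : Measure E) [μ.IsAddHaarMeasure]
    {R : ℝ} (hR : 0 < R) : ∃ B : ℝ, 0 < B ∧ μ (Metric.ball (0 : E) R) = ENNReal.ofReal B :=
  ⟨_, ENNReal.toReal_pos (Metric.measure_ball_pos _ _ hR).ne' measure_ball_lt_top.ne,
    (ENNReal.ofReal_toReal measure_ball_lt_top.ne).symm⟩

/-- The place where t = o(n^(1/d)) acts: it makes Q at most n, since Q is at most t^d in both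
regimes. -/
theorem eventually_pow_le (ht : Tendsto t atTop atTop)
    (hto : t =o[atTop] fun n : ℕ => (n : ℝ) ^ (1 / ((m : ℝ) + 1))) :
    ∀ᶠ n : ℕ in atTop, t n ^ (m + 1) ≤ n := by
  filter_upwards [hto.bound one_pos, ht.eventually_ge_atTop 0] with n hn htn
  rw [one_mul, Real.norm_of_nonneg htn, Real.norm_of_nonneg (by positivity)] at hn
  calc t n ^ (m + 1) ≤ ((n : ℝ) ^ (1 / ((m : ℝ) + 1))) ^ (m + 1) := by gcongr
    _ = n := by
      rw [← Real.rpow_natCast, ← Real.rpow_mul (Nat.cast_nonneg n)]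
      push_cast
      rw [one_div_mul_cancel (by positivity), Real.rpow_one]

theorem IsVonMises.qFn_le (hψ : IsVonMises ψ) : ∀ᶠ t in atTop, qFn m ψ t ≤ t ^ (m + 1) := by
  filter_upwards [hψ.scaleFn_div_tendsto.eventually (ge_mem_nhds zero_lt_one),
    eventually_gt_atTop 0] with t hat ht0
  have ha := hψ.scaleFn_pos ht0
  rw [div_le_one ht0] at hat
  rw [qFn_eq hψ ht0, pow_succ]
  gcongr
  rw [Real.sqrt_le_left ht0.le, sq]
  gcongr

/-- Here Q = t^d, and the region of high density is a pair of concentric balls of radii t and 2t. -/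
theorem variance_heavy (hDo : IsOpen D) (hDb : Bornology.IsBounded D)
    (hD0 : (0 : Space m) ∈ D) (hθ : ‖θ‖ = 1) (hh : IsUKernel k h)
    (hg0 : ∀ s, 0 ≤ s → 0 < g s) (hg : AntitoneOn g (Ici 0)) (hf : ∫ x, homDensity D g x = 1)
    (hN : ∀ n, IsPoissonProcess P (condIntensity D g θ (t n) n) (N n)) (hr : ∀ n, 0 < r n)
    (hrlim0 : 0 < rlim) (hrlim : Tendsto r atTop (𝓝 rlim)) (ht : Tendsto t atTop atTop)
    (hto : t =o[atTop] fun n : ℕ => (n : ℝ) ^ (1 / ((m : ℝ) + 1)))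
    (hα : (m : ℝ) + 1 < α) (hgv : IsRegVarying g α) :
    ((fun n => variance (fun ω => uStat k h (N n ω) (r n)) P)
        =O[atTop] fun n : ℕ => (n : ℝ) ^ (2 * k + 1) / (t n ^ (m + 1)) ^ (2 * k)) ∧
    (kernelMass k h ≠ 0 → (fun n : ℕ => (n : ℝ) ^ (2 * k + 1) / (t n ^ (m + 1)) ^ (2 * k))
      =O[atTop] fun n => variance (fun ω => uStat k h (N n ω) (r n)) P) := by
  obtain ⟨v, c, hc, hball⟩ := exists_ball_le_homDensity hDo hD0 hθ hg hg0 hgv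
  obtain ⟨K, hK, hZ⟩ := exists_lintegral_le_heavy hDo hDb hD0 hθ hg hg0 hgv hα
  obtain ⟨B, hB0, hB⟩ := exists_ofReal_volume_ball (volume : Measure (Space m)) one_pos
  have hvol : ∀ s, 0 ≤ s → volume (Metric.closedBall (s • v) s) =
      ENNReal.ofReal (B * s ^ (m + 1)) := fun s hs => by
    rw [Measure.addHaar_closedBall _ _ hs, hB, finrank_euclideanSpace_fin,
      ← ENNReal.ofReal_mul (by positivity), mul_comm]
  have hZ0 : ∀ᶠ n in atTop, ENNReal.ofReal (c * B * (t n ^ (m + 1) * g (t n))) ≤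
      ∫⁻ x in t n • outerHalfspace D θ, ENNReal.ofReal (homDensity D g x) := by
    filter_upwards [ht.eventually hball, ht.eventually_gt_atTop 0] with n ⟨hn1, hn2⟩ htn
    have hgt := hg0 _ htn.le
    have hsub : Metric.closedBall (t n • v) (t n) ⊆ Metric.closedBall (t n • v) (2 * t n) :=
      Metric.closedBall_subset_closedBall (by linarith)
    calc _ = ∫⁻ x in Metric.closedBall (t n • v) (t n), ENNReal.ofReal (c * g (t n)) := by
          rw [setLIntegral_const, hvol _ htn.le, ← ENNReal.ofReal_mul (by positivity)]
          congr 1; ring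
      _ ≤ ∫⁻ x in Metric.closedBall (t n • v) (t n), ENNReal.ofReal (homDensity D g x) :=
          setLIntegral_mono' Metric.isClosed_closedBall.measurableSet fun x hx =>
            ENNReal.ofReal_le_ofReal (hn2 x (hsub hx))
      _ ≤ _ := lintegral_mono_set (hsub.trans hn1)
  have hQ : ∀ᶠ n : ℕ in atTop, 0 < t n ^ (m + 1) := by
    filter_upwards [ht.eventually_gt_atTop 0] with n hn
    positivity
  refine ⟨isBigO_variance_of_le_mass hDo hDb hD0 hθ hh hg0 hg hf hN hr hrlim ht
    (hQ.and (eventually_pow_le ht hto)) (by positivity) hZ0, fun hmass => ?_⟩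
  refine isBigO_variance_rev_of_region hh hg0 hf hN hr hrlim0 hrlim ht hQ hmass
    (by positivity) hK hZ0 (ht.eventually hZ) fun ρ hρ => ⟨c, B, hc, hB0, ?_⟩
  filter_upwards [ht.eventually hball, ht.eventually_ge_atTop ρ] with n ⟨hn1, hn2⟩ htn
  refine ⟨_, _, Metric.isClosed_closedBall.measurableSet,
    Metric.isClosed_closedBall.measurableSet, fun x hx => ?_, hn1, hn2,
    (hvol (t n) (hρ.le.trans htn)).ge⟩
  exact Metric.closedBall_subset_closedBall' (by linarith [Metric.mem_closedBall.1 hx])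

/-- With a bounded below, both box sizes √(at) and a are eventually at least constant multiples of
the kernel range, so enlarging the box by the range keeps the density of order g(t). -/
theorem variance_exp (hDo : IsOpen D) (hDb : Bornology.IsBounded D) (hDc : Convex ℝ D)
    (hD0 : (0 : Space m) ∈ D) (hθ : ‖θ‖ = 1) (hh : IsUKernel k h)
    (hg0 : ∀ s, 0 ≤ s → 0 < g s) (hf : ∫ x, homDensity D g x = 1)
    (hN : ∀ n, IsPoissonProcess P (condIntensity D g θ (t n) n) (N n)) (hr : ∀ n, 0 < r n)
    (hrlim0 : 0 < rlim) (hrlim : Tendsto r atTop (𝓝 rlim)) (ht : Tendsto t atTop atTop)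
    (hto : t =o[atTop] fun n : ℕ => (n : ℝ) ^ (1 / ((m : ℝ) + 1)))
    (hA : IsInitialTransformation D θ A) (hC : 0 < C) (hψ : IsVonMises ψ)
    (hg : ∀ s, 0 ≤ s → g s = C * Real.exp (-ψ s)) {a₀ : ℝ} (ha₀ : 0 < a₀)
    (ha : ∀ᶠ n in atTop, a₀ ≤ scaleFn ψ (t n)) :
    ((fun n => variance (fun ω => uStat k h (N n ω) (r n)) P)
        =O[atTop] fun n : ℕ => (n : ℝ) ^ (2 * k + 1) / qFn m ψ (t n) ^ (2 * k)) ∧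
    (kernelMass k h ≠ 0 → (fun n : ℕ => (n : ℝ) ^ (2 * k + 1) / qFn m ψ (t n) ^ (2 * k))
      =O[atTop] fun n => variance (fun ω => uStat k h (N n ω) (r n)) P) := by
  obtain ⟨c₀, hc₀, hZ0⟩ := exists_ofReal_le_lintegral_light hDo hDc hD0 hA hC hψ hg
  obtain ⟨K, hK, hZ⟩ := exists_lintegral_le_light hDo hDb hDc hD0 hθ hA hC hψ hg
  have hQ : ∀ᶠ n : ℕ in atTop, 0 < qFn m ψ (t n) := by
    filter_upwards [ht.eventually_gt_atTop 0] with n hn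
    exact qFn_pos hψ hn
  refine ⟨isBigO_variance_of_le_mass hDo hDb hD0 hθ hh hg0 (hψ.antitoneOn hC hg) hf hN hr hrlim ht
    (hQ.and ?_) hc₀ (ht.eventually hZ0), fun hmass => ?_⟩
  · filter_upwards [ht.eventually hψ.qFn_le, eventually_pow_le ht hto] with n h1 h2
    exact h1.trans h2
  refine isBigO_variance_rev_of_region hh hg0 hf hN hr hrlim0 hrlim ht hQ hmass
    hc₀ hK (ht.eventually hZ0) (ht.eventually hZ) fun ρ hρ => ?_
  obtain ⟨J, hJ0, hJ⟩ : ∃ J : ℝ, 0 < J ∧ ∀ x, ‖(coordL A).symm x‖ ≤ J * ‖x‖ :=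
    ((coordL A).symm : Space m →L[ℝ] Horiz m × ℝ).bound
  -- Jρ bounds the coordinates of vectors of length ρ, and V a ≥ Jρ. The inner box is lifted by V a
  -- so that its ρ-neighbourhood stays above height t.
  set V := J * ρ / a₀ with hV
  have hV0 : 0 < V := by positivity
  have hR2 : (2 : ℝ) ≤ 2 * V + 2 := by linarith
  obtain ⟨c, hc, hdens⟩ := exists_le_homDensity hDo hDc hD0 hA hC hψ hg
    (show 0 ≤ 2 * V + 2 by positivity)
  obtain ⟨κ, hκ, hvol, -⟩ := exists_volume_coordL A
  obtain ⟨B, hB0, hB⟩ := exists_ofReal_volume_ball (volume : Measure (Horiz m)) one_pos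
  refine ⟨c, κ * B, hc, by positivity, ?_⟩
  filter_upwards [ht.eventually hdens, ha, ht.eventually_gt_atTop 0,
    ht.eventually_ge_atTop ((J * ρ) ^ 2 / a₀)] with n hn han htn htn'
  have ha0 : 0 < scaleFn ψ (t n) := ha₀.trans_le han
  set a := scaleFn ψ (t n) with had
  set b := √(a * t n) with hb
  have hb0 : 0 < b := by positivity
  have hJb : J * ρ ≤ b := by
    refine Real.le_sqrt_of_sq_le ?_
    rw [div_le_iff₀ ha₀] at htn'
    nlinarith
  have hJV : J * ρ ≤ V * a := by
    rw [hV, div_mul_eq_mul_div, le_div_iff₀ ha₀]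
    gcongr
  refine ⟨coordL A '' (Metric.ball 0 (b * 1) ×ˢ Icc (t n + V * a) (t n + V * a + a)),
    coordL A '' (Metric.closedBall 0 (2 * b) ×ˢ Icc (t n) (t n + (2 * V + 2) * a)),
    measurableSet_coordL_image A (Metric.isOpen_ball.measurableSet.prod measurableSet_Icc),
    measurableSet_coordL_image A (Metric.isClosed_closedBall.measurableSet.prod measurableSet_Icc),
    ?_, ?_, ?_, ?_⟩
  · rintro _ ⟨⟨w, s⟩, ⟨hw, hs⟩, rfl⟩ y hy
    refine ⟨(coordL A).symm y, ?_, by simp⟩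
    obtain ⟨⟨w', s'⟩, rfl⟩ := (coordL A).surjective y
    rw [ContinuousLinearEquiv.symm_apply_apply]
    have h1 : ‖(w', s') - (w, s)‖ ≤ J * ρ := by
      have := hJ (coordL A (w', s') - coordL A (w, s))
      rw [map_sub, ContinuousLinearEquiv.symm_apply_apply,
        ContinuousLinearEquiv.symm_apply_apply, ← dist_eq_norm (coordL A _)] at this
      exact this.trans (by gcongr; exact hy)
    have h2 : ‖w' - w‖ ≤ J * ρ := (norm_fst_le ((w', s') - (w, s))).trans h1
    have h3 : |s' - s| ≤ J * ρ := (norm_snd_le ((w', s') - (w, s))).trans h1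
    have hw1 := (mem_ball_zero_iff.1 hw)
    have h4 := norm_le_norm_add_norm_sub' w' w
    have h5 := abs_le.1 h3
    have hs1 := hs.1
    have hs2 := hs.2
    simp only at hs1 hs2 hw1
    refine ⟨mem_closedBall_zero_iff.2 ?_, ?_, ?_⟩
    · simp only; linarith
    · simp only; linarith
    · simp only; linarith
  · rintro _ ⟨⟨w, s⟩, ⟨hw, hs⟩, rfl⟩
    exact (hA.mem_smul_iff htn w s).2 hs.1
  · rintro _ ⟨⟨w, s⟩, ⟨hw, hs⟩, rfl⟩
    refine hn w s ((mem_closedBall_zero_iff.1 hw).trans ?_) hs.1 hs.2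
    gcongr
  · rw [hvol _ (Metric.isOpen_ball.measurableSet.prod measurableSet_Icc), volume_box _ hb0, hB,
      ← ENNReal.ofReal_mul (by positivity), ← ENNReal.ofReal_mul (by positivity), qFn_eq hψ htn]
    refine ENNReal.ofReal_le_ofReal (le_of_eq ?_)
    ring

end Regions

/-! ### Variance bounds for light tails with ξ = 0 and β < ∞ -/

section LightTails

variable {m k : ℕ} {Ω : Type*} [MeasurableSpace Ω] {P : Measure Ω} [IsProbabilityMeasure P]
  {D : Set (Space m)} {θ : Space m} {g ψ : ℝ → ℝ} {h : ℝ → (Fin (k + 1) → Space m) → ℝ}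
  {r t : ℕ → ℝ} {N : ℕ → Ω → Set (Space m)} {rlim β C : ℝ} {A : Space m ≃L[ℝ] Space m}

/-- Take Q = 1: every ball has mass at most the total mass, which is at most n. -/
theorem isBigO_variance_lite (hh : IsUKernel k h)
    (hg0 : ∀ s, 0 ≤ s → 0 < g s) (hf : ∫ x, homDensity D g x = 1)
    (hN : ∀ n, IsPoissonProcess P (condIntensity D g θ (t n) n) (N n)) (hr : ∀ n, 0 < r n) :
    (fun n => variance (fun ω => uStat k h (N n ω) (r n)) P)
        =O[atTop] fun n : ℕ => (n : ℝ) ^ (2 * k + 1) := by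
  obtain ⟨κ, -, hκ⟩ := hh.exists_dist_le
  have := isBigO_variance_uStat (Q := fun _ => 1) (C := 1) hh hg0 hf hN hr hκ
    (by
      filter_upwards [eventually_ge_atTop 1] with n hn
      exact ⟨one_pos, by rw [one_mul]; exact_mod_cast hn⟩)
    (Eventually.of_forall fun n x => by
      rw [one_mul, div_one]
      exact (measure_mono (subset_univ _)).trans (condIntensity_univ_le hg0 hf _ _))
  simpa using this

/-- Otherwise the kernel would vanish at all continuity configurations, that is almost everywhere,
and the integral would be 0. -/
theorem exists_pos_of_limitIntegralLite (hh : IsUKernel k h) (hrlim0 : 0 < rlim)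
    (hcont : ∀ᵐ u : Fin (k + 1) → Horiz m,
      ContinuousAt (h rlim) (fun i => A (joinUV (β • u i) 0)))
    (hpos : 0 < limitIntegralLite k h A rlim β) :
    ∃ u : Fin (k + 1) → Horiz m, ContinuousAt (h rlim) (fun i => A (joinUV (β • u i) 0)) ∧
      0 < h rlim (fun i => A (joinUV (β • u i) 0)) := by
  by_contra! hne
  refine hpos.ne' ?_
  have h0 : ∀ᵐ u : Fin (k + 1) → Horiz m, h rlim (fun i => A (joinUV (β • u i) 0)) = 0 := by
    filter_upwards [hcont] with u hu
    exact le_antisymm (hne u hu) (hh.nonneg _ hrlim0.le _)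
  have hmp := volume_preserving_piFinSuccAbove (fun _ : Fin (k + 1) => Horiz m) 0
  have h1 := (hmp.symm).quasiMeasurePreserving.ae h0
  rw [Measure.volume_eq_prod] at h1
  have h2 := Measure.ae_ae_of_ae_prod h1
  rw [limitIntegralLite, mul_eq_zero]
  right
  refine (lintegral_congr_ae ?_).trans lintegral_zero
  filter_upwards [h2] with u₀ hu₀
  refine (lintegral_congr_ae ?_).trans lintegral_zero
  filter_upwards [hu₀] with u hu
  have hins : (MeasurableEquiv.piFinSuccAbove (fun _ : Fin (k + 1) => Horiz m) 0).symm
      (u₀, u) = Fin.cons u₀ u := Fin.insertNth_zero' u₀ u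
  rw [hins] at hu
  simp [hu]

/-- Translation invariance removes the height τ and a dilation replaces r_n by r. The rescaled tuple
is then near the flat one, since the thickness tends to 0, the horizontal scale to β, and σ is
small; continuity concludes. -/
theorem exists_le_kernel_near (hh : IsUKernel k h) (hrlim0 : 0 < rlim) (hr : ∀ n, 0 < r n)
    (hrlim : Tendsto r atTop (𝓝 rlim)) {a b : ℕ → ℝ} (ha : ∀ᶠ n in atTop, 0 < a n)
    (ha0 : Tendsto a atTop (𝓝 0)) (hb : Tendsto b atTop (𝓝 β)) (hb0 : ∀ᶠ n in atTop, 0 < b n)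
    {u : Fin (k + 1) → Horiz m}
    (hcont : ContinuousAt (h rlim) (fun i => A (joinUV (β • u i) 0)))
    (hpos : 0 < h rlim (fun i => A (joinUV (β • u i) 0))) :
    ∃ δ σ : ℝ, 0 < δ ∧ 0 < σ ∧ ∀ᶠ n in atTop, ∀ (τ : ℝ) (w : Fin (k + 1) → Horiz m)
      (s : Fin (k + 1) → ℝ), (∀ i, w i ∈ Metric.ball (b n • u i) (b n * σ)) →
      (∀ i, s i ∈ Icc τ (τ + a n)) → δ ≤ h (r n) fun i => coordL A (w i, s i) := by
  set x₀ : Fin (k + 1) → Space m := fun i => A (joinUV (β • u i) 0) with hx₀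
  obtain ⟨ε, hε, hball⟩ := Metric.eventually_nhds_iff.1
    (hcont.eventually (lt_mem_nhds (half_lt_self hpos)))
  obtain ⟨J, hJ0, hJ⟩ : ∃ J : ℝ, 0 < J ∧ ∀ z, ‖coordL A z‖ ≤ J * ‖z‖ :=
    (coordL A : Horiz m × ℝ →L[ℝ] Space m).bound
  have hβ : 0 ≤ β := ge_of_tendsto hb (hb0.mono fun _ h => h.le)
  set ε' := ε / (2 * J) with hε'
  have hε'0 : 0 < ε' := by positivity
  have hJε : J * ε' < ε := by rw [hε']; field_simp; linarith
  refine ⟨_, ε' / (2 * (β + 1)), half_pos hpos, by positivity, ?_⟩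
  have hc : Tendsto (fun n => rlim / r n) atTop (𝓝 1) := by
    have := (tendsto_const_nhds (x := rlim)).div hrlim hrlim0.ne'
    rwa [div_self hrlim0.ne'] at this
  have hcb : Tendsto (fun n => rlim / r n * b n) atTop (𝓝 β) := by simpa using hc.mul hb
  have hca : Tendsto (fun n => rlim / r n * a n) atTop (𝓝 0) := by simpa using hc.mul ha0
  have hcb' : Tendsto (fun n => |rlim / r n * b n - β| * ‖u‖) atTop (𝓝 0) := by
    have := ((hcb.sub_const β).abs).mul_const ‖u‖
    simpa using this
  filter_upwards [ha, hb0, hcb.eventually (gt_mem_nhds (lt_add_one β)),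
    hca.eventually (gt_mem_nhds hε'0), hcb'.eventually (gt_mem_nhds (half_pos hε'0))]
    with n han hbn hcbn hcan hcbn' τ w s hw hs
  have hrn := hr n
  set c := rlim / r n with hcd
  have hc0 : 0 < c := by positivity
  have hshift : h (r n) (fun i => coordL A (w i, s i)) =
      h (r n) (fun i => coordL A (w i, s i - τ)) := by
    rw [← hh.translation_invariant (r n) hrn.le (coordL A (0, τ))
      (fun i => coordL A (w i, s i - τ))]
    congr 1 with i : 1
    rw [← map_add]
    simp
  have hscale : ∀ x, h (r n) x = h rlim (c • x) := fun x => by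
    rw [hh.eq_one hrn, hh.eq_one hrlim0, smul_smul]
    congr 2
    rw [hcd]; field_simp
  rw [hshift, hscale]
  refine (hball ?_).le
  rw [dist_pi_lt_iff hε]
  intro i
  have e : (c • fun i => coordL A (w i, s i - τ)) i - x₀ i =
      coordL A (c • w i - β • u i, c * (s i - τ)) := by
    rw [Pi.smul_apply, ← map_smul, hx₀]
    simp only [← coordL_apply]
    rw [← map_sub]
    simp
  rw [dist_eq_norm, e]
  refine ((hJ _).trans (mul_le_mul_of_nonneg_left ?_ hJ0.le)).trans_lt hJε
  refine max_le ?_ ?_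
  · have h1 : c • w i - β • u i = c • (w i - b n • u i) + (c * b n - β) • u i := by
      module
    have h2 : ‖w i - b n • u i‖ ≤ b n * (ε' / (2 * (β + 1))) := by
      rw [← dist_eq_norm]; exact (Metric.mem_ball.1 (hw i)).le
    rw [h1]
    refine (norm_add_le _ _).trans ?_
    rw [norm_smul, norm_smul, Real.norm_eq_abs, Real.norm_eq_abs, abs_of_pos hc0]
    have h3 : c * ‖w i - b n • u i‖ ≤ ε' / 2 := by
      calc c * ‖w i - b n • u i‖ ≤ c * (b n * (ε' / (2 * (β + 1)))) := by gcongr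
        _ = (c * b n) * (ε' / (2 * (β + 1))) := by ring
        _ ≤ (β + 1) * (ε' / (2 * (β + 1))) := by gcongr
        _ = ε' / 2 := by field_simp
    have h4 : |c * b n - β| * ‖u i‖ ≤ ε' / 2 :=
      (mul_le_mul_of_nonneg_left (norm_le_pi_norm u i) (abs_nonneg _)).trans hcbn'.le
    linarith
  · obtain ⟨h1, h2⟩ := hs i
    rw [Real.norm_eq_abs, abs_of_nonneg (mul_nonneg hc0.le (by linarith))]
    refine le_trans ?_ hcan.le
    gcongr
    linarith

/-- Each of the k+1 small boxes has volume of order q, hence intensity mass of order n, and h ≥ δ on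
their product. So the mean is at least of order n^(k+1). -/
theorem isBigO_variance_lite_rev (hDo : IsOpen D) (hDb : Bornology.IsBounded D) (hDc : Convex ℝ D)
    (hD0 : (0 : Space m) ∈ D) (hθ : ‖θ‖ = 1) (hh : IsUKernel k h)
    (hg0 : ∀ s, 0 ≤ s → 0 < g s) (hf : ∫ x, homDensity D g x = 1)
    (hN : ∀ n, IsPoissonProcess P (condIntensity D g θ (t n) n) (N n)) (hr : ∀ n, 0 < r n)
    (hrlim0 : 0 < rlim) (hrlim : Tendsto r atTop (𝓝 rlim)) (ht : Tendsto t atTop atTop)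
    (hA : IsInitialTransformation D θ A) (hC : 0 < C) (hψ : IsVonMises ψ)
    (hg : ∀ s, 0 ≤ s → g s = C * Real.exp (-ψ s))
    (ha : Tendsto (fun n => scaleFn ψ (t n)) atTop (𝓝 0))
    (hb : Tendsto (fun n => √(scaleFn ψ (t n) * t n)) atTop (𝓝 β))
    (hcont : ∀ᵐ u : Fin (k + 1) → Horiz m,
      ContinuousAt (h rlim) (fun i => A (joinUV (β • u i) 0)))
    (hpos : 0 < limitIntegralLite k h A rlim β) :
    (fun n : ℕ => (n : ℝ) ^ (2 * k + 1))
      =O[atTop] fun n => variance (fun ω => uStat k h (N n ω) (r n)) P := by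
  obtain ⟨u, hu1, hu2⟩ := exists_pos_of_limitIntegralLite hh hrlim0 hcont hpos
  have ha0 : ∀ᶠ n in atTop, 0 < scaleFn ψ (t n) := by
    filter_upwards [ht.eventually_gt_atTop 0] with n hn
    exact hψ.scaleFn_pos hn
  have hb0 : ∀ᶠ n in atTop, 0 < √(scaleFn ψ (t n) * t n) := by
    filter_upwards [ha0, ht.eventually_gt_atTop 0] with n hn hn'
    positivity
  obtain ⟨δ, σ, hδ, hσ, hnear⟩ :=
    exists_le_kernel_near hh hrlim0 hr hrlim ha0 ha hb hb0 hu1 hu2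
  obtain ⟨c₀, hc₀, hZ0⟩ := exists_ofReal_le_lintegral_light hDo hDc hD0 hA hC hψ hg
  obtain ⟨K, hK, hZ⟩ := exists_lintegral_le_light hDo hDb hDc hD0 hθ hA hC hψ hg
  -- Covers all boxes in natural units: horizontally they reach ‖u‖ + σ, vertically 1.
  set R := ‖u‖ + σ + 1 with hR
  have hR0 : 0 ≤ R := by positivity
  obtain ⟨c, hc, hdens⟩ := exists_le_homDensity hDo hDc hD0 hA hC hψ hg hR0
  obtain ⟨κ, hκ, hvol, -⟩ := exists_volume_coordL A
  obtain ⟨B, hB0, hB⟩ := exists_ofReal_volume_ball (volume : Measure (Horiz m)) hσ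
  have key := isBigO_variance_uStat_rev (Q := fun _ => 1) (c := δ * (c / K * κ * B) ^ (k + 1))
    hh hg0 hf hN hr (by positivity) (Eventually.of_forall fun _ => one_pos) ?_
  · simpa using key
  filter_upwards [hnear, ht.eventually hZ0, ht.eventually hZ, ht.eventually hdens,
    ht.eventually_gt_atTop 0] with n hnear hZ0n hZn hn htn
  have := isFiniteMeasure_condIntensity (θ := θ) hf (t n) n
  have han := hψ.scaleFn_pos htn
  have hq := qFn_pos (m := m) hψ htn
  have hgt := hg0 _ htn.le
  have hZpos := lt_of_lt_of_le
    (ENNReal.ofReal_pos.2 (show 0 < c₀ * (qFn m ψ (t n) * g (t n)) by positivity)) hZ0n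
  set b := √(scaleFn ψ (t n) * t n) with hbd
  have hbn : 0 < b := by positivity
  set E : Fin (k + 1) → Set (Horiz m × ℝ) := fun i =>
    Metric.ball (b • u i) (b * σ) ×ˢ Icc (t n) (t n + scaleFn ψ (t n)) with hE
  have hEm : ∀ i, MeasurableSet (E i) := fun i =>
    Metric.isOpen_ball.measurableSet.prod measurableSet_Icc
  have hmass : ∀ i, ENNReal.ofReal (n * (c / K * κ * B)) ≤
      condIntensity D g θ (t n) n (coordL A '' E i) := by
    intro i
    rw [← mul_assoc] at hZn
    have hm := measurableSet_coordL_image A (hEm i)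
    have hle := smul_restrict_le_condIntensity hg0 hf htn (c := c) n hZpos hZn hm
      (by
        rintro _ ⟨⟨w, s⟩, ⟨hw, hs⟩, rfl⟩
        exact (hA.mem_smul_iff htn w s).2 hs.1)
      (by
        rintro _ ⟨⟨w, s⟩, ⟨hw, hs⟩, rfl⟩
        refine hn w s ?_ hs.1 (hs.2.trans ?_)
        · have h1 : ‖w - b • u i‖ ≤ b * σ := by
            rw [← dist_eq_norm]; exact (Metric.mem_ball.1 hw).le
          have h2 := norm_le_norm_add_norm_sub' w (b • u i)
          rw [norm_smul, Real.norm_of_nonneg hbn.le] at h2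
          have h3 : b * ‖u i‖ ≤ b * ‖u‖ := by gcongr; exact norm_le_pi_norm u i
          rw [hR]
          nlinarith
        · have : scaleFn ψ (t n) ≤ R * scaleFn ψ (t n) :=
            le_mul_of_one_le_left han.le (by rw [hR]; linarith [norm_nonneg u])
          linarith)
    refine le_trans (le_of_eq ?_) (hle (coordL A '' E i))
    rw [Measure.smul_apply, Measure.restrict_apply hm, inter_self, smul_eq_mul, hvol _ (hEm i),
      hE, volume_box _ hbn, hB, ← qFn_eq hψ htn, ← ENNReal.ofReal_mul (by positivity),
      ← ENNReal.ofReal_mul (by positivity), ← ENNReal.ofReal_mul (by positivity)]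
    congr 1
    field_simp
  calc ENNReal.ofReal (δ * (c / K * κ * B) ^ (k + 1) * (n ^ (k + 1) / 1 ^ k)) =
        ENNReal.ofReal δ * ∏ _i : Fin (k + 1), ENNReal.ofReal (n * (c / K * κ * B)) := by
        rw [Finset.prod_const, Finset.card_univ, Fintype.card_fin,
          ← ENNReal.ofReal_pow (by positivity), ← ENNReal.ofReal_mul hδ.le, one_pow, div_one,
          mul_pow (n : ℝ)]
        congr 1
        ring
    _ ≤ ENNReal.ofReal δ * ∏ i, condIntensity D g θ (t n) n (coordL A '' E i) := by
        gcongr with i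
        exact hmass i
    _ = ∫⁻ _ in univ.pi fun i => coordL A '' E i, ENNReal.ofReal δ
          ∂Measure.pi fun _ : Fin (k + 1) => condIntensity D g θ (t n) n := by
        rw [setLIntegral_const, Measure.pi_pi]
    _ ≤ ∫⁻ x in univ.pi fun i => coordL A '' E i, ENNReal.ofReal (h (r n) x)
          ∂Measure.pi fun _ : Fin (k + 1) => condIntensity D g θ (t n) n := by
        refine setLIntegral_mono' (MeasurableSet.univ_pi fun i =>
          measurableSet_coordL_image A (hEm i)) fun x hx => ENNReal.ofReal_le_ofReal ?_
        choose z hz hzx using fun i => hx i (mem_univ i)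
        have e : x = fun i => coordL A ((z i).1, (z i).2) := funext fun i => (hzx i).symm
        rw [e]
        exact hnear (t n) _ _ (fun i => (hz i).1) (fun i => (hz i).2)
    _ ≤ _ := setLIntegral_le_lintegral _ _

end LightTails

/-! ### Assembly of the regimes -/

theorem corollaryc {m : ℕ} (k : ℕ) {Ω : Type*} [MeasurableSpace Ω]
    (P : Measure Ω) [IsProbabilityMeasure P]
    (D : Set (Space m)) (hD_open : IsOpen D) (hD_bdd : Bornology.IsBounded D)
    (hD_conv : Convex ℝ D) (hD_zero : (0 : Space m) ∈ D)
    (θ : Space m) (hθ : ‖θ‖ = 1)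
    (h : ℝ → (Fin (k + 1) → Space m) → ℝ) (hh : IsUKernel k h)
    (r : ℕ → ℝ) (hr_pos : ∀ n, 0 < r n) (rlim : ℝ) (hrlim : 0 < rlim)
    (hr : Tendsto r atTop (𝓝 rlim))
    (t : ℕ → ℝ) (ht : Tendsto t atTop atTop)
    (hto : t =o[atTop] fun n : ℕ => (n : ℝ) ^ (1 / ((m : ℝ) + 1)))
    (g : ℝ → ℝ) (hg_pos : ∀ s, 0 ≤ s → 0 < g s) (hf : ∫ x, homDensity D g x = 1)
    (N : ℕ → Ω → Set (Space m))
    (hN : ∀ n, IsPoissonProcess P (condIntensity D g θ (t n) n) (N n)) :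
    -- light tails
    (IsRotund D → (∃ A : Space m ≃L[ℝ] Space m, IsInitialTransformation D θ A) ∧
      ∀ (C : ℝ) (ψ : ℝ → ℝ), 0 < C → IsVonMises ψ →
      (∀ s, 0 ≤ s → g s = C * Real.exp (-ψ s)) →
      ∀ ξ : ℝ≥0∞, Tendsto (fun n => ENNReal.ofReal (scaleFn ψ (t n))) atTop (𝓝 ξ) →
      (∀ n, MemLp (fun ω => uStat k h (N n ω) (r n)) 2 P) ∧
      -- the case of `ξ = 0` and `β < ∞`
      (ξ = 0 → ∀ β : ℝ, Tendsto (fun n => √(scaleFn ψ (t n) * t n)) atTop (𝓝 β) →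
        ((fun n => variance (fun ω => uStat k h (N n ω) (r n)) P)
          =O[atTop] fun n : ℕ => (n : ℝ) ^ (2 * k + 1)) ∧
        (∀ A : Space m ≃L[ℝ] Space m, IsInitialTransformation D θ A →
          (∀ᵐ u : Fin (k + 1) → Horiz m,
            ContinuousAt (h rlim) (fun i => A (joinUV (β • u i) 0))) →
          0 < limitIntegralLite k h A rlim β →
          (fun n => variance (fun ω => uStat k h (N n ω) (r n)) P)
            =Θ[atTop] fun n : ℕ => (n : ℝ) ^ (2 * k + 1))) ∧
      -- the case of `ξ > 0`
      (0 < ξ →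
        ((fun n => variance (fun ω => uStat k h (N n ω) (r n)) P)
          =O[atTop] fun n : ℕ => (n : ℝ) ^ (2 * k + 1) / qFn m ψ (t n) ^ (2 * k)) ∧
        (∀ A : Space m ≃L[ℝ] Space m, IsInitialTransformation D θ A →
          0 < limitIntegralExp k h D A rlim (ξ⁻¹).toReal →
          (fun n => variance (fun ω => uStat k h (N n ω) (r n)) P)
            =Θ[atTop] fun n : ℕ => (n : ℝ) ^ (2 * k + 1) / qFn m ψ (t n) ^ (2 * k)))) ∧
    -- regularly varying tails
    (AntitoneOn g (Ici 0) → ∀ α : ℝ, (m : ℝ) + 1 < α → IsRegVarying g α →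
      (∀ n, MemLp (fun ω => uStat k h (N n ω) (r n)) 2 P) ∧
      ((fun n => variance (fun ω => uStat k h (N n ω) (r n)) P)
        =O[atTop] fun n : ℕ => (n : ℝ) ^ (2 * k + 1) / t n ^ (2 * (m + 1) * k)) ∧
      (0 < limitIntegralHeavy k h D θ α →
        (fun n => variance (fun ω => uStat k h (N n ω) (r n)) P)
          =Θ[atTop] fun n : ℕ => (n : ℝ) ^ (2 * k + 1) / t n ^ (2 * (m + 1) * k))) := by
  refine ⟨fun hD => ?_, fun hga α hα hgv => ?_⟩
  · refine ⟨exists_isInitialTransformation hD hθ, fun C ψ hC hψ hg ξ hξ => ?_⟩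
    refine ⟨memLp_uStat hh hf hN hr_pos, ?_, ?_⟩
    · rintro rfl β hβ
      have hup := isBigO_variance_lite (k := k) hh hg_pos hf hN hr_pos
      refine ⟨hup, fun A hA hcont hpos => ⟨hup, ?_⟩⟩
      have ha : Tendsto (fun n => scaleFn ψ (t n)) atTop (𝓝 0) := by
        have h1 := (ENNReal.tendsto_toReal ENNReal.zero_ne_top).comp hξ
        refine Tendsto.congr' ?_ h1
        filter_upwards [ht.eventually_gt_atTop 0] with n hn
        exact ENNReal.toReal_ofReal (hψ.scaleFn_pos hn).le
      exact isBigO_variance_lite_rev hD_open hD_bdd hD_conv hD_zero hθ hh hg_pos hf hN hr_pos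
        hrlim hr ht hA hC hψ hg ha hβ hcont hpos
    · intro hξ0
      -- A finite number strictly between 0 and ξ bounds a(t_n) from below eventually, also when ξ =
      -- ∞.
      obtain ⟨a₀, ha₀, ha₀ξ⟩ := ENNReal.lt_iff_exists_nnreal_btwn.1 hξ0
      have ha : ∀ᶠ n in atTop, (a₀ : ℝ) ≤ scaleFn ψ (t n) := by
        filter_upwards [hξ.eventually (lt_mem_nhds ha₀ξ)] with n hn
        by_contra hlt
        rw [← ENNReal.ofReal_coe_nnreal] at hn
        exact (ENNReal.ofReal_le_ofReal (not_le.1 hlt).le).not_gt hn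
      have ha₀' : (0 : ℝ) < a₀ := by exact_mod_cast ha₀
      -- The variance estimates can use any initial transformation: the given A enters only through
      -- the positivity of its integral, and what this says about the kernel mass does not depend on
      -- A.
      obtain ⟨A₀, hA₀⟩ := exists_isInitialTransformation hD hθ
      obtain ⟨hup, hlow⟩ := variance_exp hD_open hD_bdd hD_conv hD_zero hθ hh hg_pos hf hN hr_pos
        hrlim hr ht hto hA₀ hC hψ hg ha₀' ha
      exact ⟨hup, fun A _ hpos => ⟨hup, hlow (hh.kernelMass_ne_zero_of_exp hpos)⟩⟩
  · obtain ⟨hup, hlow⟩ := variance_heavy hD_open hD_bdd hD_zero hθ hh hg_pos hga hf hN hr_pos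
      hrlim hr ht hto hα hgv
    have e : ∀ n, (t n ^ (m + 1)) ^ (2 * k) = t n ^ (2 * (m + 1) * k) := fun n => by
      rw [← pow_mul]; congr 1; ring
    simp only [e] at hup hlow
    exact ⟨memLp_uStat hh hf hN hr_pos, hup,
      fun hpos => ⟨hup, hlow (hh.kernelMass_ne_zero_of_heavy hpos)⟩⟩
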